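/- **Basic operations.** Let $B$ be a set of one- and two-qubit quantum operations (finite-outcome instruments given by Kraus operators) that contains the measurement of a qubit in the computational basis and is universal: every one-qubit unitary is, up to a global phase, a finite product of one-qubit unitaries in $B$, and every two-qubit unitary is, up to a global phase, a finite product of unitaries in $B$ applied to one or both of the two qubits (in either order). **Circuits.** A circuit with a classical controller is given by a randomized polynomial-time machine. The machine receives a bit string $x$, the number $m\ge 0$ of qubits holding a quantum input (in unary), a random seed whose length is a fixed polynomial evaluated at $|x|+m$, and the outcomes of the timesteps performed so far. It outputs either a finite list of operations from $B$ (called by name, according to a table that belongs to the circuit) on disjoint sets of qubits, which form the next timestep, or a stop symbol. Its running time is polynomial in the size of what it receives. All qubits other than the $m$ input qubits start in $|0\rangle$. - In the *CCAC* model the qubits are indexed by $\mathbb N$, the input qubits are $0,\dots,m-1$, and two-qubit operations may act on any two qubits. - In the *2-D CCNTC* model the qubits are the points of $\mathbb Z^2$, the input qubits are $(0,0),\dots,(0,m-1)$, and two-qubit operations act only on neighbouring grid points. For given input length $|x|=\ell$ and given $m$, the *depth* is the maximal number of timesteps and the *size* the maximal number of operations, over all $x$ of length $\ell$, all seeds and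 all outcomes of positive probability. For each $x$ let $A_x$ be the set of the $m$ input qubits and of all qubits acted on for some seed and some outcomes of positive probability. The *width* is $\max_{|x|=\ell}|A_x|$ for CCAC, and for CCNTC the maximum over $|x|=\ell$ of the number of points of the smallest square grid containing $A_x$. (All values may be infinite.) **Simulation.** A CCNTC circuit $C'$ *simulates* a CCAC circuit $C$ if it uses seeds of the same length and there are polynomial-time computable maps, one decoding the outcomes of $C'$ into outcomes of $C$, and one giving, for $x$, $m$, the seed and the outcomes of $C$, an injective assignment of grid points to the qubits of $C$ which sends every input qubit $j<m$ to $(0,j)$, such that the following holds. For all $x$, $m$, all seeds, every density matrix of the $m$ input qubits, and every sequence $h$ of outcomes after which $C$ stops, the sum of the unnormalised final states of $C'$ over all outcomes after which $C'$ stops and which decode to $h$ equals the unnormalised final state of $C$ for $h$, with each qubit of $C$ placed at its assigned grid point and all other grid points in $|0\rangle$. **Theorem.** There are a constant $K$ and finitely many basic operations, depending only on $B$, such that every CCAC circuit $C$ over $B$ is simulated by a 2-D CCNTC circuit $C'$ over $B$ whose table of basic operations is that of $C$ preceded by these finitely many operations, and such that for all $\ell$ and $m$: if $d$, $s$, $n$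 are the depth, size and width of $C$, then $C'$ has depth at most $Kd$, size at most $K s n$ and width at most $n^2$. -/

import Mathlib

open scoped Kronecker ComplexOrder

/-! ### The classical machine model: structured programs over binary trees, with a step count -/

namespace CC

/-- Binary trees, the data on which the classical controller computes. -/
inductive Data : Type
  | nil : Data
  | node : Data → Data → Data

namespace Data

/-- Number of nodes and leaves of a tree. -/
def size : Data → ℕ
  | nil => 1
  | node a b => a.size + b.size + 1

def head : Data → Data
  | nil => nil
  | node a _ => a

def tail : Data → Data
  | nil => nil
  | node _ b => b

end Data

/-- Programs. Each program transforms one tree into another. `cond c p q` branches on whether the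
value of `c` is `nil`; `loop c p` repeats `p` as long as the value of `c` is not `nil`. -/
inductive Prog : Type
  | id : Prog
  | nil : Prog
  | head : Prog
  | tail : Prog
  | cons : Prog → Prog → Prog
  | comp : Prog → Prog → Prog
  | cond : Prog → Prog → Prog → Prog
  | loop : Prog → Prog → Prog

/-- `Run p v w t`: on the tree `v` the program `p` halts with the tree `w` after time `t`.
Every instruction is charged at least the size of the tree it reads, so that the time also bounds
the size of the result and of all intermediate trees. -/
inductive Run : Prog → Data → Data → ℕ → Prop
  | id (v : Data) : Run Prog.id v v v.size
  | nil (v : Data) : Run Prog.nil v Data.nil v.size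
  | head (v : Data) : Run Prog.head v v.head v.size
  | tail (v : Data) : Run Prog.tail v v.tail v.size
  | cons {p q : Prog} {v a b : Data} {s t : ℕ} (hp : Run p v a s) (hq : Run q v b t) :
      Run (Prog.cons p q) v (Data.node a b) (v.size + s + t + 1)
  | comp {p q : Prog} {v w u : Data} {s t : ℕ} (hq : Run q v w s) (hp : Run p w u t) :
      Run (Prog.comp p q) v u (v.size + s + t)
  | condTrue {c p q : Prog} {v a b w : Data} {s t : ℕ} (hc : Run c v (Data.node a b) s)
      (hp : Run p v w t) : Run (Prog.cond c p q) v w (v.size + s + t)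
  | condFalse {c p q : Prog} {v w : Data} {s t : ℕ} (hc : Run c v Data.nil s)
      (hq : Run q v w t) : Run (Prog.cond c p q) v w (v.size + s + t)
  | loopStop {c p : Prog} {v : Data} {s : ℕ} (hc : Run c v Data.nil s) :
      Run (Prog.loop c p) v v (v.size + s)
  | loopStep {c p : Prog} {v a b w u : Data} {s t r : ℕ} (hc : Run c v (Data.node a b) s)
      (hp : Run p v w t) (hr : Run (Prog.loop c p) w u r) :
      Run (Prog.loop c p) v u (v.size + s + t + r)

/-- A type whose elements are written down as trees. -/
class Coded (α : Type) where
  code : α → Data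
  code_injective : Function.Injective code

open Coded

instance : Coded Bool where
  code b := if b then Data.node Data.nil Data.nil else Data.nil
  code_injective := by intro a b h; cases a <;> cases b <;> simp_all

instance {α β : Type} [Coded α] [Coded β] : Coded (α × β) where
  code p := Data.node (code p.1) (code p.2)
  code_injective := by
    rintro ⟨a, b⟩ ⟨c, d⟩ h
    simp only [Data.node.injEq] at h
    exact Prod.ext (code_injective h.1) (code_injective h.2)

def codeList {α : Type} [Coded α] : List α → Data
  | [] => Data.nil
  | a :: l => Data.node (code a) (codeList l)

instance {α : Type} [Coded α] : Coded (List α) where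
  code := codeList
  code_injective := by
    intro l
    induction l with
    | nil => intro l' h; cases l' <;> simp_all [codeList]
    | cons a l ih =>
      intro l' h
      cases l' with
      | nil => simp [codeList] at h
      | cons b l' =>
        simp only [codeList, Data.node.injEq] at h
        rw [code_injective h.1, ih h.2]

instance {α : Type} [Coded α] : Coded (Option α) where
  code o := match o with
    | none => Data.nil
    | some a => Data.node Data.nil (code a)
  code_injective := by
    intro a b h
    cases a <;> cases b <;> simp_all
    exact code_injective h

/-- Natural numbers are written in binary. -/
instance : Coded ℕ where
  code n := code n.bits
  code_injective := by
    intro a b h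
    have h' : a.bits = b.bits := code_injective h
    have key : ∀ n : ℕ, n.bits.foldr (fun b k => Nat.bit b k) 0 = n := by
      intro n
      induction n using Nat.binaryRec' with
      | zero => simp
      | bit b n hn ih => rw [Nat.bits_append_bit n b hn]; simp [ih]
    rw [← key a, ← key b, h']

instance : Coded ℤ where
  code z := code (decide (z < 0), z.natAbs)
  code_injective := by
    intro a b h
    have h' := code_injective h
    simp only [Prod.mk.injEq, decide_eq_decide] at h'
    omega

/-- `f` is computed by a program whose running time is bounded by a polynomial in the size of the
argument. -/
def PolyTime {α β : Type} [Coded α] [Coded β] (f : α → β) : Prop :=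
  ∃ (p : Prog) (P : Polynomial ℕ), ∀ a : α,
    ∃ t : ℕ, t ≤ P.eval (code a).size ∧ Run p (code a) (code (f a)) t

/-! ### Quantum operations -/

/-- A quantum operation with classical outcomes on a system with basis `ι`: the outcomes are
`0, …, kraus.length - 1`, and outcome `o` is described by the Kraus operators in the `o`-th list. -/
structure Instrument (ι : Type) [Fintype ι] [DecidableEq ι] where
  kraus : List (List (Matrix ι ι ℂ))
  complete : (kraus.flatten.map fun K => K.conjTranspose * K).sum = 1

/-- A set of basic operations: one-qubit operations and two-qubit operations. -/
structure GateSet where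
  one : Set (Instrument Bool)
  two : Set (Instrument (Bool × Bool))

namespace GateSet

/-- The one-qubit unitaries among the basic operations. -/
def unitary₁ (B : GateSet) : Set (Matrix Bool Bool ℂ) :=
  {V | ∃ E ∈ B.one, E.kraus = [[V]]}

/-- The operators on two qubits obtained by applying one unitary basic operation, a two-qubit
operation being applied in either order of the two qubits. -/
def unitary₂ (B : GateSet) : Set (Matrix (Bool × Bool) (Bool × Bool) ℂ) :=
  {W | (∃ V ∈ B.unitary₁, W = V ⊗ₖ (1 : Matrix Bool Bool ℂ)) ∨
    (∃ V ∈ B.unitary₁, W = (1 : Matrix Bool Bool ℂ) ⊗ₖ V) ∨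
    (∃ E ∈ B.two, E.kraus = [[W]]) ∨
    (∃ E ∈ B.two, E.kraus = [[W.submatrix Prod.swap Prod.swap]])}

/-- Every one- or two-qubit unitary can be constructed (up to a global phase) as a finite product
of basic operations. -/
structure IsUniversal (B : GateSet) : Prop where
  one : ∀ U ∈ Matrix.unitaryGroup Bool ℂ,
    ∃ gs : List (Matrix Bool Bool ℂ), (∀ V ∈ gs, V ∈ B.unitary₁) ∧
      ∃ z : ℂ, ‖z‖ = 1 ∧ gs.prod = z • U
  two : ∀ U ∈ Matrix.unitaryGroup (Bool × Bool) ℂ,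
    ∃ gs : List (Matrix (Bool × Bool) (Bool × Bool) ℂ), (∀ W ∈ gs, W ∈ B.unitary₂) ∧
      ∃ z : ℂ, ‖z‖ = 1 ∧ gs.prod = z • U

/-- The measurement of a qubit in the computational basis is a basic operation. -/
def HasMeasurement (B : GateSet) : Prop :=
  ∃ E ∈ B.one, E.kraus = [[Matrix.single false false 1], [Matrix.single true true 1]]

end GateSet

/-- The (unnormalised) density operator of qubits indexed by `Q`, through its matrix entries in the
computational basis; all but finitely many of the qubits will be in the state `|0⟩`. -/
abbrev QState (Q : Type) : Type := (Q → Bool) → (Q → Bool) → ℂ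

namespace QState

/-- `ρ ↦ K ρ K†`, the operator `K` acting on qubit `q`. -/
def conj₁ {Q : Type} [DecidableEq Q] (K : Matrix Bool Bool ℂ) (q : Q) (ρ : QState Q) : QState Q :=
  fun c c' => ∑ u : Bool, ∑ v : Bool,
    K (c q) u * ρ (Function.update c q u) (Function.update c' q v) * star (K (c' q) v)

/-- `ρ ↦ K ρ K†`, the operator `K` acting on the qubits `a`, `b` (in this order). -/
def conj₂ {Q : Type} [DecidableEq Q] (K : Matrix (Bool × Bool) (Bool × Bool) ℂ) (a b : Q)
    (ρ : QState Q) : QState Q :=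
  fun c c' => ∑ u : Bool × Bool, ∑ v : Bool × Bool,
    K (c a, c b) u *
      ρ (Function.update (Function.update c a u.1) b u.2)
        (Function.update (Function.update c' a v.1) b v.2) *
      star (K (c' a, c' b) v)

open Classical in
/-- Place qubit `a` at `f a`, for an injective `f`; all qubits outside the range of `f` are in the
state `|0⟩`. -/
noncomputable def place {A Q : Type} (f : A → Q) (ρ : QState A) : QState Q :=
  fun c c' => if ∀ q, q ∉ Set.range f → c q = false ∧ c' q = false
    then ρ (c ∘ f) (c' ∘ f) else 0

end QState

/-- Density matrices of `m` qubits. -/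
def IsDensity {m : ℕ} (ρ : QState (Fin m)) : Prop :=
  (Matrix.of ρ).PosSemidef ∧ (Matrix.of ρ).trace = 1

/-! ### Circuits with a classical controller -/

/-- One operation to be applied: the name of a basic operation and the qubit(s) it acts on. -/
inductive Instr (Q : Type) : Type
  | one (g : ℕ) (q : Q) : Instr Q
  | two (g : ℕ) (a b : Q) : Instr Q

instance {Q : Type} [Coded Q] : Coded (Instr Q) where
  code i := match i with
    | Instr.one g q => code (false, g, q)
    | Instr.two g a b => code (true, g, a, b)
  code_injective := by
    intro i j h
    cases i with
    | one g q =>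
      cases j with
      | one g' q' => simpa using code_injective (α := Bool × ℕ × Q) h
      | two g' a' b' => simp [code] at h
    | two g a b =>
      cases j with
      | one g' q' => simp [code] at h
      | two g' a' b' => simpa using code_injective (α := Bool × ℕ × Q × Q) h

/-- The qubits an operation acts on. -/
def Instr.qubits {Q : Type} : Instr Q → List Q
  | one _ q => [q]
  | two _ a b => [a, b]

/-- What the controller is given at the start: the classical input `x`, the number `m` of qubits
that hold a quantum input, and the random seed `r`. -/
structure Input where
  x : List Bool
  m : ℕ
  r : List Bool

/-- The number of input qubits is written in unary. -/
instance : Coded Input where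
  code i := code (i.x, List.replicate i.m false, i.r)
  code_injective := by
    rintro ⟨x, m, r⟩ ⟨x', m', r'⟩ h
    have h' := code_injective h
    simp only [Prod.mk.injEq] at h'
    obtain ⟨h1, h2, h3⟩ := h'
    have := congrArg List.length h2
    simp at this
    simp [h1, this, h3]

/-- The outcomes of the timesteps performed so far, the latest timestep first; each entry lists the
outcomes of the operations of that timestep in order (an operation that is not a measurement has
the single outcome `0`). -/
abbrev History : Type := List (List ℕ)

/-- A quantum circuit with a classical controller, on qubits indexed by `Q`, with basic operations
from `B`, in which a two-qubit operation on `a`, `b` requires `adj a b`. -/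
structure Circuit (B : GateSet) (Q : Type) [Coded Q] (adj : Q → Q → Prop) where
  /-- The basic operations named by the numbers that the controller writes. -/
  one : ℕ → Instrument Bool
  one_mem : ∀ g, one g ∈ B.one
  two : ℕ → Instrument (Bool × Bool)
  two_mem : ∀ g, two g ∈ B.two
  /-- The seed has length `seedLen (|x| + m)`. -/
  seedLen : Polynomial ℕ
  /-- The operations of the next timestep, or `none` if the computation is over. -/
  ctrl : Input → History → Option (List (Instr Q))
  polyTime : PolyTime fun p : Input × History => ctrl p.1 p.2
  disjoint : ∀ i h L, ctrl i h = some L → (L.flatMap Instr.qubits).Nodup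
  adjacent : ∀ i h L, ctrl i h = some L → ∀ g a b, Instr.two g a b ∈ L → adj a b

namespace Circuit

variable {B : GateSet} {Q : Type} [Coded Q] [DecidableEq Q] {adj : Q → Q → Prop}

/-- The effect of one operation with outcome `o`. -/
noncomputable def act (C : Circuit B Q adj) (o : ℕ) (ρ : QState Q) : Instr Q → QState Q
  | Instr.one g q => (((C.one g).kraus.getD o []).map fun K => ρ.conj₁ K q).sum
  | Instr.two g a b => (((C.two g).kraus.getD o []).map fun K => ρ.conj₂ K a b).sum

/-- The effect of the operations of one timestep with given outcomes. -/
noncomputable def actLayer (C : Circuit B Q adj) :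
    List (Instr Q) → List ℕ → QState Q → QState Q
  | [], [], ρ => ρ
  | i :: L, o :: os, ρ => C.actLayer L os (C.act o ρ i)
  | _, _, _ => 0

/-- The unnormalised state after the timesteps with outcomes `h`, from the initial state `ρ`; its
trace is the probability of `h`. -/
noncomputable def run (C : Circuit B Q adj) (i : Input) (ρ : QState Q) : History → QState Q
  | [] => ρ
  | o :: h => match C.ctrl i h with
    | none => 0
    | some L => C.actLayer L o (C.run i ρ h)

/-- The timesteps ordered by the controller along the outcomes `h`, including the one it orders in
response to `h`. -/
def timesteps (C : Circuit B Q adj) (i : Input) : History → List (List (Instr Q))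
  | [] => (C.ctrl i []).toList
  | o :: h => (C.ctrl i (o :: h)).toList ++ C.timesteps i h

/-- The outcomes `h` have positive probability for some state of the `i.m` input qubits, the `j`-th
of which is placed at `site j`, all other qubits starting in `|0⟩`. -/
def Possible (C : Circuit B Q adj) (site : ℕ → Q) (i : Input) (h : History) : Prop :=
  ∃ ρ : QState (Fin i.m), IsDensity ρ ∧ C.run i (ρ.place fun j : Fin i.m => site j) h ≠ 0

/-- Runs on inputs `x` of length `l` with `m` input qubits. -/
def IsRun (C : Circuit B Q adj) (site : ℕ → Q) (l m : ℕ) (i : Input) (h : History) : Prop :=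
  i.x.length = l ∧ i.m = m ∧ i.r.length = C.seedLen.eval (l + m) ∧ C.Possible site i h

/-- The maximal number of timesteps. -/
noncomputable def depth (C : Circuit B Q adj) (site : ℕ → Q) (l m : ℕ) : ℕ∞ :=
  ⨆ (i : Input) (h : History) (_ : C.IsRun site l m i h), ((C.timesteps i h).length : ℕ∞)

/-- The maximal number of operations. -/
noncomputable def size (C : Circuit B Q adj) (site : ℕ → Q) (l m : ℕ) : ℕ∞ :=
  ⨆ (i : Input) (h : History) (_ : C.IsRun site l m i h), ((C.timesteps i h).flatten.length : ℕ∞)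

/-- The qubits used on input `x` for some seed and some outcomes: those acted on and those that
hold the quantum input. -/
def used (C : Circuit B Q adj) (site : ℕ → Q) (m : ℕ) (x : List Bool) : Set Q :=
  {q | ∃ j < m, site j = q} ∪
  {q | ∃ i h, i.x = x ∧ C.IsRun site x.length m i h ∧
    ∃ L ∈ C.timesteps i h, ∃ a ∈ L, q ∈ a.qubits}

end Circuit

/-- Qubits indexed by `ℕ`, with interactions between any two qubits. -/
abbrev CCAC (B : GateSet) : Type := Circuit B ℕ fun _ _ => True

/-- Neighbours in the two-dimensional grid. -/
def GridAdj (p q : ℤ × ℤ) : Prop := |p.1 - q.1| + |p.2 - q.2| = 1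

/-- Qubits on the two-dimensional grid, with interactions only between neighbours. -/
abbrev CCNTC (B : GateSet) : Type := Circuit B (ℤ × ℤ) GridAdj

/-- The sites of the first column of the grid. -/
def column (j : ℕ) : ℤ × ℤ := (0, j)

namespace CCAC

variable {B : GateSet}

noncomputable def depth (C : CCAC B) (l m : ℕ) : ℕ∞ := Circuit.depth C id l m

noncomputable def size (C : CCAC B) (l m : ℕ) : ℕ∞ := Circuit.size C id l m

/-- The number of qubits used, maximised over the inputs of length `l`. -/
noncomputable def width (C : CCAC B) (l m : ℕ) : ℕ∞ :=
  ⨆ (x : List Bool) (_ : x.length = l), (Circuit.used C id m x).encard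

end CCAC

namespace CCNTC

variable {B : GateSet}

noncomputable def depth (C : CCNTC B) (l m : ℕ) : ℕ∞ := Circuit.depth C column l m

noncomputable def size (C : CCNTC B) (l m : ℕ) : ℕ∞ := Circuit.size C column l m

/-- The number of sites in the smallest square that contains all qubits used, maximised over the
inputs of length `l`. -/
noncomputable def width (C : CCNTC B) (l m : ℕ) : ℕ∞ :=
  ⨆ (x : List Bool) (_ : x.length = l),
    ⨅ (a : ℤ) (b : ℤ) (k : ℕ)
      (_ : Circuit.used C column m x ⊆ Set.Ico a (a + k) ×ˢ Set.Ico b (b + k)), ((k ^ 2 : ℕ) : ℕ∞)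

end CCNTC

/-- `C'` simulates `C`. The two circuits use the same seed; `C'` starts with the `j`-th input qubit
at row `j` of the first column. The outcomes `h` of `C` are computed from those of `C'` by `dec`,
and `loc i h` gives the site at which each qubit of `C` is found at the end, all in polynomial time.
For every input, seed and state of the input qubits, and all outcomes `h` with which `C` stops, the
runs of `C'` that stop with outcomes decoded to `h` have the same total unnormalised final state as
the run `h` of `C`, all sites of the grid that hold no qubit of `C` being in the state `|0⟩`. -/
def Simulates {B : GateSet} (C' : CCNTC B) (C : CCAC B) : Prop :=
  C'.seedLen = C.seedLen ∧
  ∃ (dec : Input → History → History) (loc : Input → History → ℕ → ℤ × ℤ),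
    PolyTime (fun p : Input × History => dec p.1 p.2) ∧
    PolyTime (fun p : Input × History × ℕ => loc p.1 p.2.1 p.2.2) ∧
    ∀ (i : Input) (h : History),
      Function.Injective (loc i h) ∧ (∀ j < i.m, loc i h j = column j) ∧
      (C.ctrl i h = none → ∀ ρ : QState (Fin i.m), IsDensity ρ →
        HasSum
          (fun h' : {h' : History // C'.ctrl i h' = none ∧ dec i h' = h} =>
            C'.run i (ρ.place fun j : Fin i.m => column j) h')
          ((C.run i (ρ.place fun j : Fin i.m => (j : ℕ)) h).place (loc i h)))

/-- The list `E` of operations followed by the sequence `f`. -/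
def prepend {α : Type} (E : List α) (f : ℕ → α) (k : ℕ) : α :=
  if h : k < E.length then E[k] else f (k - E.length)

end CC

open scoped Kronecker ComplexOrder

namespace CC

open Coded

/-! ### Closure properties of polynomial-time functions -/

/-! Every qubit gets a home in the first column of the grid: the input qubits keep the rows 0, …,
m-1, and a further qubit receives the next free row when the controller first addresses it. A
timestep is simulated by bringing the two qubits of every interacting pair next to each other,
applying the operations, and bringing everything back. For homes in rows r < r', both qubits travel
along their rows to column r'; then the first one travels along that column to (r', r'-1), beside
its partner at (r', r'). Different pairs have different rows and different columns, so the paths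
used at one time are disjoint (`rowPaths_nodup`, `colPaths_nodup`), and beyond their starting points
they are vacant (`rowPaths_tail_not_mem`, `colPaths_tail_not_mem`).

The depth stays constant because a qubit can be sent along a path of any length in a fixed number of
timesteps. To hop from p to a vacant neighbour q, put q into the state |+⟩, measure the parity of p
and q, apply a Hadamard to p, measure p and reset it. The state passes to q up to a Pauli operator
determined by the two outcomes, and every outcome has probability 1/2 whatever the state is
(`conj_hop`). A Pauli error already present on p is carried along and merely modified by the
outcomes, so nothing has to be corrected before the end of the path. Moreover the parity projectors
of all edges are diagonal and commute, even for edges with a common site (`parityOp_comm`). Hence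
all edges of all paths can be treated simultaneously, in two colours so that the CNOTs do not
collide; the controller sums up the outcomes along each path and corrects its last site only.
Formally, operations that commute are regrouped from timestep by timestep to edge by edge
(`seq_seq`, `Impl.moveBlock`), after which one follows the hops along each path (`seq_edgeOp_path`,
`Impl.movePaths`).

A predicate `Impl` records that a sequence of timesteps turns one state into another up to the
weight of its outcomes, a number that does not involve the state. For the whole simulation of a
timestep this is `Impl.chunk`. Once the outcomes of the simulated operations are fixed, the weights
of the auxiliary outcomes sum to 1 (`tsum_progWeight_chunk`). By induction on the outcomes of the
given circuit, the runs of the grid circuit that decode to them are multiples of the correct state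
with coefficients of sum 1 (`exists_weights`); this is the simulation. It also shows that possible
outcomes decode to possible outcomes (`isRun_of_isRun`), so that the maxima defining depth, size and
width can be compared run by run.

A simulated timestep takes 4μ+1 timesteps, four moves of μ timesteps each and the operations
themselves, with μ depending only on the words for H, X, Z and CNOT that universality provides. If n
qubits have been seen, one of these timesteps has at most 2n operations for each simulated one, and
all of them lie in the square of side n. That the controller is polynomial is obtained by building
each of its functions from case distinctions and folds over lists. -/

theorem polynomial_eval_mono (P : Polynomial ℕ) {a b : ℕ} (h : a ≤ b) : P.eval a ≤ P.eval b := by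
  rw [Polynomial.eval_eq_sum, Polynomial.eval_eq_sum]
  exact Finset.sum_le_sum fun i _ => Nat.mul_le_mul_left _ (Nat.pow_le_pow_left h i)

/-- The size of the tree that encodes `a`. -/
abbrev csize {α : Type} [Coded α] (a : α) : ℕ := (code a).size

theorem Data.size_pos (d : Data) : 0 < d.size := by cases d <;> simp [Data.size]

theorem Data.size_head_le (d : Data) : d.head.size ≤ d.size := by
  cases d <;> simp [Data.size, Data.head]; omega

theorem Data.size_tail_le (d : Data) : d.tail.size ≤ d.size := by
  cases d
  · simp [Data.tail]
  · simp [Data.size, Data.tail]; omega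

/-- Every instruction is charged for the tree it reads. A time bound is therefore a bound on the
size of the output, which is what makes polynomial time closed under composition. -/
theorem Run.size_le {p : Prog} {v w : Data} {t : ℕ} (h : Run p v w t) : w.size ≤ t := by
  induction h with
  | id v => exact le_rfl
  | nil v => exact v.size_pos
  | head v => exact v.size_head_le
  | tail v => exact v.size_tail_le
  | cons _ _ h1 h2 => simp only [Data.size]; omega
  | _ => omega

theorem csize_pos {α : Type} [Coded α] (a : α) : 0 < csize a := Data.size_pos _

theorem csize_pair {α β : Type} [Coded α] [Coded β] (a : α) (b : β) :
    csize (a, b) = csize a + csize b + 1 := rfl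

theorem csize_nil {α : Type} [Coded α] : csize ([] : List α) = 1 := rfl

theorem csize_cons {α : Type} [Coded α] (a : α) (l : List α) :
    csize (a :: l) = csize a + csize l + 1 := rfl

theorem csize_bool_le (b : Bool) : csize b ≤ 3 := by cases b <;> decide

theorem csize_append {α : Type} [Coded α] (l l' : List α) :
    csize (l ++ l') + 1 = csize l + csize l' := by
  induction l with
  | nil => simp [csize_nil]; omega
  | cons a l ih => rw [List.cons_append, csize_cons, csize_cons]; omega

theorem csize_reverse {α : Type} [Coded α] (l : List α) : csize l.reverse = csize l := by
  induction l with
  | nil => rfl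
  | cons a l ih =>
    have := csize_append l.reverse [a]
    rw [List.reverse_cons]
    rw [csize_cons, csize_nil] at this
    rw [csize_cons]; omega

theorem csize_mem_le {α : Type} [Coded α] {a : α} {l : List α} (h : a ∈ l) :
    csize a ≤ csize l := by
  induction l with
  | nil => simp at h
  | cons b l ih =>
    rw [csize_cons]
    rcases List.mem_cons.1 h with rfl | h
    · omega
    · have := ih h; omega

theorem length_lt_csize {α : Type} [Coded α] (l : List α) : l.length < csize l := by
  induction l with
  | nil => simp [csize_nil]
  | cons b l ih => rw [csize_cons, List.length_cons]; omega

theorem csize_prefix_le {α : Type} [Coded α] {l l' : List α} (h : l <+: l') :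
    csize l ≤ csize l' := by
  obtain ⟨m, rfl⟩ := h
  have := csize_append l m
  have := csize_pos m
  omega

theorem csize_suffix_le {α : Type} [Coded α] {l l' : List α} (h : l <:+ l') :
    csize l ≤ csize l' := by
  obtain ⟨m, rfl⟩ := h
  have := csize_append m l
  have := csize_pos m
  omega

theorem csize_list_le {α : Type} [Coded α] (l : List α) (B : ℕ) (h : ∀ a ∈ l, csize a ≤ B) :
    csize l ≤ l.length * (B + 1) + 1 := by
  induction l with
  | nil => simp [csize_nil]
  | cons b l ih =>
    rw [csize_cons, List.length_cons, Nat.succ_mul]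
    have := h b (by simp)
    have := ih fun a ha => h a (by simp [ha])
    omega

namespace PolyTime

variable {α β γ δ σ : Type} [Coded α] [Coded β] [Coded γ] [Coded δ] [Coded σ]

theorem congr {f g : α → β} (hf : PolyTime f) (h : ∀ a, g a = f a) : PolyTime g := by
  rwa [show g = f from funext h]

theorem of_code_eq {f : α → β} {g : α → γ} (hg : PolyTime g) (h : ∀ a, code (f a) = code (g a)) :
    PolyTime f := by
  obtain ⟨p, P, hp⟩ := hg
  exact ⟨p, P, fun a => by rw [h]; exact hp a⟩

theorem csize_le {f : α → β} (hf : PolyTime f) :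
    ∃ P : Polynomial ℕ, ∀ a, csize (f a) ≤ P.eval (csize a) := by
  obtain ⟨p, P, hp⟩ := hf
  refine ⟨P, fun a => ?_⟩
  obtain ⟨t, ht, hr⟩ := hp a
  exact hr.size_le.trans ht

protected theorem id : PolyTime (fun a : α => a) :=
  ⟨Prog.id, Polynomial.X, fun a => ⟨_, by simp, Run.id _⟩⟩

theorem comp {f : β → γ} {g : α → β} (hf : PolyTime f) (hg : PolyTime g) :
    PolyTime fun a => f (g a) := by
  obtain ⟨p, P, hp⟩ := hf
  obtain ⟨q, Q, hq⟩ := hg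
  refine ⟨Prog.comp p q, Polynomial.X + Q + P.comp Q, fun a => ?_⟩
  obtain ⟨s, hs, hrs⟩ := hq a
  obtain ⟨t, ht, hrt⟩ := hp (g a)
  refine ⟨_, ?_, Run.comp hrs hrt⟩
  simp only [Polynomial.eval_add, Polynomial.eval_X, Polynomial.eval_comp]
  have := polynomial_eval_mono P (hrs.size_le.trans hs)
  omega

theorem pair {f : α → β} {g : α → γ} (hf : PolyTime f) (hg : PolyTime g) :
    PolyTime fun a => (f a, g a) := by
  obtain ⟨p, P, hp⟩ := hf
  obtain ⟨q, Q, hq⟩ := hg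
  refine ⟨Prog.cons p q, Polynomial.X + P + Q + 1, fun a => ?_⟩
  obtain ⟨s, hs, hrs⟩ := hp a
  obtain ⟨t, ht, hrt⟩ := hq a
  refine ⟨_, ?_, Run.cons hrs hrt⟩
  simp only [Polynomial.eval_add, Polynomial.eval_X, Polynomial.eval_one]
  omega

theorem fst {f : α → β × γ} (hf : PolyTime f) : PolyTime fun a => (f a).1 :=
  comp (f := fun p : β × γ => p.1)
    ⟨Prog.head, Polynomial.X, fun a => ⟨_, by simp, Run.head _⟩⟩ hf

theorem snd {f : α → β × γ} (hf : PolyTime f) : PolyTime fun a => (f a).2 :=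
  comp (f := fun p : β × γ => p.2)
    ⟨Prog.tail, Polynomial.X, fun a => ⟨_, by simp, Run.tail _⟩⟩ hf

protected theorem const (b : β) : PolyTime fun _ : α => b := by
  have key : ∀ d : Data, ∃ (p : Prog) (P : Polynomial ℕ), ∀ v : Data,
      ∃ t ≤ P.eval v.size, Run p v d t := by
    intro d
    induction d with
    | nil => exact ⟨Prog.nil, Polynomial.X, fun v => ⟨_, by simp, Run.nil v⟩⟩
    | node a b iha ihb =>
      obtain ⟨p, P, hp⟩ := iha
      obtain ⟨q, Q, hq⟩ := ihb
      refine ⟨Prog.cons p q, Polynomial.X + P + Q + 1, fun v => ?_⟩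
      obtain ⟨s, hs, hrs⟩ := hp v
      obtain ⟨t, ht, hrt⟩ := hq v
      refine ⟨_, ?_, Run.cons hrs hrt⟩
      simp only [Polynomial.eval_add, Polynomial.eval_X, Polynomial.eval_one]
      omega
  obtain ⟨p, P, hp⟩ := key (code b)
  exact ⟨p, P, fun a => hp _⟩

theorem cond {c : α → Bool} {f g : α → β} (hc : PolyTime c) (hf : PolyTime f) (hg : PolyTime g) :
    PolyTime fun a => bif c a then f a else g a := by
  obtain ⟨r, R, hr⟩ := hc
  obtain ⟨p, P, hp⟩ := hf
  obtain ⟨q, Q, hq⟩ := hg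
  refine ⟨Prog.cond r p q, Polynomial.X + R + P + Q, fun a => ?_⟩
  obtain ⟨u, hu, hru⟩ := hr a
  obtain ⟨s, hs, hrs⟩ := hp a
  obtain ⟨t, ht, hrt⟩ := hq a
  simp only [Polynomial.eval_add, Polynomial.eval_X]
  cases h : c a <;> rw [h] at hru
  · exact ⟨_, by omega, Run.condFalse hru hrt⟩
  · exact ⟨_, by omega, Run.condTrue hru hrs⟩

theorem ite {p : α → Prop} [DecidablePred p] {f g : α → β} (hc : PolyTime fun a => decide (p a))
    (hf : PolyTime f) (hg : PolyTime g) : PolyTime fun a => if p a then f a else g a :=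
  (cond hc hf hg).congr fun a => by by_cases h : p a <;> simp [h]

theorem boolFn {c : α → Bool} (F : Bool → β) (hc : PolyTime c) : PolyTime fun a => F (c a) :=
  (cond hc (PolyTime.const (F true)) (PolyTime.const (F false))).congr fun a => by
    cases c a <;> rfl

theorem boolFn₂ {c d : α → Bool} (F : Bool → Bool → β) (hc : PolyTime c) (hd : PolyTime d) :
    PolyTime fun a => F (c a) (d a) :=
  (cond hc (boolFn (F true) hd) (boolFn (F false) hd)).congr fun a => by
    cases c a <;> rfl

/-! Lists and options -/

theorem cons {f : α → β} {g : α → List β} (hf : PolyTime f) (hg : PolyTime g) :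
    PolyTime fun a => f a :: g a := (pair hf hg).of_code_eq fun _ => rfl

theorem singleton {f : α → β} (hf : PolyTime f) : PolyTime fun a => [f a] :=
  cons hf (PolyTime.const [])

theorem some {f : α → β} (hf : PolyTime f) : PolyTime fun a => some (f a) :=
  (pair (PolyTime.const false) hf).of_code_eq fun _ => rfl

theorem tail {f : α → List β} (hf : PolyTime f) : PolyTime fun a => (f a).tail :=
  comp (f := fun l : List β => l.tail)
    ⟨Prog.tail, Polynomial.X, fun a => ⟨(code a).size, by simp, by
      cases a <;> exact Run.tail _⟩⟩ hf

/-- After branching, the list is computed a second time: `cond` hands the original tree, not the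
value of the test, to its branches. -/
theorem listCases {l : α → List β} {f h : α → γ} {g : α × β × List β → γ} (hl : PolyTime l)
    (hf : PolyTime f) (hg : PolyTime g) (hnil : ∀ a, l a = [] → h a = f a)
    (hcons : ∀ a x xs, l a = x :: xs → h a = g (a, x, xs)) : PolyTime h := by
  obtain ⟨r, R, hr⟩ := hl
  obtain ⟨p, P, hp⟩ := hf
  obtain ⟨q, Q, hq⟩ := hg
  refine ⟨Prog.cond r (Prog.comp q (Prog.cons Prog.id r)) p,
    Polynomial.X + R + P + (Polynomial.X + (Polynomial.X + Polynomial.X + R + 1) +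
      Q.comp (Polynomial.X + R + 1)), fun a => ?_⟩
  obtain ⟨u, hu, hru⟩ := hr a
  simp only [Polynomial.eval_add, Polynomial.eval_X, Polynomial.eval_one, Polynomial.eval_comp]
  cases hla : l a with
  | nil =>
    rw [hla] at hru
    obtain ⟨s, hs, hrs⟩ := hp a
    rw [hnil a hla]
    exact ⟨_, by omega, Run.condFalse hru hrs⟩
  | cons x xs =>
    rw [hla] at hru
    obtain ⟨t, ht, hrt⟩ := hq (a, x, xs)
    rw [hcons a x xs hla]
    refine ⟨_, ?_, Run.condTrue hru (Run.comp (Run.cons (Run.id _) hru) hrt)⟩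
    have h1 : csize (a, x, xs) ≤ csize a + R.eval (csize a) + 1 := by
      have := hru.size_le
      have h2 : csize (x :: xs) ≤ u := this
      rw [csize_pair]
      rw [csize_cons] at h2
      rw [csize_pair]
      simp only [csize] at *
      omega
    have := polynomial_eval_mono Q h1
    simp only [csize] at *
    omega

theorem optionCases {l : α → Option β} {f h : α → γ} {g : α × β → γ} (hl : PolyTime l)
    (hf : PolyTime f) (hg : PolyTime g) (hnil : ∀ a, l a = none → h a = f a)
    (hcons : ∀ a x, l a = Option.some x → h a = g (a, x)) : PolyTime h := by
  obtain ⟨r, R, hr⟩ := hl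
  obtain ⟨p, P, hp⟩ := hf
  obtain ⟨q, Q, hq⟩ := hg
  refine ⟨Prog.cond r (Prog.comp q (Prog.cons Prog.id (Prog.comp Prog.tail r))) p,
    Polynomial.X + R + P + (Polynomial.X +
      (Polynomial.X + Polynomial.X + (Polynomial.X + R + R) + 2) +
      Q.comp (Polynomial.X + R + 1)), fun a => ?_⟩
  obtain ⟨u, hu, hru⟩ := hr a
  simp only [Polynomial.eval_add, Polynomial.eval_X, Polynomial.eval_one, Polynomial.eval_comp,
    Polynomial.eval_ofNat]
  cases hla : l a with
  | none =>
    rw [hla] at hru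
    obtain ⟨s, hs, hrs⟩ := hp a
    rw [hnil a hla]
    exact ⟨_, by omega, Run.condFalse hru hrs⟩
  | some x =>
    rw [hla] at hru
    obtain ⟨t, ht, hrt⟩ := hq (a, x)
    rw [hcons a x hla]
    have h2 : (code (Option.some x)).size ≤ u := hru.size_le
    refine ⟨_, ?_, Run.condTrue hru (Run.comp (Run.cons (Run.id _)
      (Run.comp hru (Run.tail _))) hrt)⟩
    have h3 : (code (Option.some x)).size = csize x + 2 := by
      change 1 + csize x + 1 = _
      omega
    have h1 : csize (a, x) ≤ csize a + R.eval (csize a) + 1 := by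
      rw [csize_pair]
      simp only [csize] at *
      omega
    have := polynomial_eval_mono Q h1
    have := Data.size_pos (code a)
    have := Data.size_pos (code x)
    simp only [csize] at *
    omega

theorem headD {f : α → List β} {d : α → β} (hf : PolyTime f) (hd : PolyTime d) :
    PolyTime fun a => (f a).headD (d a) :=
  listCases hf (f := d) (g := fun p => p.2.1) hd
    (fst (snd PolyTime.id)) (fun a h => by simp [h]) (fun a x xs h => by simp [h])

theorem isEmpty {f : α → List β} (hf : PolyTime f) : PolyTime fun a => (f a).isEmpty :=
  listCases hf (f := fun _ => true) (g := fun _ => false) (PolyTime.const _)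
    (PolyTime.const _) (fun a h => by simp [h]) (fun a x xs h => by simp [h])

theorem foldl {l : α → List β} {s : α → σ} {step : α → σ → β → σ} (hl : PolyTime l)
    (hs : PolyTime s) (hstep : PolyTime fun p : α × σ × β => step p.1 p.2.1 p.2.2)
    (hB : ∃ P : Polynomial ℕ, ∀ a l', l' <+: l a →
      csize (l'.foldl (step a) (s a)) ≤ P.eval (csize a)) :
    PolyTime fun a => (l a).foldl (step a) (s a) := by
  obtain ⟨B, hB⟩ := hB
  obtain ⟨p, P, hp⟩ := hstep
  obtain ⟨L, hL⟩ := hl.csize_le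
  -- The loop works on triples (argument, state, rest of the list). `tt` reads the rest, and the
  -- loop ends when it is empty.
  let tt : Prog := Prog.comp Prog.tail Prog.tail
  let body : Prog := Prog.cons Prog.head (Prog.cons
    (Prog.comp p (Prog.cons Prog.head (Prog.cons (Prog.comp Prog.head Prog.tail)
      (Prog.comp Prog.head tt)))) (Prog.comp Prog.tail tt))
  let V : Polynomial ℕ := Polynomial.X + B + L + 2
  have hloop : PolyTime (fun a => (a, (l a).foldl (step a) (s a), ([] : List β))) := by
    have hinit : PolyTime (fun a => (a, s a, l a)) := pair PolyTime.id (pair hs hl)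
    obtain ⟨q, Q, hq⟩ := hinit
    refine ⟨Prog.comp (Prog.loop tt body) q,
      Polynomial.X + Q + (L + 1) * (50 * V + P.comp V + 50), fun a => ?_⟩
    obtain ⟨u, hu, hru⟩ := hq a
    -- Induction on the rest `l₂`. Each round costs one evaluation of `step` and a few copies of
    -- parts of the triple, which the generous constant 50 covers.
    have main : ∀ (l₂ l₁ : List β), l₁ ++ l₂ = l a → ∃ t,
        t ≤ (l₂.length + 1) * (50 * V.eval (csize a) + P.eval (V.eval (csize a)) + 50) ∧
        Run (Prog.loop tt body) (code (a, l₁.foldl (step a) (s a), l₂))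
          (code (a, (l a).foldl (step a) (s a), ([] : List β))) t := by
      intro l₂
      induction l₂ with
      | nil =>
        intro l₁ h
        rw [List.append_nil] at h
        subst h
        have hb := hB a (l a) (List.prefix_refl _)
        refine ⟨_, ?_, Run.loopStop (Run.comp (Run.tail _) (Run.tail _))⟩
        have e1 := csize_pair a ((l a).foldl (step a) (s a), ([] : List β))
        have e2 := csize_pair ((l a).foldl (step a) (s a)) ([] : List β)
        have e3 : csize ([] : List β) = 1 := rfl
        have h1 := Data.size_tail_le (code (a, (l a).foldl (step a) (s a), ([] : List β)))
        have hV : V.eval (csize a) = csize a + B.eval (csize a) + L.eval (csize a) + 2 := by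
          simp [V]
        simp only [List.length_nil, Nat.zero_add, Nat.one_mul]
        simp only [csize] at *
        omega
      | cons b l₂ ih =>
        intro l₁ h
        obtain ⟨t, ht, hrt⟩ := ih (l₁ ++ [b]) (by simpa using h)
        rw [List.foldl_append] at hrt
        simp only [List.foldl_cons, List.foldl_nil] at hrt
        set x := l₁.foldl (step a) (s a) with hx
        obtain ⟨r, hr, hrr⟩ := hp (a, x, b)
        have hb := hB a l₁ ⟨_, h⟩
        have hl2 : csize (b :: l₂) ≤ L.eval (csize a) :=
          (csize_suffix_le ⟨l₁, h⟩).trans (hL a)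
        have hV : V.eval (csize a) = csize a + B.eval (csize a) + L.eval (csize a) + 2 := by
          simp [V]
        have e1 := csize_pair a (x, b :: l₂)
        have e2 := csize_pair x (b :: l₂)
        have e3 := csize_cons b l₂
        have e4 := csize_pair a (x, b)
        have e5 := csize_pair x b
        rw [← hx] at hb
        have hPV : P.eval (csize (a, x, b)) ≤ P.eval (V.eval (csize a)) :=
          polynomial_eval_mono P (by omega)
        have R1 : Run tt (code (a, x, b :: l₂)) (code (b :: l₂)) _ :=
          Run.comp (Run.tail _) (Run.tail _)
        have R2 : Run body (code (a, x, b :: l₂)) (code (a, step a x b, l₂)) _ :=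
          Run.cons (Run.head _) (Run.cons
            (Run.comp (Run.cons (Run.head _) (Run.cons (Run.comp (Run.tail _) (Run.head _))
              (Run.comp R1 (Run.head _)))) hrr) (Run.comp R1 (Run.tail _)))
        refine ⟨_, ?_, Run.loopStep R1 R2 hrt⟩
        have h1 := Data.size_tail_le (code (a, x, b :: l₂))
        have hr' : r ≤ P.eval (V.eval (csize a)) := hr.trans hPV
        rw [List.length_cons, Nat.succ_mul]
        clear_value x
        change _ ≤ _ at hr
        simp only [csize] at *
        have s1 : (Data.node (code a) (Data.node (code x) (code b))).size =
            (code (a, x, b)).size := rfl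
        have s3 : Data.size (Data.node (Data.head (code (a, x, b :: l₂)))
          (Data.node (Data.head (Data.tail (code (a, x, b :: l₂)))) (Data.head (code (b :: l₂)))))
            = (code (a, x, b)).size := rfl
        have s2 : Data.size (Data.tail (code (a, x, b :: l₂))) = (code (x, b :: l₂)).size := rfl
        have := Data.size_pos (code b)
        have := Data.size_pos (code a)
        have := Data.size_pos (code x)
        have := Data.size_pos (code l₂)
        omega
    obtain ⟨t, ht, hrt⟩ := main (l a) [] rfl
    refine ⟨_, ?_, Run.comp hru hrt⟩
    simp only [Polynomial.eval_add, Polynomial.eval_X, Polynomial.eval_one, Polynomial.eval_comp,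
      Polynomial.eval_mul, Polynomial.eval_ofNat]
    have h1 : ((l a).length + 1) ≤ L.eval (csize a) + 1 := by
      have := length_lt_csize (l a)
      have := hL a
      omega
    have := Nat.mul_le_mul_right
      (50 * V.eval (csize a) + P.eval (V.eval (csize a)) + 50) h1
    simp only [csize] at *
    omega
  exact fst (snd hloop)

/-- A fold in which every step increases the size of the state by a bounded amount. -/
theorem foldlAdd {l : α → List β} {s : α → σ} {step : α → σ → β → σ} (hl : PolyTime l)
    (hs : PolyTime s) (hstep : PolyTime fun p : α × σ × β => step p.1 p.2.1 p.2.2)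
    (hB : ∃ P : Polynomial ℕ, ∀ a x b,
      csize (step a x b) ≤ csize x + P.eval (csize a + csize b)) :
    PolyTime fun a => (l a).foldl (step a) (s a) := by
  refine foldl hl hs hstep ?_
  obtain ⟨P, hP⟩ := hB
  obtain ⟨L, hL⟩ := hl.csize_le
  obtain ⟨S, hS⟩ := hs.csize_le
  refine ⟨S + L * P.comp (Polynomial.X + L), fun a l' h => ?_⟩
  have key : ∀ (l' : List β) (x : σ), (∀ b ∈ l', csize b ≤ L.eval (csize a)) →
      csize (l'.foldl (step a) x) ≤
        csize x + l'.length * P.eval (csize a + L.eval (csize a)) := by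
    intro l'
    induction l' with
    | nil => intro x _; simp
    | cons b l' ih =>
      intro x hb
      have h1 := ih (step a x b) fun b' hb' => hb b' (by simp [hb'])
      have h2 := hP a x b
      have h3 := polynomial_eval_mono P (Nat.add_le_add_left (hb b (by simp)) (csize a))
      rw [List.length_cons, Nat.succ_mul]
      simp only [List.foldl_cons]
      omega
  have h1 := key l' (s a) fun b hb =>
    (csize_mem_le hb).trans ((csize_prefix_le h).trans (hL a))
  have h2 : l'.length ≤ L.eval (csize a) :=
    (length_lt_csize l').le.trans ((csize_prefix_le h).trans (hL a))
  have h3 := Nat.mul_le_mul_right (P.eval (csize a + L.eval (csize a))) h2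
  have h4 := hS a
  simp only [Polynomial.eval_add, Polynomial.eval_mul, Polynomial.eval_comp, Polynomial.eval_X]
  omega

theorem reverse {l : α → List β} (hl : PolyTime l) : PolyTime fun a => (l a).reverse :=
  (foldlAdd (s := fun _ => ([] : List β)) (step := fun _ x b => b :: x) hl (PolyTime.const _)
    (cons (snd (snd PolyTime.id)) (fst (snd PolyTime.id)))
    ⟨Polynomial.X + 1, fun a x b => by
      rw [csize_cons]; simp only [Polynomial.eval_add, Polynomial.eval_X, Polynomial.eval_one]
      omega⟩).congr fun a => by simp

theorem append {l l' : α → List β} (hl : PolyTime l) (hl' : PolyTime l') :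
    PolyTime fun a => l a ++ l' a :=
  (foldlAdd (s := l') (step := fun _ x b => b :: x) (reverse hl) hl'
    (cons (snd (snd PolyTime.id)) (fst (snd PolyTime.id)))
    ⟨Polynomial.X + 1, fun a x b => by
      rw [csize_cons]; simp only [Polynomial.eval_add, Polynomial.eval_X, Polynomial.eval_one]
      omega⟩).congr fun a => by simp

theorem map {l : α → List β} {f : α → β → γ} (hl : PolyTime l)
    (hf : PolyTime fun p : α × β => f p.1 p.2) : PolyTime fun a => (l a).map (f a) := by
  obtain ⟨F, hF⟩ := hf.csize_le
  refine (foldlAdd (s := fun _ => ([] : List γ)) (step := fun a x b => f a b :: x) (reverse hl)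
    (PolyTime.const _)
    (cons (comp hf (pair (fst PolyTime.id) (snd (snd PolyTime.id)))) (fst (snd PolyTime.id)))
    ⟨F.comp (Polynomial.X + 1) + 1, fun a x b => ?_⟩).congr fun a => ?_
  · have h := hF (a, b)
    rw [csize_pair] at h
    rw [csize_cons]
    simp only [Polynomial.eval_add, Polynomial.eval_X, Polynomial.eval_one, Polynomial.eval_comp]
    simp only at h
    omega
  · rw [List.foldl_reverse, List.map_eq_foldr]

theorem flatten {l : α → List (List β)} (hl : PolyTime l) : PolyTime fun a => (l a).flatten := by
  refine (foldlAdd (s := fun _ => ([] : List β)) (step := fun _ x b => b ++ x) (reverse hl)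
    (PolyTime.const _) (append (snd (snd PolyTime.id)) (fst (snd PolyTime.id)))
    ⟨Polynomial.X, fun a x b => ?_⟩).congr fun a => ?_
  · have := csize_append b x
    simp only [Polynomial.eval_X]
    omega
  · rw [List.foldl_reverse]
    induction l a with
    | nil => rfl
    | cons b l ih => simp [ih]

theorem flatMap {l : α → List β} {f : α → β → List γ} (hl : PolyTime l)
    (hf : PolyTime fun p : α × β => f p.1 p.2) : PolyTime fun a => (l a).flatMap (f a) :=
  (flatten (map hl hf)).congr fun _ => List.flatMap_def ..

theorem filter {l : α → List β} {f : α → β → Bool} (hl : PolyTime l)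
    (hf : PolyTime fun p : α × β => f p.1 p.2) : PolyTime fun a => (l a).filter (f a) := by
  refine (flatMap (f := fun a b => bif f a b then [b] else []) hl
    (cond hf (singleton (snd PolyTime.id)) (PolyTime.const _))).congr fun a => ?_
  induction l a with
  | nil => rfl
  | cons b l ih => cases h : f a b <;> simp [h, ih]

theorem any {l : α → List β} {f : α → β → Bool} (hl : PolyTime l)
    (hf : PolyTime fun p : α × β => f p.1 p.2) : PolyTime fun a => (l a).any (f a) :=
  (boolFn (fun b => !b) (isEmpty (filter hl hf))).congr fun a => by
    rw [Bool.eq_iff_iff]; simp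

/-- This is subtraction, and hence comparison, of numbers that are given in unary as lengths of
lists. -/
theorem dropLength {l : α → List β} {l' : α → List γ} (hl : PolyTime l) (hl' : PolyTime l') :
    PolyTime fun a => (l a).drop (l' a).length :=
  (foldlAdd (s := l) (step := fun _ x _ => x.tail) hl' hl
    (tail (fst (snd PolyTime.id)))
    ⟨0, fun a x b => by simpa using csize_suffix_le x.tail_suffix⟩).congr fun a => by
      induction l' a generalizing l with
      | nil => simp
      | cons c l' ih =>
        have : ∀ m : List β, m.drop (l'.length) = l'.foldl (fun x _ => x.tail) m := by
          clear ih
          induction l' with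
          | nil => simp
          | cons d l' ih => intro m; simp [← ih]
        simp [← this]

end PolyTime

end CC

/-! ### Polynomial-time arithmetic with binary numbers -/

namespace CC

open Coded

/-- Increment of a number written in binary, least significant bit first. -/
def incBits : List Bool → List Bool
  | [] => [true]
  | false :: l => true :: l
  | true :: l => false :: incBits l

theorem bits_succ (n : ℕ) : (n + 1).bits = incBits n.bits := by
  induction n using Nat.binaryRec' with
  | zero => simp [incBits]
  | bit b n hn ih =>
    cases b with
    | false =>
      have : Nat.bit false n + 1 = Nat.bit true n := by simp [Nat.bit]
      rw [this, Nat.bits_append_bit n false hn, Nat.bits_append_bit n true (by simp)]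
      rfl
    | true =>
      have : Nat.bit true n + 1 = Nat.bit false (n + 1) := by simp [Nat.bit]; ring
      rw [this, Nat.bits_append_bit n true hn, Nat.bits_append_bit (n + 1) false (by simp), ih]
      rfl

theorem csize_incBits_le (l : List Bool) : csize (incBits l) ≤ csize l + 4 := by
  induction l with
  | nil => decide
  | cons b l ih =>
    cases b with
    | false =>
      change 3 + csize l + 1 ≤ 1 + csize l + 1 + 4
      omega
    | true =>
      change 1 + csize (incBits l) + 1 ≤ 3 + csize l + 1 + 4
      omega

theorem csize_nat_succ_le (n : ℕ) : csize (n + 1) ≤ csize n + 4 := by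
  change csize (n + 1).bits ≤ csize n.bits + 4
  rw [bits_succ]
  exact csize_incBits_le _

theorem csize_nat_le (n : ℕ) : csize n ≤ 4 * n + 1 := by
  induction n with
  | zero => decide
  | succ n ih => have := csize_nat_succ_le n; omega

namespace PolyTime

variable {α β γ δ σ : Type} [Coded α] [Coded β] [Coded γ] [Coded δ] [Coded σ]

theorem bits {f : α → ℕ} (hf : PolyTime f) : PolyTime fun a => (f a).bits :=
  hf.of_code_eq fun _ => rfl

/-- One pass whose state consists of the carry and the output so far, reversed. A carry that is left
at the end becomes a new leading bit. -/
theorem incBits {f : α → List Bool} (hf : PolyTime f) : PolyTime fun a => incBits (f a) := by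
  have h := foldlAdd (l := f) (s := fun _ => (true, ([] : List Bool)))
    (step := fun _ x b => (x.1 && b, (xor x.1 b) :: x.2)) hf (PolyTime.const _)
    (pair (boolFn₂ (· && ·) (fst (fst (snd PolyTime.id))) (snd (snd PolyTime.id)))
      (cons (boolFn₂ xor (fst (fst (snd PolyTime.id))) (snd (snd PolyTime.id)))
        (snd (fst (snd PolyTime.id)))))
    ⟨8, fun a x b => by
      obtain ⟨x, l⟩ := x
      rw [csize_pair, csize_pair, csize_cons]
      have := csize_bool_le (x && b)
      have := csize_bool_le (xor x b)
      have := csize_pos x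
      simp only [Polynomial.eval_ofNat]
      omega⟩
  refine (append (reverse (snd h)) (boolFn (fun b => bif b then [true] else []) (fst h))).congr
    fun a => ?_
  have key : ∀ (l m : List Bool),
      (l.foldl (fun (x : Bool × List Bool) b => (x.1 && b, (xor x.1 b) :: x.2)) (false, m)) =
        (false, l.reverse ++ m) := by
    intro l
    induction l with
    | nil => simp
    | cons b l ih => intro m; simp [ih]
  have key2 : ∀ (l m : List Bool),
      let r := l.foldl (fun (x : Bool × List Bool) b => (x.1 && b, (xor x.1 b) :: x.2)) (true, m)
      r.2.reverse ++ (bif r.1 then [true] else []) = m.reverse ++ CC.incBits l := by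
    intro l
    induction l with
    | nil => simp [CC.incBits]
    | cons b l ih =>
      intro m
      cases b with
      | false => simp [CC.incBits, key]
      | true => simpa [CC.incBits] using ih (false :: m)
  exact (by simpa using (key2 (f a) []).symm)

theorem succ {f : α → ℕ} (hf : PolyTime f) : PolyTime fun a => f a + 1 :=
  (incBits (bits hf)).of_code_eq fun a => by
    change code (f a + 1).bits = _
    rw [bits_succ]

theorem addConst {f : α → ℕ} (hf : PolyTime f) (k : ℕ) : PolyTime fun a => f a + k := by
  induction k with
  | zero => exact hf
  | succ k ih => exact succ ih

theorem length {l : α → List β} (hl : PolyTime l) : PolyTime fun a => (l a).length :=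
  (foldlAdd (s := fun _ => 0) (step := fun _ x _ => x + 1) hl (PolyTime.const _)
    (succ (fst (snd PolyTime.id)))
    ⟨4, fun a x b => by
      simp only [Polynomial.eval_ofNat]; exact csize_nat_succ_le x⟩).congr fun a => by
      have : ∀ (l : List β) (n : ℕ), l.foldl (fun x _ => x + 1) n = n + l.length := by
        intro l
        induction l with
        | nil => simp
        | cons b l ih => intro n; simp [ih]; omega
      simp [this]

/-- The next number is the length of the list built so far. The growth of a step depends on the
state, so `foldlAdd` does not apply and the size is bounded through the closed form `key`. -/
theorem range {l : α → List β} (hl : PolyTime l) : PolyTime fun a => List.range (l a).length := by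
  have key : ∀ (l : List β), l.foldl (fun (x : List ℕ) _ => x.length :: x) [] =
      (List.range l.length).reverse := by
    intro l
    induction l using List.reverseRecOn with
    | nil => rfl
    | append_singleton l b ih => simp [ih, List.range_succ]
  refine (reverse (foldl (s := fun _ => ([] : List ℕ)) (step := fun _ x _ => x.length :: x) hl
    (PolyTime.const _) (cons (length (fst (snd PolyTime.id))) (fst (snd PolyTime.id)))
    ?_)).congr fun a => by simp [key]
  obtain ⟨L, hL⟩ := hl.csize_le
  refine ⟨L * (4 * L + 2) + 1, fun a l' h => ?_⟩
  rw [key, csize_reverse]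
  have h1 : l'.length ≤ L.eval (csize a) :=
    (length_lt_csize l').le.trans ((csize_prefix_le h).trans (hL a))
  have h2 := csize_list_le (List.range l'.length) (4 * l'.length + 1) fun n hn => by
    have := csize_nat_le n
    have := List.mem_range.1 hn
    omega
  rw [List.length_range] at h2
  simp only [Polynomial.eval_add, Polynomial.eval_mul, Polynomial.eval_ofNat, Polynomial.eval_one]
  have := Nat.mul_le_mul h1 (show 4 * l'.length + 1 + 1 ≤ 4 * L.eval (csize a) + 2 by omega)
  omega

/-- The second list is consumed during a fold over the first, with a flag for agreement so far.
Equality means that the flag survives and nothing of the second list is left. -/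
theorem boolListEq {f g : α → List Bool} (hf : PolyTime f) (hg : PolyTime g) :
    PolyTime fun a => decide (f a = g a) := by
  have h := foldlAdd (l := f) (s := fun a => (true, g a))
    (step := fun _ x b => (bif b then x.1 && x.2.headD false else
      x.1 && !x.2.isEmpty && !x.2.headD true, x.2.tail)) hf (pair (PolyTime.const _) hg)
    (pair (cond (snd (snd PolyTime.id))
      (boolFn₂ (· && ·) (fst (fst (snd PolyTime.id)))
        (headD (snd (fst (snd PolyTime.id))) (PolyTime.const _)))
      (boolFn₂ (fun x y => x && !y) (boolFn₂ (fun x y => x && !y) (fst (fst (snd PolyTime.id)))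
        (isEmpty (snd (fst (snd PolyTime.id)))))
        (headD (snd (fst (snd PolyTime.id))) (PolyTime.const _))))
      (tail (snd (fst (snd PolyTime.id)))))
    ⟨4, fun a x b => by
      obtain ⟨x, l⟩ := x
      rw [csize_pair, csize_pair]
      have := csize_bool_le (bif b then x && l.headD false else
        x && !l.isEmpty && !l.headD true)
      have := csize_suffix_le l.tail_suffix
      simp only [Polynomial.eval_ofNat]
      omega⟩
  refine (boolFn₂ (· && ·) (fst h) (isEmpty (snd h))).congr fun a => ?_
  have key : ∀ (l m : List Bool) (c : Bool),
      let r := l.foldl (fun (x : Bool × List Bool) b =>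
        (bif b then x.1 && x.2.headD false else
          x.1 && !x.2.isEmpty && !x.2.headD true, x.2.tail)) (c, m)
      (r.1 && r.2.isEmpty) = (c && decide (l = m)) := by
    intro l
    induction l with
    | nil => intro m c; cases m <;> simp
    | cons b l ih =>
      intro m c
      have := ih m.tail (bif b then c && m.headD false else
          c && !m.isEmpty && !m.headD true)
      simp only [List.foldl_cons] at this ⊢
      rw [this]
      cases m with
      | nil => cases b <;> simp
      | cons d m =>
        by_cases hlm : l = m <;> cases b <;> cases d <;> cases c <;> simp [hlm]
  exact (by simpa using (key (f a) (g a) true).symm)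

theorem natEq {f g : α → ℕ} (hf : PolyTime f) (hg : PolyTime g) :
    PolyTime fun a => decide (f a = g a) :=
  (boolListEq (bits hf) (bits hg)).congr fun a => by
    have : f a = g a ↔ (f a).bits = (g a).bits :=
      ⟨fun h => by rw [h], fun h => code_injective (α := ℕ) (congrArg (code (α := List Bool)) h)⟩
    simp [this]

theorem natMem {f : α → ℕ} {l : α → List ℕ} (hf : PolyTime f) (hl : PolyTime l) :
    PolyTime fun a => decide (f a ∈ l a) :=
  (any (f := fun a b => decide (f a = b)) hl
    (natEq (hf.comp (fst PolyTime.id)) (snd PolyTime.id))).congr fun a => by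
      rw [Bool.eq_iff_iff]; simp

theorem intOfNat {f : α → ℕ} (hf : PolyTime f) : PolyTime fun a => (f a : ℤ) :=
  (pair (PolyTime.const false) hf).of_code_eq fun a => by
    change code (decide ((f a : ℤ) < 0), (f a : ℤ).natAbs) = _
    have h1 : decide ((f a : ℤ) < 0) = false := by simp
    rw [h1, Int.natAbs_natCast]

theorem intNegSucc {f : α → ℕ} (hf : PolyTime f) : PolyTime fun a => -((f a : ℤ) + 1) :=
  (pair (PolyTime.const true) (succ hf)).of_code_eq fun a => by
    change code (decide (-((f a : ℤ) + 1) < 0), (-((f a : ℤ) + 1)).natAbs) = _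
    have h1 : decide (-((f a : ℤ) + 1) < 0) = true := by simp; omega
    have h2 : (-((f a : ℤ) + 1)).natAbs = f a + 1 := by omega
    rw [h1, h2]

/-- The list is the clock of its own fold. The last, empty tail is never met by the fold and is
added by hand. -/
theorem tails {l : α → List β} (hl : PolyTime l) : PolyTime fun a => (l a).tails := by
  have key : ∀ (m l : List β) (out : List (List β)), m.length ≤ l.length →
      (m.foldl (fun (x : List β × List (List β)) _ => (x.1.tail, x.1 :: x.2)) (l, out)) =
        (l.drop m.length, (l.tails.take m.length).reverse ++ out) := by
    intro m
    induction m with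
    | nil => simp
    | cons b m ih =>
      intro l out h
      cases l with
      | nil => simp at h
      | cons c l =>
        simp only [List.foldl_cons, List.tail_cons]
        rw [ih l _ (by simpa using h)]
        simp
  have h := foldl (s := fun a => (l a, ([] : List (List β))))
    (step := fun _ x _ => (x.1.tail, x.1 :: x.2)) hl (pair hl (PolyTime.const _))
    (pair (tail (fst (fst (snd PolyTime.id))))
      (cons (fst (fst (snd PolyTime.id))) (snd (fst (snd PolyTime.id)))))
    (by
      obtain ⟨L, hL⟩ := hl.csize_le
      refine ⟨L + (L * (L + 1) + 1) + 1, fun a l' hp => ?_⟩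
      rw [key _ _ _ hp.length_le, List.append_nil, csize_pair, csize_reverse]
      have h1 := csize_list_le ((l a).tails.take l'.length) (csize (l a)) fun b hb =>
        csize_suffix_le ((List.mem_tails _ _).1 (List.mem_of_mem_take hb))
      have h2 := csize_suffix_le (List.drop_suffix l'.length (l a))
      have h3 := length_lt_csize (l a)
      have h4 := hL a
      have h5 : ((l a).tails.take l'.length).length ≤ (l a).length := by
        rw [List.length_take]
        exact (min_le_left _ _).trans hp.length_le
      have h6 := Nat.mul_le_mul (h5.trans (h3.le.trans h4)) (Nat.add_le_add_right h4 1)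
      simp only [Polynomial.eval_add, Polynomial.eval_mul, Polynomial.eval_one]
      omega)
  refine (reverse (cons (PolyTime.const []) (snd h))).congr fun a => ?_
  rw [key _ _ _ le_rfl]
  simp only [List.append_nil, List.reverse_cons, List.reverse_reverse]
  induction l a with
  | nil => rfl
  | cons b l ih => simpa using ih

end PolyTime

end CC

namespace CC

open Coded

/-! ### The algebra of local operations -/

namespace QState

variable {Q : Type} [DecidableEq Q]

/-- `ρ ↦ K ρ K†` for an operator `K` on the register that is read by `g` and written by `s`. -/
def conjOn {ι : Type} [Fintype ι] (g : (Q → Bool) → ι) (s : (Q → Bool) → ι → Q → Bool)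
    (K : Matrix ι ι ℂ) (ρ : QState Q) : QState Q :=
  fun c c' => ∑ u, ∑ v, K (g c) u * ρ (s c u) (s c' v) * star (K (g c') v)

theorem conj₁_eq_conjOn (K : Matrix Bool Bool ℂ) (q : Q) :
    conj₁ K q = conjOn (fun c => c q) (fun c u => Function.update c q u) K := rfl

theorem conj₂_eq_conjOn (K : Matrix (Bool × Bool) (Bool × Bool) ℂ) (a b : Q) :
    conj₂ K a b = conjOn (fun c => (c a, c b))
      (fun c u => Function.update (Function.update c a u.1) b u.2) K := rfl

section conjOn

variable {ι κ : Type} [Fintype ι] [Fintype κ]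
  {g : (Q → Bool) → ι} {s : (Q → Bool) → ι → Q → Bool}
  {g' : (Q → Bool) → κ} {s' : (Q → Bool) → κ → Q → Bool}

omit [DecidableEq Q] in
theorem conjOn_apply (K : Matrix ι ι ℂ) (ρ : QState Q) (c c' : Q → Bool) :
    conjOn g s K ρ c c' =
      (K * (Matrix.of fun u v => ρ (s c u) (s c' v)) * K.conjTranspose) (g c) (g c') := by
  simp only [conjOn, Matrix.mul_apply, Matrix.conjTranspose_apply, Matrix.of_apply, Finset.sum_mul]
  rw [Finset.sum_comm]

omit [DecidableEq Q] in
theorem conjOn_mul (h1 : ∀ c u, g (s c u) = u) (h2 : ∀ c u v, s (s c u) v = s c v)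
    (A B : Matrix ι ι ℂ) (ρ : QState Q) :
    conjOn g s A (conjOn g s B ρ) = conjOn g s (A * B) ρ := by
  funext c c'
  rw [conjOn_apply, conjOn_apply]
  have : (Matrix.of fun u v => conjOn g s B ρ (s c u) (s c' v)) =
      B * (Matrix.of fun u v => ρ (s c u) (s c' v)) * B.conjTranspose := by
    ext u v
    rw [Matrix.of_apply, conjOn_apply, h1, h1]
    simp only [h2]
  rw [this, Matrix.conjTranspose_mul]
  simp only [Matrix.mul_assoc]

omit [DecidableEq Q] in
-- The registers are independent: writing one does not change what is read from the other (`h1`,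
-- `h2`), and the two writings commute (`h3`).
theorem conjOn_comm (h1 : ∀ c u, g' (s c u) = g' c) (h2 : ∀ c u, g (s' c u) = g c)
    (h3 : ∀ c u v, s (s' c v) u = s' (s c u) v)
    (A : Matrix ι ι ℂ) (B : Matrix κ κ ℂ) (ρ : QState Q) :
    conjOn g s A (conjOn g' s' B ρ) = conjOn g' s' B (conjOn g s A ρ) := by
  funext c c'
  simp only [conjOn, Finset.mul_sum, Finset.sum_mul, h1, h2, h3]
  have (F : ι → ι → κ → κ → ℂ) : ∑ u, ∑ v, ∑ x, ∑ y, F u v x y = ∑ x, ∑ y, ∑ u, ∑ v, F u v x y := by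
    have h := Finset.sum_comm (s := Finset.univ) (t := Finset.univ)
      (f := fun (p : ι × ι) (r : κ × κ) => F p.1 p.2 r.1 r.2)
    simpa only [Fintype.sum_prod_type] using h
  rw [this]
  refine Finset.sum_congr rfl fun x _ => Finset.sum_congr rfl fun y _ =>
    Finset.sum_congr rfl fun u _ => Finset.sum_congr rfl fun v _ => by ring

omit [DecidableEq Q] in
theorem conjOn_real_smul (K : Matrix ι ι ℂ) (r : ℝ) (ρ : QState Q) :
    conjOn g s K (r • ρ) = r • conjOn g s K ρ := by
  funext c c'
  simp only [conjOn, Pi.smul_apply, Finset.smul_sum, mul_smul_comm, smul_mul_assoc]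

omit [DecidableEq Q] in
-- A scalar meets its conjugate on the other side. In particular phases disappear, which is why
-- universality up to a global phase is enough.
theorem conjOn_smul (K : Matrix ι ι ℂ) (z : ℂ) (ρ : QState Q) :
    conjOn g s (z • K) ρ = (‖z‖ ^ 2) • conjOn g s K ρ := by
  have hz : ((‖z‖ ^ 2 : ℝ) : ℂ) = z * star z := by
    rw [Complex.star_def, Complex.mul_conj, Complex.normSq_eq_norm_sq]
  funext c c'
  simp only [conjOn, Pi.smul_apply, Matrix.smul_apply, smul_eq_mul, Complex.real_smul, star_mul,
    Finset.mul_sum]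
  rw [hz]
  refine Finset.sum_congr rfl fun u _ => Finset.sum_congr rfl fun v _ => by ring

end conjOn

theorem conj₁_mul (A B : Matrix Bool Bool ℂ) (q : Q) (ρ : QState Q) :
    (ρ.conj₁ B q).conj₁ A q = ρ.conj₁ (A * B) q := by
  simp only [conj₁_eq_conjOn]
  exact conjOn_mul (by simp) (by simp) A B ρ

theorem conj₂_mul (A B : Matrix (Bool × Bool) (Bool × Bool) ℂ) {a b : Q} (h : a ≠ b)
    (ρ : QState Q) : (ρ.conj₂ B a b).conj₂ A a b = ρ.conj₂ (A * B) a b := by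
  simp only [conj₂_eq_conjOn]
  refine conjOn_mul ?_ ?_ A B ρ
  · intro c u
    simp [Function.update_of_ne h]
  · intro c u v
    rw [Function.update_comm h.symm, Function.update_idem, Function.update_idem]

theorem conj₁_comm (A B : Matrix Bool Bool ℂ) {p q : Q} (h : p ≠ q) (ρ : QState Q) :
    (ρ.conj₁ B q).conj₁ A p = (ρ.conj₁ A p).conj₁ B q := by
  simp only [conj₁_eq_conjOn]
  refine conjOn_comm ?_ ?_ ?_ A B ρ
  · intro c u; simp [Function.update_of_ne h.symm]
  · intro c u; simp [Function.update_of_ne h]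
  · intro c u v; exact Function.update_comm h.symm _ _ _

theorem conj₁_conj₂_comm (A : Matrix Bool Bool ℂ) (B : Matrix (Bool × Bool) (Bool × Bool) ℂ)
    {p a b : Q} (ha : p ≠ a) (hb : p ≠ b) (ρ : QState Q) :
    (ρ.conj₂ B a b).conj₁ A p = (ρ.conj₁ A p).conj₂ B a b := by
  simp only [conj₁_eq_conjOn, conj₂_eq_conjOn]
  refine conjOn_comm ?_ ?_ ?_ A B ρ
  · intro c u; simp [Function.update_of_ne ha.symm, Function.update_of_ne hb.symm]
  · intro c u; simp [Function.update_of_ne ha, Function.update_of_ne hb]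
  · intro c u v
    rw [Function.update_comm hb.symm, Function.update_comm ha.symm]

theorem conj₂_comm (A B : Matrix (Bool × Bool) (Bool × Bool) ℂ)
    {p q a b : Q} (hpa : p ≠ a) (hpb : p ≠ b) (hqa : q ≠ a) (hqb : q ≠ b) (ρ : QState Q) :
    (ρ.conj₂ B a b).conj₂ A p q = (ρ.conj₂ A p q).conj₂ B a b := by
  simp only [conj₂_eq_conjOn]
  refine conjOn_comm ?_ ?_ ?_ A B ρ
  · intro c u
    simp [Function.update_of_ne hpa.symm, Function.update_of_ne hpb.symm,
      Function.update_of_ne hqa.symm, Function.update_of_ne hqb.symm]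
  · intro c u
    simp [Function.update_of_ne hpa, Function.update_of_ne hpb,
      Function.update_of_ne hqa, Function.update_of_ne hqb]
  · intro c u v
    rw [Function.update_comm hpb.symm, Function.update_comm hpa.symm,
      Function.update_comm hqb.symm, Function.update_comm hqa.symm]

theorem conj₁_real_smul (K : Matrix Bool Bool ℂ) (q : Q) (r : ℝ) (ρ : QState Q) :
    (r • ρ).conj₁ K q = r • ρ.conj₁ K q := conjOn_real_smul K r ρ

theorem conj₂_real_smul (K : Matrix (Bool × Bool) (Bool × Bool) ℂ) (a b : Q) (r : ℝ)
    (ρ : QState Q) : (r • ρ).conj₂ K a b = r • ρ.conj₂ K a b := conjOn_real_smul K r ρ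

theorem conj₁_smul (K : Matrix Bool Bool ℂ) (q : Q) (z : ℂ) (ρ : QState Q) :
    ρ.conj₁ (z • K) q = (‖z‖ ^ 2) • ρ.conj₁ K q := conjOn_smul K z ρ

theorem conj₂_smul (K : Matrix (Bool × Bool) (Bool × Bool) ℂ) (a b : Q) (z : ℂ)
    (ρ : QState Q) : ρ.conj₂ (z • K) a b = (‖z‖ ^ 2) • ρ.conj₂ K a b := conjOn_smul K z ρ

theorem conj₁_one (q : Q) (ρ : QState Q) : ρ.conj₁ 1 q = ρ := by
  funext c c'
  simp [conj₁, Matrix.one_apply]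

theorem conj₂_one (a b : Q) (ρ : QState Q) : ρ.conj₂ 1 a b = ρ := by
  funext c c'
  simp [conj₂, Matrix.one_apply]

/-- Turns one-qubit operators into matrices on two qubits, so that everything done to an edge can be
multiplied out as a product of matrices. -/
theorem conj₁_eq_conj₂_left (V : Matrix Bool Bool ℂ) {a b : Q} (h : a ≠ b) (ρ : QState Q) :
    ρ.conj₁ V a = ρ.conj₂ (V ⊗ₖ (1 : Matrix Bool Bool ℂ)) a b := by
  have hu : ∀ (c : Q → Bool) (u : Bool), Function.update (Function.update c a u) b (c b) =
      Function.update c a u := fun c u => by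
    rw [Function.update_eq_self_iff, Function.update_of_ne h.symm]
  funext c c'
  have h1 := hu c
  have h2 := hu c'
  cases hc : c b <;> cases hc' : c' b <;> rw [hc] at h1 <;> rw [hc'] at h2 <;>
    simp [conj₁, conj₂, Fintype.sum_prod_type, Matrix.one_apply, h1, h2, hc, hc']

theorem conj₁_eq_conj₂_right (V : Matrix Bool Bool ℂ) {a b : Q} (ρ : QState Q) :
    ρ.conj₁ V b = ρ.conj₂ ((1 : Matrix Bool Bool ℂ) ⊗ₖ V) a b := by
  funext c c'
  have h1 := Function.update_eq_self a c
  have h2 := Function.update_eq_self a c'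
  cases hc : c a <;> cases hc' : c' a <;> rw [hc] at h1 <;> rw [hc'] at h2 <;>
    simp [conj₁, conj₂, Fintype.sum_prod_type, Matrix.one_apply, h1, h2, hc, hc']

theorem conj₂_submatrix_swap (W : Matrix (Bool × Bool) (Bool × Bool) ℂ) {a b : Q} (h : a ≠ b)
    (ρ : QState Q) : ρ.conj₂ (W.submatrix Prod.swap Prod.swap) b a = ρ.conj₂ W a b := by
  funext c c'
  simp only [conj₂, Matrix.submatrix_apply, Prod.swap_prod_mk]
  rw [← (Equiv.prodComm Bool Bool).sum_comp]
  refine Finset.sum_congr rfl fun u _ => ?_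
  rw [← (Equiv.prodComm Bool Bool).sum_comp]
  refine Finset.sum_congr rfl fun v _ => ?_
  simp [Function.update_comm h]

/-- Diagonal operators multiply each matrix entry of the state by a number, so they commute even if
they share qubits. This allows the parities of all edges of a path to be measured independently of
their order. -/
theorem conj₂_diagonal_comm (d e : Bool × Bool → ℂ) (a b a' b' : Q) (ρ : QState Q) :
    (ρ.conj₂ (Matrix.diagonal e) a' b').conj₂ (Matrix.diagonal d) a b =
      (ρ.conj₂ (Matrix.diagonal d) a b).conj₂ (Matrix.diagonal e) a' b' := by
  have key : ∀ (d : Bool × Bool → ℂ) (a b : Q) (ρ : QState Q) (c c' : Q → Bool),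
      ρ.conj₂ (Matrix.diagonal d) a b c c' = d (c a, c b) * ρ c c' * star (d (c' a, c' b)) := by
    intro d a b ρ c c'
    simp only [conj₂]
    rw [Finset.sum_eq_single (c a, c b), Finset.sum_eq_single (c' a, c' b)]
    · simp
    · intro v _ hv; rw [Matrix.diagonal_apply_ne' _ hv]; simp
    · simp
    · intro u _ hu; rw [Matrix.diagonal_apply_ne' _ hu]; simp
    · simp
  funext c c'
  simp only [key]
  ring

/-! ### Placing qubits at sites, and the support of a state -/

section place

variable {A : Type}

omit [DecidableEq Q] in
theorem place_zero (f : A → Q) : (0 : QState A).place f = 0 := by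
  funext c c'
  simp [place]

omit [DecidableEq Q] in
theorem place_add (f : A → Q) (ρ σ : QState A) : (ρ + σ).place f = ρ.place f + σ.place f := by
  funext c c'
  simp only [place, Pi.add_apply]
  split <;> simp

omit [DecidableEq Q] in
theorem place_ne_zero {f : A → Q} {ρ : QState A} (h : ρ.place f ≠ 0) : ρ ≠ 0 := by
  rintro rfl
  exact h (place_zero f)

variable [DecidableEq A]

omit [DecidableEq A] in
theorem update_zero_off_range_iff {f : A → Q} {a : A} (c c' : Q → Bool) (u v : Bool) :
    (∀ q, q ∉ Set.range f →
      Function.update c (f a) u q = false ∧ Function.update c' (f a) v q = false) ↔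
    ∀ q, q ∉ Set.range f → c q = false ∧ c' q = false := by
  refine forall_congr' fun q => imp_congr_right fun hq => ?_
  have : q ≠ f a := fun h => hq ⟨a, h.symm⟩
  rw [Function.update_of_ne this, Function.update_of_ne this]

omit [DecidableEq Q] [DecidableEq A] in
theorem place_pos {f : A → Q} {c c' : Q → Bool}
    (h : ∀ q, q ∉ Set.range f → c q = false ∧ c' q = false) (ρ : QState A) :
    ρ.place f c c' = ρ (c ∘ f) (c' ∘ f) := if_pos h

omit [DecidableEq Q] [DecidableEq A] in
theorem place_neg {f : A → Q} {c c' : Q → Bool}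
    (h : ¬∀ q, q ∉ Set.range f → c q = false ∧ c' q = false) (ρ : QState A) :
    ρ.place f c c' = 0 := if_neg h

theorem conj₁_place {f : A → Q} (hf : Function.Injective f) (K : Matrix Bool Bool ℂ) (a : A)
    (ρ : QState A) : (ρ.place f).conj₁ K (f a) = (ρ.conj₁ K a).place f := by
  funext c c'
  simp only [conj₁]
  by_cases h : ∀ q, q ∉ Set.range f → c q = false ∧ c' q = false
  · rw [place_pos h]
    refine Finset.sum_congr rfl fun u _ => Finset.sum_congr rfl fun v _ => ?_
    rw [place_pos ((update_zero_off_range_iff c c' u v).2 h),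
      Function.update_comp_eq_of_injective _ hf, Function.update_comp_eq_of_injective _ hf]
    rfl
  · rw [place_neg h]
    refine Finset.sum_eq_zero fun u _ => Finset.sum_eq_zero fun v _ => ?_
    rw [place_neg fun h' => h ((update_zero_off_range_iff c c' u v).1 h')]
    simp

theorem conj₂_place {f : A → Q} (hf : Function.Injective f)
    (K : Matrix (Bool × Bool) (Bool × Bool) ℂ) (a b : A) (ρ : QState A) :
    (ρ.place f).conj₂ K (f a) (f b) = (ρ.conj₂ K a b).place f := by
  funext c c'
  simp only [conj₂]
  by_cases h : ∀ q, q ∉ Set.range f → c q = false ∧ c' q = false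
  · rw [place_pos h]
    refine Finset.sum_congr rfl fun u _ => Finset.sum_congr rfl fun v _ => ?_
    rw [place_pos ((update_zero_off_range_iff _ _ u.2 v.2).2
        ((update_zero_off_range_iff c c' u.1 v.1).2 h)),
      Function.update_comp_eq_of_injective _ hf, Function.update_comp_eq_of_injective _ hf,
      Function.update_comp_eq_of_injective _ hf, Function.update_comp_eq_of_injective _ hf]
    rfl
  · rw [place_neg h]
    refine Finset.sum_eq_zero fun u _ => Finset.sum_eq_zero fun v _ => ?_
    rw [place_neg fun h' => h ((update_zero_off_range_iff c c' u.1 v.1).1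
      ((update_zero_off_range_iff _ _ u.2 v.2).1 h'))]
    simp

/-- All qubits outside `S` are in the state `|0⟩`. -/
def SupportedOn (S : Set A) (ρ : QState A) : Prop :=
  ∀ c c', ρ c c' ≠ 0 → ∀ q, q ∉ S → c q = false ∧ c' q = false

omit [DecidableEq Q] [DecidableEq A] in
-- Outside `S` the qubits are in |0⟩, and so are all sites without a qubit; it makes no difference
-- where such qubits are put. This is used when new qubits receive a row.
theorem place_congr {f g : A → Q} (hf : Function.Injective f) (hg : Function.Injective g)
    {S : Set A} {ρ : QState A} (hρ : SupportedOn S ρ) (h : ∀ a ∈ S, f a = g a) :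
    ρ.place f = ρ.place g := by
  classical
  have main : ∀ f g : A → Q, Function.Injective g → (∀ a ∈ S, f a = g a) →
      ∀ c c', ρ.place f c c' ≠ 0 → ρ.place f c c' = ρ.place g c c' := by
    intro f g hg h c c' hne
    unfold place at hne ⊢
    split_ifs at hne with h1
    swap
    · exact absurd rfl hne
    have h2 := hρ _ _ hne
    have h3 : ∀ a, (c (f a) = c (g a) ∧ c' (f a) = c' (g a)) := by
      intro a
      by_cases ha : a ∈ S
      · rw [h a ha]; simp
      · have h4 := h2 a ha
        by_cases h5 : g a ∈ Set.range f
        · obtain ⟨b, hb⟩ := h5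
          by_cases hbS : b ∈ S
          · have := hg (hb.symm.trans (h b hbS))
            exact absurd (this ▸ hbS) ha
          · have h6 := h2 b hbS
            simp only [Function.comp_apply] at h4 h6
            rw [← hb, h4.1, h4.2, h6.1, h6.2]; simp
        · have h6 := h1 _ h5
          simp only [Function.comp_apply] at h4
          rw [h4.1, h4.2, h6.1, h6.2]; simp
    rw [if_pos h1, if_pos]
    · congr 1 <;> funext a
      · exact (h3 a).1
      · exact (h3 a).2
    · intro q hq
      by_cases h5 : q ∈ Set.range f
      · obtain ⟨a, rfl⟩ := h5
        by_cases ha : a ∈ S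
        · exact absurd ⟨a, (h a ha).symm⟩ hq
        · exact h2 a ha
      · exact h1 q h5
  funext c c'
  by_cases h1 : ρ.place f c c' = 0
  · by_cases h2 : ρ.place g c c' = 0
    · rw [h1, h2]
    · exact (main g f hf (fun a ha => (h a ha).symm) c c' h2).symm
  · exact main f g hg h c c' h1

omit [DecidableEq Q] [DecidableEq A] in
theorem supportedOn_place (f : A → Q) (ρ : QState A) : SupportedOn (Set.range f) (ρ.place f) := by
  intro c c' h q hq
  unfold place at h
  split_ifs at h with h1
  · exact h1 q hq
  · exact absurd rfl h

theorem SupportedOn.conj₁ {S : Set Q} {ρ : QState Q} (h : SupportedOn S ρ)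
    (K : Matrix Bool Bool ℂ) {q : Q} (hq : q ∈ S) : SupportedOn S (ρ.conj₁ K q) := by
  intro c c' hne p hp
  obtain ⟨u, _, hu⟩ := Finset.exists_ne_zero_of_sum_ne_zero hne
  obtain ⟨v, _, hv⟩ := Finset.exists_ne_zero_of_sum_ne_zero hu
  have := h _ _ (right_ne_zero_of_mul (left_ne_zero_of_mul hv)) p hp
  have hpq : p ≠ q := fun h => hp (h ▸ hq)
  rwa [Function.update_of_ne hpq, Function.update_of_ne hpq] at this

theorem SupportedOn.conj₂ {S : Set Q} {ρ : QState Q} (h : SupportedOn S ρ)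
    (K : Matrix (Bool × Bool) (Bool × Bool) ℂ) {a b : Q} (ha : a ∈ S) (hb : b ∈ S) :
    SupportedOn S (ρ.conj₂ K a b) := by
  intro c c' hne p hp
  obtain ⟨u, _, hu⟩ := Finset.exists_ne_zero_of_sum_ne_zero hne
  obtain ⟨v, _, hv⟩ := Finset.exists_ne_zero_of_sum_ne_zero hu
  have := h _ _ (right_ne_zero_of_mul (left_ne_zero_of_mul hv)) p hp
  have hpa : p ≠ a := fun h => hp (h ▸ ha)
  have hpb : p ≠ b := fun h => hp (h ▸ hb)
  rwa [Function.update_of_ne hpb, Function.update_of_ne hpb, Function.update_of_ne hpa,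
    Function.update_of_ne hpa] at this

omit [DecidableEq Q] in
theorem SupportedOn.mono {S T : Set Q} {ρ : QState Q} (h : SupportedOn S ρ) (hST : S ⊆ T) :
    SupportedOn T ρ := fun c c' hne q hq => h c c' hne q fun hqS => hq (hST hqS)

omit [DecidableEq Q] in
theorem SupportedOn.zero (S : Set Q) : SupportedOn S (0 : QState Q) :=
  fun _ _ h => absurd rfl h

omit [DecidableEq Q] in
theorem SupportedOn.add {S : Set Q} {ρ σ : QState Q} (h : SupportedOn S ρ)
    (h' : SupportedOn S σ) : SupportedOn S (ρ + σ) := by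
  intro c c' hne q hq
  by_cases h1 : ρ c c' = 0
  · refine h' c c' (fun h2 => hne ?_) q hq
    simp [h1, h2]
  · exact h c c' h1 q hq

end place

end QState

end CC

namespace CC

open Coded

/-! ### The elementary gates -/

section intGates

/-- The Hadamard matrix without its normalisation. -/
def intH : Matrix Bool Bool ℤ := Matrix.of fun a b => if a && b then -1 else 1

/-- The Pauli matrix `X`, or the identity. -/
def intX (t : Bool) : Matrix Bool Bool ℤ := Matrix.of fun a b => if xor a b = t then 1 else 0

/-- The Pauli matrix `Z`, or the identity. -/
def intZ (t : Bool) : Matrix Bool Bool ℤ := Matrix.diagonal fun a => if a && t then -1 else 1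

/-- A projector of the computational basis. -/
def intP (t : Bool) : Matrix Bool Bool ℤ := Matrix.diagonal fun a => if a = t then 1 else 0

def intCNOT : Matrix (Bool × Bool) (Bool × Bool) ℤ :=
  Matrix.of fun u v => if u.1 = v.1 ∧ u.2 = xor v.1 v.2 then 1 else 0

def intSWAP : Matrix (Bool × Bool) (Bool × Bool) ℤ :=
  Matrix.of fun u v => if u.1 = v.2 ∧ u.2 = v.1 then 1 else 0

/-- The projector on a given parity of two qubits. -/
def intD (s : Bool) : Matrix (Bool × Bool) (Bool × Bool) ℤ :=
  Matrix.diagonal fun u => if xor u.1 u.2 = s then 1 else 0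

/-- A parity is measured by a CNOT, a measurement of the target, and a second CNOT. -/
theorem intCNOT_conj (s : Bool) :
    intCNOT * ((1 : Matrix Bool Bool ℤ) ⊗ₖ intP s) * intCNOT = intD s := by
  revert s; decide

theorem intX_mul_intX (t : Bool) : intX t * intX t = 1 := by revert t; decide

theorem intZ_mul_intZ (t : Bool) : intZ t * intZ t = 1 := by revert t; decide

theorem intX_false : intX false = 1 := by decide

theorem intZ_false : intZ false = 1 := by decide

/-- The fate of the site that is left: Hadamard, projection on the outcome `t` and the flip back to
0 combine to the column |0⟩ times the row with entries 1 and (-1)^t. -/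
def intA (t : Bool) : Matrix Bool Bool ℤ :=
  Matrix.of fun a b => if a then 0 else if t && b then -1 else 1

theorem intA_eq (t : Bool) : intX t * (intP t * intH) = intA t := by revert t; decide

/-- The Pauli error carried by a moving qubit, with its entries written out so that identities can
be decided. -/
def intY (x z : Bool) : Matrix Bool Bool ℤ :=
  Matrix.of fun a b => if xor a b = x then if b && z then -1 else 1 else 0

theorem intY_eq (x z : Bool) : intX x * intZ z = intY x z := by revert x z; decide

/-- What has happened to an edge after the parity measurement with outcome `s`: its second site came
in as |0⟩, received a Hadamard, and the first site carried the error `intY x z`. -/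
def intS (s x z : Bool) : Matrix (Bool × Bool) (Bool × Bool) ℤ :=
  Matrix.of fun u v => if xor u.1 u.2 = s ∧ v.2 = false then intY x z u.1 v.1 else 0

theorem intS_eq (s x z : Bool) :
    intD s * (((1 : Matrix Bool Bool ℤ) ⊗ₖ intH) * (intY x z ⊗ₖ intP false)) = intS s x z := by
  revert s x z; decide

/-- The identity behind a hop, a finite check over the integers. The left side moves the qubit and
adds the outcomes to its Pauli error; the sign comes from reordering X and Z and disappears under
conjugation. -/
theorem intA_mul_intS (s t x z : Bool) : ∃ ε : ℤ, (ε = 1 ∨ ε = -1) ∧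
    (intA t ⊗ₖ (1 : Matrix Bool Bool ℤ)) * intS s x z =
      ε • (((1 : Matrix Bool Bool ℤ) ⊗ₖ intY (xor x s) (xor z t)) *
        (intSWAP * ((1 : Matrix Bool Bool ℤ) ⊗ₖ intP false))) := by
  have h : (intA t ⊗ₖ (1 : Matrix Bool Bool ℤ)) * intS s x z =
        1 • (((1 : Matrix Bool Bool ℤ) ⊗ₖ intY (xor x s) (xor z t)) *
        (intSWAP * ((1 : Matrix Bool Bool ℤ) ⊗ₖ intP false))) ∨
      (intA t ⊗ₖ (1 : Matrix Bool Bool ℤ)) * intS s x z =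
        (-1 : ℤ) • (((1 : Matrix Bool Bool ℤ) ⊗ₖ intY (xor x s) (xor z t)) *
        (intSWAP * ((1 : Matrix Bool Bool ℤ) ⊗ₖ intP false))) := by
    revert s t x z; decide
  rcases h with h | h
  · exact ⟨1, Or.inl rfl, by simpa using h⟩
  · exact ⟨-1, Or.inr rfl, h⟩

end intGates

/-- An integer matrix as a complex matrix. -/
def toC {m : Type} (M : Matrix m m ℤ) : Matrix m m ℂ := M.map (Int.cast : ℤ → ℂ)

section toC

variable {m : Type} [Fintype m] [DecidableEq m]

omit [DecidableEq m] in
theorem toC_mul (M N : Matrix m m ℤ) : toC (M * N) = toC M * toC N := by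
  ext i j
  simp [toC, Matrix.mul_apply]

omit [Fintype m] in
theorem toC_one : toC (1 : Matrix m m ℤ) = 1 := by
  ext i j
  simp [toC, Matrix.one_apply]

omit [Fintype m] [DecidableEq m] in
theorem toC_smul (z : ℤ) (M : Matrix m m ℤ) : toC (z • M) = (z : ℂ) • toC M := by
  ext i j
  simp [toC]

omit [Fintype m] [DecidableEq m] in
theorem toC_kronecker (M N : Matrix m m ℤ) : toC (M ⊗ₖ N) = toC M ⊗ₖ toC N := by
  ext i j
  simp [toC, Matrix.kroneckerMap_apply]

theorem toC_mem_unitaryGroup {M : Matrix m m ℤ} (h : M * M.transpose = 1) :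
    toC M ∈ Matrix.unitaryGroup m ℂ := by
  rw [Matrix.mem_unitaryGroup_iff, Matrix.star_eq_conjTranspose]
  have : (toC M).conjTranspose = toC M.transpose := by
    ext i j
    simp [toC]
  rw [this, ← toC_mul, h, toC_one]

end toC

/-- The Hadamard gate. -/
noncomputable def gateH : Matrix Bool Bool ℂ := (((Real.sqrt 2)⁻¹ : ℝ) : ℂ) • toC intH

theorem gateH_mem : gateH ∈ Matrix.unitaryGroup Bool ℂ := by
  rw [Matrix.mem_unitaryGroup_iff, Matrix.star_eq_conjTranspose]
  have h1 : (toC intH).conjTranspose = toC intH := by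
    ext i j
    cases i <;> cases j <;> simp [toC, intH]
  have h2 : intH * intH = (2 : ℤ) • 1 := by decide
  have h3 : (((Real.sqrt 2)⁻¹ : ℝ) : ℂ) * (((Real.sqrt 2)⁻¹ : ℝ) : ℂ) * 2 = 1 := by
    rw [← Complex.ofReal_mul, ← mul_inv, Real.mul_self_sqrt (by norm_num)]
    norm_num
  rw [gateH, Matrix.conjTranspose_smul, h1, Complex.star_def, Complex.conj_ofReal,
    smul_mul_smul_comm, ← toC_mul, h2, toC_smul, toC_one, smul_smul]
  push_cast
  push_cast at h3
  rw [h3, one_smul]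

theorem gateX_mem : toC (intX true) ∈ Matrix.unitaryGroup Bool ℂ :=
  toC_mem_unitaryGroup (by decide)

theorem gateZ_mem : toC (intZ true) ∈ Matrix.unitaryGroup Bool ℂ :=
  toC_mem_unitaryGroup (by decide)

theorem gateCNOT_mem : toC intCNOT ∈ Matrix.unitaryGroup (Bool × Bool) ℂ :=
  toC_mem_unitaryGroup (by decide)

theorem single_eq_toC_intP (t : Bool) : Matrix.single t t 1 = toC (intP t) := by
  ext i j
  cases t <;> cases i <;> cases j <;> simp [toC, intP]

namespace QState

variable {Q A : Type} [DecidableEq Q]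

theorem conj₁_gateH (q : Q) (ρ : QState Q) :
    ρ.conj₁ gateH q = (2⁻¹ : ℝ) • ρ.conj₁ (toC intH) q := by
  rw [gateH, conj₁_smul, Complex.norm_real, Real.norm_eq_abs, sq_abs, inv_pow,
    Real.sq_sqrt (by norm_num)]

/-- Move the qubit at site `p` to site `q`. -/
def hop (p q : Q) (f : A → Q) (a : A) : Q := if f a = p then q else f a

/-- A move to a vacant site is a permutation of the sites, so it preserves injectivity and is
implemented by the swap matrix. -/
theorem hop_eq_swap {p q : Q} {f : A → Q} (hq : q ∉ Set.range f) :
    hop p q f = Equiv.swap p q ∘ f := by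
  funext a
  simp only [hop, Function.comp_apply]
  split_ifs with h
  · rw [h, Equiv.swap_apply_left]
  · rw [Equiv.swap_apply_of_ne_of_ne h fun h' => hq ⟨a, h'⟩]

theorem hop_hop {p q r : Q} {f : A → Q} (hq : q ∉ Set.range f) :
    hop q r (hop p q f) = hop p r f := by
  funext a
  simp only [hop]
  by_cases h : f a = p
  · simp [h]
  · have : f a ≠ q := fun h' => hq ⟨a, h'⟩
    simp [h, this]

theorem hop_self (p : Q) (f : A → Q) : hop p p f = f := by
  funext a
  simp only [hop]
  split_ifs with h
  · exact h.symm
  · rfl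

theorem range_hop_subset (p q : Q) (f : A → Q) :
    Set.range (hop p q f) ⊆ insert q (Set.range f) := by
  rintro _ ⟨a, rfl⟩
  simp only [hop]
  split_ifs
  · exact Or.inl rfl
  · exact Or.inr ⟨a, rfl⟩

theorem conj₂_swap (p q : Q) (ρ : QState Q) (h : p ≠ q) (c c' : Q → Bool) :
    ρ.conj₂ (toC intSWAP) p q c c' = ρ (c ∘ Equiv.swap p q) (c' ∘ Equiv.swap p q) := by
  have key : ∀ c : Q → Bool, Function.update (Function.update c p (c q)) q (c p) =
      c ∘ Equiv.swap p q := by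
    intro c
    funext r
    by_cases h1 : r = p
    · subst h1; simp [Function.update_of_ne h]
    · by_cases h2 : r = q
      · subst h2; simp
      · simp [Function.update_of_ne h1, Function.update_of_ne h2,
          Equiv.swap_apply_of_ne_of_ne h1 h2]
  have hs : ∀ u v : Bool × Bool, toC intSWAP u v = if v = (u.2, u.1) then 1 else 0 := by
    rintro ⟨a, b⟩ ⟨c, d⟩
    cases a <;> cases b <;> cases c <;> cases d <;> simp [toC, intSWAP]
  rw [← key c, ← key c']
  simp only [conj₂, hs]
  simp

theorem conj₂_swap_place {p q : Q} (h : p ≠ q) {f : A → Q} (hq : q ∉ Set.range f)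
    (σ : QState A) : (σ.place f).conj₂ (toC intSWAP) p q = σ.place (hop p q f) := by
  classical
  funext c c'
  rw [conj₂_swap p q _ h, hop_eq_swap hq]
  unfold place
  refine if_congr ?_ rfl rfl
  constructor
  · intro H r hr
    have := H (Equiv.swap p q r) (fun ⟨a, ha⟩ => hr ⟨a, by simp [ha]⟩)
    simpa using this
  · intro H r hr
    have := H (Equiv.swap p q r) (fun ⟨a, ha⟩ => hr ⟨a, by simpa using ha⟩)
    simpa using this

/-- A vacant site is in |0⟩, so projecting it on |0⟩ changes nothing. -/
theorem conj₂_intP_false {q : Q} (p : Q) {ρ : QState Q}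
    (hρ : SupportedOn {r | r ≠ q} ρ) :
    ρ.conj₂ ((1 : Matrix Bool Bool ℂ) ⊗ₖ toC (intP false)) p q = ρ := by
  rw [← conj₁_eq_conj₂_right]
  funext c c'
  have hP : ∀ u v : Bool, toC (intP false) u v = if u = false ∧ v = false then 1 else 0 := by
    intro u v
    cases u <;> cases v <;> simp [toC, intP]
  have h1 := Function.update_eq_self q c
  have h2 := Function.update_eq_self q c'
  have h3 : ρ c c' ≠ 0 → c q = false ∧ c' q = false := fun h => hρ c c' h q (by simp)
  simp only [conj₁, hP]
  cases hc : c q <;> cases hc' : c' q <;> rw [hc] at h1 <;> rw [hc'] at h2 <;>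
    simp [h1, h2]
  all_goals
    by_contra hne
    have := h3 fun h => hne (by simp [h])
    simp [hc, hc'] at this

/-- One hop along an edge: a Pauli error of the moving qubit is carried along and modified by the
outcomes `s`, `t`. -/
theorem conj_hop {p q : Q} (h : p ≠ q) {f : A → Q} (hq : q ∉ Set.range f) (s t x z : Bool)
    (σ : QState A) :
    (((2 : ℝ) • (((2 : ℝ) • (((σ.place f).conj₁ (toC (intY x z)) p).conj₁ gateH q).conj₂
      (toC (intD s)) p q).conj₁ gateH p).conj₁ (toC (intP t)) p).conj₁ (toC (intX t)) p) =
    (σ.place (hop p q f)).conj₁ (toC (intY (xor x s) (xor z t))) q := by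
  -- The matrix identity holds only if `q` is in |0⟩; as the site is vacant, the projector that
  -- expresses this may be inserted.
  have h0 : (σ.place f).conj₂ ((1 : Matrix Bool Bool ℂ) ⊗ₖ toC (intP false)) p q = σ.place f :=
    conj₂_intP_false p ((supportedOn_place f σ).mono fun r hr => by
      rintro rfl; exact hq hr)
  rw [← conj₂_swap_place h hq, ← h0]
  simp only [conj₁_gateH, conj₁_real_smul, conj₂_real_smul, smul_smul]
  -- The squared normalisations of the two Hadamards cancel the factors 2 of the two measurements.
  -- This is the reason why each outcome has probability 1/2 in every state.
  rw [show ((2 : ℝ) * (2 * 2⁻¹ * 2⁻¹)) = 1 by norm_num, one_smul]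
  rw [conj₁_mul, conj₁_mul, ← toC_mul, ← toC_mul, Matrix.mul_assoc, intA_eq]
  rw [conj₁_eq_conj₂_left _ h, conj₁_eq_conj₂_right _ (a := p), conj₁_eq_conj₂_left _ h,
    conj₁_eq_conj₂_right _ (a := p)]
  simp only [conj₂_mul _ _ h]
  obtain ⟨ε, hε, hmat⟩ := intA_mul_intS s t x z
  have hmat' := congrArg toC hmat
  rw [← intS_eq] at hmat'
  simp only [toC_mul, toC_smul, toC_kronecker, toC_one] at hmat'
  have e1 : (toC (intY x z) ⊗ₖ (1 : Matrix Bool Bool ℂ)) *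
      ((1 : Matrix Bool Bool ℂ) ⊗ₖ toC (intP false)) = toC (intY x z) ⊗ₖ toC (intP false) := by
    rw [← Matrix.mul_kronecker_mul, one_mul, mul_one]
  rw [e1, hmat', conj₂_smul]
  have : ‖(ε : ℂ)‖ ^ 2 = 1 := by rcases hε with rfl | rfl <;> simp
  rw [this, one_smul]

end QState

end CC

namespace CC

open Coded

/-! ### Sequences of operations -/

/-- Apply `A a` for all `a` in a list, the first one first. -/
def seq {α S : Type} (A : α → S → S) : List α → S → S
  | [], ρ => ρ
  | a :: l, ρ => seq A l (A a ρ)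

section seq

variable {α β S : Type}

theorem seq_map (A : β → S → S) (f : α → β) (l : List α) (ρ : S) :
    seq A (l.map f) ρ = seq (fun a => A (f a)) l ρ := by
  induction l generalizing ρ with
  | nil => rfl
  | cons a l ih => exact ih _

theorem seq_filter (A : α → S → S) (p : α → Bool) (l : List α) (ρ : S) :
    seq A (l.filter p) ρ = seq (fun a ρ => if p a then A a ρ else ρ) l ρ := by
  induction l generalizing ρ with
  | nil => rfl
  | cons a l ih =>
    by_cases h : p a
    · simp only [List.filter_cons_of_pos h, seq, h, if_true]; exact ih _
    · simp only [List.filter_cons_of_neg h, seq, h]; exact ih _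

theorem seq_congr {A A' : α → S → S} {l : List α} (h : ∀ a ∈ l, ∀ ρ, A a ρ = A' a ρ) (ρ : S) :
    seq A l ρ = seq A' l ρ := by
  induction l generalizing ρ with
  | nil => rfl
  | cons a l ih =>
    simp only [seq]
    rw [h a (by simp), ih fun b hb => h b (by simp [hb])]

theorem seq_comm_op (A : α → S → S) (l : List α) (F : S → S)
    (h : ∀ a ∈ l, ∀ ρ, F (A a ρ) = A a (F ρ)) (ρ : S) : F (seq A l ρ) = seq A l (F ρ) := by
  induction l generalizing ρ with
  | nil => rfl
  | cons a l ih =>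
    simp only [seq]
    rw [ih fun b hb => h b (by simp [hb]), h a (by simp)]

/-- To collect the operations belonging to one index, `B a` only has to move past `A a'` for the
indices `a'` after `a`. Repeated use turns layers applied to a whole list into one combined
operation for each element. -/
theorem seq_seq {A B : α → S → S} {l : List α}
    (h : l.Pairwise fun a a' => ∀ ρ, B a (A a' ρ) = A a' (B a ρ)) (ρ : S) :
    seq B l (seq A l ρ) = seq (fun a ρ => B a (A a ρ)) l ρ := by
  induction l generalizing ρ with
  | nil => rfl
  | cons a l ih =>
    rw [List.pairwise_cons] at h
    simp only [seq]
    rw [seq_comm_op A l (B a) h.1, ih h.2]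

theorem seq_real_smul [SMul ℝ S] {A : α → S → S} (h : ∀ a (r : ℝ) ρ, A a (r • ρ) = r • A a ρ)
    (l : List α) (r : ℝ) (ρ : S) : seq A l (r • ρ) = r • seq A l ρ := by
  induction l generalizing ρ with
  | nil => rfl
  | cons a l ih => simp only [seq, h, ih]

end seq

/-! ### Programs of a controller whose timesteps depend on earlier outcomes -/

section Stage

/-- Timesteps of unitary gates, of measurements with uniformly distributed outcomes, or any others. -/
inductive StageKind : Type
  | unitary : StageKind
  | meas : StageKind
  | free : StageKind

/-- A timestep, as a function of the outcomes of the preceding ones. -/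
structure Stage (Q : Type) where
  kind : StageKind
  layer : History → List (Instr Q)

/-- The probability of the outcomes `os` of a timestep with `n` operations. -/
noncomputable def StageKind.weight : StageKind → ℕ → List ℕ → NNReal
  | unitary, n, os => if os = List.replicate n 0 then 1 else 0
  | meas, n, os => if os.length = n ∧ ∀ o ∈ os, o < 2 then 2⁻¹ ^ n else 0
  | free, _, _ => 1

noncomputable def Stage.weight {Q : Type} (st : Stage Q) (w : History) (o : List ℕ) : NNReal :=
  st.kind.weight (st.layer w).length o

/-- The probability of the outcomes of a sequence of timesteps (in chronological order). -/
noncomputable def progWeight {Q : Type} : List (Stage Q) → History → List (List ℕ) → NNReal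
  | st :: prog, w, o :: os => st.weight w o * progWeight prog (o :: w) os
  | _, _, _ => 1

variable {B : GateSet} {Q : Type} [Coded Q] [DecidableEq Q] {adj : Q → Q → Prop}

open Circuit QState

theorem act_real_smul (C : Circuit B Q adj) (o : ℕ) (r : ℝ) (ρ : QState Q) (i : Instr Q) :
    C.act o (r • ρ) i = r • C.act o ρ i := by
  cases i <;> simp only [act, conj₁_real_smul, conj₂_real_smul, List.smul_sum, List.map_map] <;> rfl

theorem actLayer_real_smul (C : Circuit B Q adj) (L : List (Instr Q)) (os : List ℕ) (r : ℝ)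
    (ρ : QState Q) : C.actLayer L os (r • ρ) = r • C.actLayer L os ρ := by
  induction L generalizing os ρ with
  | nil => cases os <;> simp [actLayer]
  | cons i L ih => cases os <;> simp [actLayer, act_real_smul, ih]

theorem actLayer_zero (C : Circuit B Q adj) (L : List (Instr Q)) (os : List ℕ) :
    C.actLayer L os 0 = 0 := by
  simpa using actLayer_real_smul C L os 0 0

/-- The state after a sequence of timesteps with given outcomes (in chronological order). -/
noncomputable def exec (C : Circuit B Q adj) :
    List (Stage Q) → History → QState Q → List (List ℕ) → QState Q
  | st :: prog, w, ρ, o :: os => exec C prog (o :: w) (C.actLayer (st.layer w) o ρ) os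
  | _, _, ρ, _ => ρ

theorem exec_real_smul (C : Circuit B Q adj) (prog : List (Stage Q)) (w : History)
    (os : List (List ℕ)) (r : ℝ) (ρ : QState Q) :
    exec C prog w (r • ρ) os = r • exec C prog w ρ os := by
  induction prog generalizing w os ρ with
  | nil => rfl
  | cons st prog ih =>
    cases os with
    | nil => rfl
    | cons o os => simp only [exec, actLayer_real_smul, ih]

/-- Up to normalisation, the timesteps `prog` take the state `ρ` to `ρ'`. -/
def Impl (C : Circuit B Q adj) (prog : List (Stage Q)) (w : History) (os : List (List ℕ))
    (ρ ρ' : QState Q) : Prop :=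
  exec C prog w ρ os = (progWeight prog w os : ℝ) • ρ'

theorem Impl.append {C : Circuit B Q adj} {p p' : List (Stage Q)} {w : History}
    {os os' : List (List ℕ)} {ρ ρ₁ ρ₂ : QState Q} (hlen : os.length = p.length)
    (h : Impl C p w os ρ ρ₁) (h' : Impl C p' (os.reverse ++ w) os' ρ₁ ρ₂) :
    Impl C (p ++ p') w (os ++ os') ρ ρ₂ := by
  have e1 : exec C (p ++ p') w ρ (os ++ os') =
      exec C p' (os.reverse ++ w) (exec C p w ρ os) os' := by
    clear h h'
    induction p generalizing w os ρ with
    | nil =>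
      rw [List.length_nil, List.length_eq_zero_iff] at hlen
      subst hlen
      rfl
    | cons st p ih =>
      cases os with
      | nil => simp at hlen
      | cons o os =>
        simp only [List.cons_append, exec, List.reverse_cons, List.append_assoc,
          List.nil_append]
        exact ih (by simpa using hlen)
  have e2 : progWeight (p ++ p') w (os ++ os') =
      progWeight p w os * progWeight p' (os.reverse ++ w) os' := by
    clear h h' e1
    induction p generalizing w os with
    | nil =>
      rw [List.length_nil, List.length_eq_zero_iff] at hlen
      subst hlen
      simp [progWeight]
    | cons st p ih =>
      cases os with
      | nil => simp at hlen
      | cons o os =>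
        simp only [List.cons_append, progWeight, List.reverse_cons, List.append_assoc,
          List.nil_append]
        rw [ih (by simpa using hlen), mul_assoc]
  unfold Impl at *
  rw [e1, e2, h, exec_real_smul, h', smul_smul, NNReal.coe_mul]

theorem Impl.single {C : Circuit B Q adj} {st : Stage Q} {w : History} {o : List ℕ}
    {ρ ρ' : QState Q} (h : C.actLayer (st.layer w) o ρ = (st.weight w o : ℝ) • ρ') :
    Impl C [st] w [o] ρ ρ' := by
  simpa [Impl, exec, progWeight] using h

theorem actLayer_unitary (C : Circuit B Q adj) {α : Type} (inst : α → Instr Q)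
    (op : α → QState Q → QState Q) (l : List α)
    (h : ∀ a ∈ l, ∀ o ρ, C.act o ρ (inst a) = if o = 0 then op a ρ else 0) (os : List ℕ)
    (ρ : QState Q) : C.actLayer (l.map inst) os ρ =
      (StageKind.unitary.weight l.length os : ℝ) • seq op l ρ := by
  induction l generalizing os ρ with
  | nil => cases os <;> simp [actLayer, StageKind.weight, seq]
  | cons a l ih =>
    cases os with
    | nil => simp [actLayer, StageKind.weight, List.replicate_succ]
    | cons o os =>
      simp only [List.map_cons, actLayer, h a (by simp)]
      by_cases ho : o = 0
      · subst ho
        rw [if_pos rfl, ih (fun b hb => h b (by simp [hb]))]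
        simp [StageKind.weight, List.replicate_succ, seq]
      · rw [if_neg ho, actLayer_zero]
        simp [StageKind.weight, List.replicate_succ, ho]

theorem StageKind.weight_meas_cons (n o : ℕ) (os : List ℕ) :
    StageKind.meas.weight (n + 1) (o :: os) =
      if o < 2 then 2⁻¹ * StageKind.meas.weight n os else 0 := by
  have : ((o :: os).length = n + 1 ∧ ∀ a ∈ o :: os, a < 2) ↔
      o < 2 ∧ os.length = n ∧ ∀ a ∈ os, a < 2 := by
    rw [List.forall_mem_cons, List.length_cons, Nat.add_right_cancel_iff]
    tauto
  simp only [StageKind.weight]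
  rw [if_congr this rfl rfl, ite_and]
  refine if_congr Iff.rfl ?_ rfl
  split
  · rw [pow_succ']
  · simp

/-- The bit that stands for an outcome of a measurement. -/
def bit (o : ℕ) : Bool := decide (o = 1)

/-- Each projection is multiplied by 2 and each outcome is given the weight 1/2, which is a mere
convention at this point. It becomes the true probability through `conj_hop`, where the factors 2
are absorbed. -/
theorem actLayer_meas (C : Circuit B Q adj) {α : Type} (k : ℕ)
    (hk : (C.one k).kraus = [[toC (intP false)], [toC (intP true)]]) (site : α → Q) (l : List α)
    (os : List ℕ) (ρ : QState Q) : C.actLayer (l.map fun a => Instr.one k (site a)) os ρ =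
      (StageKind.meas.weight l.length os : ℝ) •
        seq (fun a ρ => (2 : ℝ) • ρ.conj₁ (toC (intP (bit a.2))) (site a.1)) (l.zip os) ρ := by
  have hact : ∀ o ρ q, C.act o ρ (Instr.one k q) =
      if o < 2 then ρ.conj₁ (toC (intP (bit o))) q else 0 := by
    intro o ρ q
    simp only [act, hk]
    match o with
    | 0 => simp [bit]
    | 1 => simp [bit]
    | o + 2 => simp
  induction l generalizing os ρ with
  | nil => cases os <;> simp [actLayer, StageKind.weight, seq]
  | cons a l ih =>
    cases os with
    | nil => simp [actLayer, StageKind.weight]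
    | cons o os =>
      simp only [List.map_cons, actLayer, hact, List.zip_cons_cons, seq]
      rw [seq_real_smul (fun a r ρ => by rw [conj₁_real_smul, smul_comm])]
      rw [List.length_cons, StageKind.weight_meas_cons]
      by_cases ho : o < 2
      · rw [if_pos ho, if_pos ho, ih, smul_smul]
        congr 1
        push_cast
        ring
      · rw [if_neg ho, if_neg ho, actLayer_zero]
        simp

/-- One timestep for each letter of a word, the letter being applied at all selected places. -/
def wordBlock {α γ : Type} (inst : γ → α → Instr Q) :
    List γ → (History → List α) → List (Stage Q)
  | [], _ => []
  | g :: gs, sel => ⟨StageKind.unitary, fun w => (sel w).map (inst g)⟩ ::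
      -- Forgetting the outcomes of the timestep just performed lets all letters of the word be
      -- applied at the same places, selected at the start of the word.
      wordBlock inst gs fun w => sel w.tail

omit [Coded Q] [DecidableEq Q] in
theorem length_wordBlock {α γ : Type} (inst : γ → α → Instr Q) (word : List γ)
    (sel : History → List α) : (wordBlock inst word sel).length = word.length := by
  induction word generalizing sel with
  | nil => rfl
  | cons g gs ih => simp [wordBlock, ih]

/-- The operation described by a word. -/
def wordOp {α γ S : Type} (op : γ → α → S → S) : List γ → α → S → S
  | [], _, ρ => ρ
  | g :: gs, a, ρ => wordOp op gs a (op g a ρ)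

theorem wordOp_apply {α β γ S : Type} (op : γ → β → S → S) (f : α → β) (word : List γ) (a : α)
    (ρ : S) : wordOp (fun g a => op g (f a)) word a ρ = wordOp op word (f a) ρ := by
  induction word generalizing ρ with
  | nil => rfl
  | cons g gs ih => exact ih _

theorem wordOp_comm {α γ S : Type} {op : γ → α → S → S} {word : List γ} {a : α} {F : S → S}
    (h : ∀ g ∈ word, ∀ ρ, op g a (F ρ) = F (op g a ρ)) (ρ : S) :
    wordOp op word a (F ρ) = F (wordOp op word a ρ) := by
  induction word generalizing ρ with
  | nil => rfl
  | cons g gs ih =>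
    simp only [wordOp]
    rw [h g (by simp), ih fun g' hg' => h g' (by simp [hg'])]

/-- The timesteps apply one letter at all places. Letters at different places commute, so this
equals applying the complete word place by place. -/
theorem Impl.wordBlock {C : Circuit B Q adj} {α γ : Type} {inst : γ → α → Instr Q}
    {op : γ → α → QState Q → QState Q} {word : List γ} {sel : History → List α} {w : History}
    {os : List (List ℕ)} {ρ : QState Q} (hlen : os.length = word.length)
    (hact : ∀ g ∈ word, ∀ a ∈ sel w, ∀ o ρ,
      C.act o ρ (inst g a) = if o = 0 then op g a ρ else 0)
    (hcomm : (sel w).Pairwise fun a a' => ∀ g ∈ word, ∀ g' ∈ word, ∀ ρ,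
      op g a (op g' a' ρ) = op g' a' (op g a ρ)) :
    Impl C (wordBlock inst word sel) w os ρ (seq (wordOp op word) (sel w) ρ) := by
  induction word generalizing sel w os ρ with
  | nil =>
    have : seq (wordOp op ([] : List γ)) (sel w) ρ = ρ := by
      induction sel w generalizing ρ with
      | nil => rfl
      | cons a l ih => exact ih
    simp [Impl, CC.wordBlock, exec, progWeight, this]
  | cons g gs ih =>
    cases os with
    | nil => simp at hlen
    | cons o os =>
      have h1 : Impl C [⟨StageKind.unitary, fun w => (sel w).map (inst g)⟩] w [o] ρ
          (seq (op g) (sel w) ρ) := by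
        refine Impl.single ?_
        rw [actLayer_unitary C (inst g) (op g) (sel w) (hact g (by simp))]
        simp [Stage.weight]
      have h2 := ih (sel := fun w => sel w.tail) (w := o :: w) (os := os)
        (ρ := seq (op g) (sel w) ρ) (by simpa using hlen)
        (fun g' hg' a ha => hact g' (by simp [hg']) a ha)
        (hcomm.imp fun h g₁ h₁ g₂ h₂ => h g₁ (by simp [h₁]) g₂ (by simp [h₂]))
      have h3 := Impl.append (p' := CC.wordBlock inst gs fun w => sel w.tail) (os' := os)
        (by rfl) h1 h2
      simp only [List.tail_cons] at h3
      rw [seq_seq] at h3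
      · exact h3
      · exact hcomm.imp fun {a a'} h ρ => wordOp_comm
          (fun g' hg' ρ => h g' (by simp [hg']) g (by simp) ρ) ρ

end Stage

/-! ### Words of basic operations -/

section Words

/-- A two-qubit gate of the grid: a basic operation applied to one or both of the qubits. -/
inductive Gate : Type
  | fst (k : ℕ) : Gate
  | snd (k : ℕ) : Gate
  | both (k : ℕ) : Gate
  | swapped (k : ℕ) : Gate

namespace Gate

/-- The instruction that applies a gate to a pair of qubits. -/
def instr {Q : Type} : Gate → Q × Q → Instr Q
  | fst k, p => Instr.one k p.1
  | snd k, p => Instr.one k p.2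
  | both k, p => Instr.two k p.1 p.2
  | swapped k, p => Instr.two k p.2 p.1

/-- The matrix of a gate is `W`. -/
def Is (one : ℕ → Instrument Bool) (two : ℕ → Instrument (Bool × Bool)) :
    Gate → Matrix (Bool × Bool) (Bool × Bool) ℂ → Prop
  | fst k, W => ∃ V, (one k).kraus = [[V]] ∧ W = V ⊗ₖ (1 : Matrix Bool Bool ℂ)
  | snd k, W => ∃ V, (one k).kraus = [[V]] ∧ W = (1 : Matrix Bool Bool ℂ) ⊗ₖ V
  | both k, W => (two k).kraus = [[W]]
  | swapped k, W => (two k).kraus = [[W.submatrix Prod.swap Prod.swap]]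

end Gate

/-- `word` is a sequence of names of one-qubit unitaries whose product is `U` up to a phase. -/
def IsWord₁ (one : ℕ → Instrument Bool) (word : List (ℕ × Matrix Bool Bool ℂ))
    (U : Matrix Bool Bool ℂ) : Prop :=
  (∀ g ∈ word, (one g.1).kraus = [[g.2]]) ∧
    ∃ z : ℂ, ‖z‖ = 1 ∧ (word.map Prod.snd).reverse.prod = z • U

/-- `word` is a sequence of gates whose product is `U` up to a phase. -/
def IsWord₂ (one : ℕ → Instrument Bool) (two : ℕ → Instrument (Bool × Bool))
    (word : List (Gate × Matrix (Bool × Bool) (Bool × Bool) ℂ))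
    (U : Matrix (Bool × Bool) (Bool × Bool) ℂ) : Prop :=
  (∀ g ∈ word, g.1.Is one two g.2) ∧
    ∃ z : ℂ, ‖z‖ = 1 ∧ (word.map Prod.snd).reverse.prod = z • U

variable {B : GateSet} {Q : Type} [Coded Q] [DecidableEq Q] {adj : Q → Q → Prop}

open Circuit QState

theorem act_one_unitary (C : Circuit B Q adj) {k : ℕ} {V : Matrix Bool Bool ℂ}
    (h : (C.one k).kraus = [[V]]) (q : Q) (o : ℕ) (ρ : QState Q) :
    C.act o ρ (Instr.one k q) = if o = 0 then ρ.conj₁ V q else 0 := by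
  simp only [act, h]
  cases o <;> simp

theorem act_two_unitary (C : Circuit B Q adj) {k : ℕ} {V : Matrix (Bool × Bool) (Bool × Bool) ℂ}
    (h : (C.two k).kraus = [[V]]) (a b : Q) (o : ℕ) (ρ : QState Q) :
    C.act o ρ (Instr.two k a b) = if o = 0 then ρ.conj₂ V a b else 0 := by
  simp only [act, h]
  cases o <;> simp

theorem act_gate (C : Circuit B Q adj) {g : Gate} {W : Matrix (Bool × Bool) (Bool × Bool) ℂ}
    (h : g.Is C.one C.two W) {p q : Q} (hpq : p ≠ q) (o : ℕ) (ρ : QState Q) :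
    C.act o ρ (g.instr (p, q)) = if o = 0 then ρ.conj₂ W p q else 0 := by
  cases g with
  | fst k =>
    obtain ⟨V, hV, rfl⟩ := h
    rw [← conj₁_eq_conj₂_left V hpq]
    exact act_one_unitary C hV _ _ _
  | snd k =>
    obtain ⟨V, hV, rfl⟩ := h
    rw [← conj₁_eq_conj₂_right V]
    exact act_one_unitary C hV _ _ _
  | both k => exact act_two_unitary C h _ _ _ _
  | swapped k =>
    rw [← conj₂_submatrix_swap W hpq]
    exact act_two_unitary C h _ _ _ _

omit [Coded Q] in
theorem wordOp_conj₁ (word : List (ℕ × Matrix Bool Bool ℂ)) {U : Matrix Bool Bool ℂ}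
    (h : ∃ z : ℂ, ‖z‖ = 1 ∧ (word.map Prod.snd).reverse.prod = z • U) (q : Q) (ρ : QState Q) :
    wordOp (fun g q ρ => QState.conj₁ g.2 q ρ) word q ρ = ρ.conj₁ U q := by
  have key : ∀ ρ : QState Q, wordOp (fun g q ρ => QState.conj₁ g.2 q ρ) word q ρ =
      ρ.conj₁ (word.map Prod.snd).reverse.prod q := by
    clear h
    induction word with
    | nil => intro ρ; simp [wordOp, conj₁_one]
    | cons g gs ih =>
      intro ρ
      simp only [wordOp, ih, conj₁_mul]
      simp
  obtain ⟨z, hz, h⟩ := h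
  rw [key, h, conj₁_smul, hz, one_pow, one_smul]

omit [Coded Q] in
theorem wordOp_conj₂ (word : List (Gate × Matrix (Bool × Bool) (Bool × Bool) ℂ))
    {U : Matrix (Bool × Bool) (Bool × Bool) ℂ}
    (h : ∃ z : ℂ, ‖z‖ = 1 ∧ (word.map Prod.snd).reverse.prod = z • U) {p q : Q} (hpq : p ≠ q)
    (ρ : QState Q) :
    wordOp (fun g (e : Q × Q) ρ => QState.conj₂ g.2 e.1 e.2 ρ) word (p, q) ρ = ρ.conj₂ U p q := by
  have key : ∀ ρ : QState Q,
      wordOp (fun g (e : Q × Q) ρ => QState.conj₂ g.2 e.1 e.2 ρ) word (p, q) ρ =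
      ρ.conj₂ (word.map Prod.snd).reverse.prod p q := by
    clear h
    induction word with
    | nil => intro ρ; simp [wordOp, conj₂_one]
    | cons g gs ih =>
      intro ρ
      simp only [wordOp, ih, conj₂_mul _ _ hpq]
      simp
  obtain ⟨z, hz, h⟩ := h
  rw [key, h, conj₂_smul, hz, one_pow, one_smul]

/-- Apply the word of a one-qubit unitary at all selected sites. -/
def oneBlock {α : Type} (word : List (ℕ × Matrix Bool Bool ℂ)) (site : α → Q)
    (sel : History → List α) : List (Stage Q) :=
  wordBlock (fun g a => Instr.one g.1 (site a)) word sel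

/-- Apply the word of a two-qubit unitary at all selected edges. -/
def twoBlock {α : Type} (word : List (Gate × Matrix (Bool × Bool) (Bool × Bool) ℂ))
    (edge : α → Q × Q) (sel : History → List α) : List (Stage Q) :=
  wordBlock (fun g a => g.1.instr (edge a)) word sel

omit [Coded Q] [DecidableEq Q] in
theorem length_oneBlock {α : Type} (word : List (ℕ × Matrix Bool Bool ℂ)) (site : α → Q)
    (sel : History → List α) : (oneBlock word site sel).length = word.length :=
  length_wordBlock _ _ _

omit [Coded Q] [DecidableEq Q] in
theorem length_twoBlock {α : Type} (word : List (Gate × Matrix (Bool × Bool) (Bool × Bool) ℂ))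
    (edge : α → Q × Q) (sel : History → List α) :
    (twoBlock word edge sel).length = word.length :=
  length_wordBlock _ _ _

theorem Impl.oneBlock {C : Circuit B Q adj} {α : Type} {word : List (ℕ × Matrix Bool Bool ℂ)}
    {U : Matrix Bool Bool ℂ} (hU : IsWord₁ C.one word U) {site : α → Q}
    {sel : History → List α} {w : History} {os : List (List ℕ)} (ρ : QState Q)
    (hlen : os.length = word.length) (hs : (sel w).Pairwise fun a a' => site a ≠ site a') :
    Impl C (oneBlock word site sel) w os ρ (seq (fun a ρ => ρ.conj₁ U (site a)) (sel w) ρ) := by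
  have h := Impl.wordBlock (C := C) (inst := fun g a => Instr.one g.1 (site a))
    (op := fun g a ρ => QState.conj₁ g.2 (site a) ρ) (word := word) (sel := sel) (w := w)
    (os := os) (ρ := ρ) hlen (fun g hg a _ o ρ => act_one_unitary C (hU.1 g hg) _ _ _)
    (hs.imp fun h g _ g' _ ρ => conj₁_comm _ _ h _)
  rw [seq_congr (A' := fun a ρ => ρ.conj₁ U (site a))] at h
  · exact h
  · intro a _ ρ
    have key := wordOp_apply (fun (g : ℕ × Matrix Bool Bool ℂ) (q : Q) (ρ : QState Q) =>
      QState.conj₁ g.2 q ρ) site word a ρ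
    rw [wordOp_conj₁ word hU.2] at key
    exact key

theorem Impl.twoBlock {C : Circuit B Q adj} {α : Type}
    {word : List (Gate × Matrix (Bool × Bool) (Bool × Bool) ℂ)}
    {U : Matrix (Bool × Bool) (Bool × Bool) ℂ} (hU : IsWord₂ C.one C.two word U)
    {edge : α → Q × Q} {sel : History → List α} {w : History} {os : List (List ℕ)} (ρ : QState Q)
    (hlen : os.length = word.length) (hne : ∀ a ∈ sel w, (edge a).1 ≠ (edge a).2)
    (hs : (sel w).Pairwise fun a a' => (edge a).1 ≠ (edge a').1 ∧ (edge a).1 ≠ (edge a').2 ∧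
      (edge a).2 ≠ (edge a').1 ∧ (edge a).2 ≠ (edge a').2) :
    Impl C (twoBlock word edge sel) w os ρ
      (seq (fun a ρ => ρ.conj₂ U (edge a).1 (edge a).2) (sel w) ρ) := by
  have h := Impl.wordBlock (C := C) (inst := fun g a => g.1.instr (edge a))
    (op := fun g a ρ => QState.conj₂ g.2 (edge a).1 (edge a).2 ρ) (word := word) (sel := sel)
    (w := w) (os := os) (ρ := ρ) hlen
    (fun g hg a ha o ρ => act_gate C (hU.1 g hg) (hne a ha) _ _)
    (hs.imp fun h g _ g' _ ρ => conj₂_comm _ _ h.1 h.2.1 h.2.2.1 h.2.2.2 _)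
  rw [seq_congr (A' := fun a ρ => ρ.conj₂ U (edge a).1 (edge a).2)] at h
  · exact h
  · intro a ha ρ
    have key := wordOp_apply (fun (g : Gate × Matrix (Bool × Bool) (Bool × Bool) ℂ) (e : Q × Q)
      (ρ : QState Q) => QState.conj₂ g.2 e.1 e.2 ρ) edge word a ρ
    rw [wordOp_conj₂ word hU.2 (hne a ha)] at key
    exact key

end Words

end CC

namespace CC

open Coded

/-! ### Moving qubits along disjoint paths in constant depth -/

/-- An edge `(p, q)` of a path, with its colour (edges of the same colour do not meet) and a flag
that marks the last edge of a path. -/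
abbrev Edge (Q : Type) : Type := (Q × Q) × Bool × Bool

/-- An edge, the outcomes of the parity measurement on it and of the measurement of its first site,
and flags for an `X` and a `Z` correction at its second site. -/
abbrev DEdge (Q : Type) : Type := Edge Q × Bool × Bool × Bool × Bool

/-- Distribute the outcomes over the edges, summing up the outcomes along each path. -/
def decorate {Q : Type} : Bool → Bool → List (Edge Q) → List ℕ → List ℕ → List ℕ → List (DEdge Q)
  | _, _, [], _, _, _ => []
  | x, z, e :: l, oe, oo, ot =>
    let x' := xor x (bit ((bif e.2.1 then oo else oe).headD 0))
    let z' := xor z (bit (ot.headD 0))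
    (e, bit ((bif e.2.1 then oo else oe).headD 0), bit (ot.headD 0), e.2.2 && x', e.2.2 && z') ::
      decorate (!e.2.2 && x') (!e.2.2 && z') l (bif e.2.1 then oe else oe.tail)
        (bif e.2.1 then oo.tail else oo) ot.tail

theorem decorate_map_fst {Q : Type} (x z : Bool) (E : List (Edge Q)) (oe oo ot : List ℕ) :
    (decorate x z E oe oo ot).map Prod.fst = E := by
  induction E generalizing x z oe oo ot with
  | nil => rfl
  | cons e E ih => simp only [decorate, List.map_cons, ih]

/-- Inside a path the error is handed on to the next edge, so only a last edge is corrected. This is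
needed to move a correction past later edges: none of them starts where a path ends. -/
theorem decorate_last {Q : Type} {x z : Bool} {E : List (Edge Q)} {oe oo ot : List ℕ}
    {d : DEdge Q} (h : d ∈ decorate x z E oe oo ot) (h' : d.2.2.2.1 = true ∨ d.2.2.2.2 = true) :
    d.1.2.2 = true := by
  induction E generalizing x z oe oo ot with
  | nil => simp [decorate] at h
  | cons e E ih =>
    simp only [decorate, List.mem_cons] at h
    rcases h with rfl | h
    · simp only [Bool.and_eq_true] at h'
      tauto
    · exact ih h

/-- Each edge takes the head of the outcome list of its own colour, so the edges of colour `c` meet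
the outcomes of that colour in order. -/
theorem seq_zip_decorate_parity {Q S : Type} (F : Edge Q → Bool → S → S) (c x z : Bool)
    (E : List (Edge Q)) (oe oo ot : List ℕ)
    (h : (bif c then oo else oe).length = (E.filter fun e => e.2.1 == c).length) (ρ : S) :
    seq (fun a => F a.1 (bit a.2)) ((E.filter fun e => e.2.1 == c).zip (bif c then oo else oe)) ρ =
      seq (fun d ρ => if d.1.2.1 == c then F d.1 d.2.1 ρ else ρ) (decorate x z E oe oo ot) ρ := by
  induction E generalizing x z oe oo ot ρ with
  | nil => rfl
  | cons e E ih =>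
    obtain ⟨e, k, la⟩ := e
    by_cases hc : k = c
    · subst hc
      simp only [List.filter_cons, beq_self_eq_true, if_true, List.length_cons] at h ⊢
      cases k
      · cases oe with
        | nil => simp at h
        | cons o oe =>
          simp only [cond_false, List.zip_cons_cons, seq, decorate, List.headD_cons, List.tail_cons,
            beq_self_eq_true, if_true]
          exact ih _ _ oe oo _ (by simpa using h) _
      · cases oo with
        | nil => simp at h
        | cons o oo =>
          simp only [cond_true, List.zip_cons_cons, seq, decorate, List.headD_cons, List.tail_cons,
            beq_self_eq_true, if_true]
          exact ih _ _ oe oo _ (by simpa using h) _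
    · have hb : (k == c) = false := by simpa using hc
      simp only [List.filter_cons, hb, Bool.false_eq_true, if_false, seq, decorate] at h ⊢
      cases k <;> cases c
      · exact absurd rfl hc
      · exact ih _ _ oe.tail oo _ h _
      · exact ih _ _ oe oo.tail _ h _
      · exact absurd rfl hc

theorem seq_zip_decorate_first {Q S : Type} (F : Edge Q → Bool → S → S) (x z : Bool)
    (E : List (Edge Q)) (oe oo ot : List ℕ) (h : ot.length = E.length) (ρ : S) :
    seq (fun a => F a.1 (bit a.2)) (E.zip ot) ρ =
      seq (fun d ρ => F d.1 d.2.2.1 ρ) (decorate x z E oe oo ot) ρ := by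
  induction E generalizing x z oe oo ot ρ with
  | nil => rfl
  | cons e E ih =>
    cases ot with
    | nil => simp at h
    | cons o ot =>
      simp only [List.zip_cons_cons, seq, decorate, List.headD_cons, List.tail_cons]
      exact ih _ _ _ _ ot (by simpa using h) _

/-- The words of basic operations for the gates needed to move qubits. -/
structure Toolkit where
  wH : List (ℕ × Matrix Bool Bool ℂ)
  wX : List (ℕ × Matrix Bool Bool ℂ)
  wZ : List (ℕ × Matrix Bool Bool ℂ)
  wC : List (Gate × Matrix (Bool × Bool) (Bool × Bool) ℂ)
  kM : ℕ

namespace Toolkit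

structure Valid (tk : Toolkit) (one : ℕ → Instrument Bool)
    (two : ℕ → Instrument (Bool × Bool)) : Prop where
  wH : IsWord₁ one tk.wH gateH
  wX : IsWord₁ one tk.wX (toC (intX true))
  wZ : IsWord₁ one tk.wZ (toC (intZ true))
  wC : IsWord₂ one two tk.wC (toC intCNOT)
  kM : (one tk.kM).kraus = [[toC (intP false)], [toC (intP true)]]

variable {Q : Type} (tk : Toolkit)

/-- The edges with the outcomes of the preceding measurements. -/
def deco (E : List (Edge Q)) (w : History) : List (DEdge Q) :=
  -- The history begins with the outcomes at the first sites. Past those, the Hadamards and one CNOT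
  -- word lie the parities of colour `true`; past these and two more CNOT words lie those of colour
  -- `false`.
  decorate false false E ((w.drop (2 + tk.wH.length + 3 * tk.wC.length)).headD [])
    ((w.drop (1 + tk.wH.length + tk.wC.length)).headD []) (w.headD [])

/-- Measure the parities of the edges of colour `c`. -/
def parityBlock (E : List (Edge Q)) (c : Bool) : List (Stage Q) :=
  twoBlock tk.wC Prod.fst (fun _ => E.filter fun e => e.2.1 == c) ++
    ([⟨StageKind.meas, fun _ =>
        (E.filter fun e => e.2.1 == c).map fun e => Instr.one tk.kM e.1.2⟩] ++
      twoBlock tk.wC Prod.fst (fun _ => E.filter fun e => e.2.1 == c))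

/-- Move qubits along the edges. -/
def moveBlock (E : List (Edge Q)) : List (Stage Q) :=
  oneBlock tk.wH (fun e : Edge Q => e.1.2) (fun _ => E) ++
  (tk.parityBlock E false ++ (tk.parityBlock E true ++
  (oneBlock tk.wH (fun e : Edge Q => e.1.1) (fun _ => E) ++
  ([⟨StageKind.meas, fun _ => E.map fun e => Instr.one tk.kM e.1.1⟩] ++
  -- The sites that are left are reset to |0⟩.
  (oneBlock tk.wX (fun d : DEdge Q => d.1.1.1)
    (fun w => (tk.deco E w).filter fun d => d.2.2.1) ++
  (oneBlock tk.wX (fun d : DEdge Q => d.1.1.2)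
    -- The timesteps since the last measurement are dropped, so that `deco` reads the history for
    -- which its offsets are made.
    (fun w => (tk.deco E (w.drop tk.wX.length)).filter fun d => d.2.2.2.1) ++
  oneBlock tk.wZ (fun d : DEdge Q => d.1.1.2)
    (fun w => (tk.deco E (w.drop (2 * tk.wX.length))).filter fun d => d.2.2.2.2)))))))

end Toolkit

/-- The conditions on edges `e`, `e'`, the first of which precedes the second. -/
def EdgeSep {Q : Type} (e e' : Edge Q) : Prop :=
  e.1.1 ≠ e'.1.1 ∧ e.1.1 ≠ e'.1.2 ∧ e.1.2 ≠ e'.1.2 ∧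
    -- Only consecutive edges of one path may touch, the second one starting where the first one
    -- ends; they have different colours, and the first is not marked as last.
    (e.2.2 = true ∨ e.2.1 = e'.2.1 → e.1.2 ≠ e'.1.1)

open QState

/-! ### Operators local to an edge -/

section Local

variable {Q : Type} [DecidableEq Q]

/-- `F` is homogeneous and commutes with one-qubit operations at sites other than `a`, `b`. -/
def LocalAt (a b : Q) (F : QState Q → QState Q) : Prop :=
  (∀ (r : ℝ) ρ, F (r • ρ) = r • F ρ) ∧
  ∀ (V : Matrix Bool Bool ℂ) (r : Q), r ≠ a → r ≠ b → ∀ ρ,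
    QState.conj₁ V r (F ρ) = F (QState.conj₁ V r ρ)

theorem LocalAt.comp {a b : Q} {F G : QState Q → QState Q} (hF : LocalAt a b F)
    (hG : LocalAt a b G) : LocalAt a b fun ρ => F (G ρ) :=
  ⟨fun r ρ => by simp only [hG.1, hF.1], fun V r ha hb ρ => by rw [hF.2 V r ha hb, hG.2 V r ha hb]⟩

theorem LocalAt.left (V : Matrix Bool Bool ℂ) (a b : Q) : LocalAt a b fun ρ => ρ.conj₁ V a :=
  ⟨conj₁_real_smul V a, fun _ _ ha _ _ => conj₁_comm _ _ ha _⟩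

theorem LocalAt.right (V : Matrix Bool Bool ℂ) (a b : Q) : LocalAt a b fun ρ => ρ.conj₁ V b :=
  ⟨conj₁_real_smul V b, fun _ _ _ hb _ => conj₁_comm _ _ hb _⟩

theorem LocalAt.conj₂ (V : Matrix (Bool × Bool) (Bool × Bool) ℂ) (a b : Q) :
    LocalAt a b fun ρ => ρ.conj₂ V a b :=
  ⟨conj₂_real_smul V a b, fun _ _ ha hb _ => conj₁_conj₂_comm _ _ ha hb _⟩

theorem LocalAt.smul {a b : Q} {F : QState Q → QState Q} (hF : LocalAt a b F) (r : ℝ) :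
    LocalAt a b fun ρ => r • F ρ :=
  ⟨fun s ρ => by simp only [hF.1, smul_comm r s],
    fun V r ha hb ρ => by rw [conj₁_real_smul, hF.2 V r ha hb]⟩

theorem LocalAt.ite {a b : Q} {F : QState Q → QState Q} (hF : LocalAt a b F) (c : Prop)
    [Decidable c] : LocalAt a b fun ρ => if c then F ρ else ρ := by
  by_cases h : c
  · simpa only [if_pos h] using hF
  · simp only [if_neg h]
    exact ⟨fun _ _ => rfl, fun _ _ _ _ _ => rfl⟩

end Local

/-! ### The timesteps of a move, regrouped edge by edge -/

section Move

variable {Q : Type} [DecidableEq Q]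

/-- Project on the measured parity of an edge of colour `c`. -/
noncomputable def parityOp (c : Bool) (d : DEdge Q) (ρ : QState Q) : QState Q :=
  if d.1.2.1 == c then (2 : ℝ) • ρ.conj₂ (toC (intD d.2.1)) d.1.1.1 d.1.1.2 else ρ

/-- The combined effect of all operations on an edge. -/
noncomputable def edgeOp (d : DEdge Q) (ρ : QState Q) : QState Q :=
  (((((2 : ℝ) • (((parityOp true d (parityOp false d (ρ.conj₁ gateH d.1.1.2))).conj₁
    gateH d.1.1.1).conj₁ (toC (intP d.2.2.1)) d.1.1.1)).conj₁
    (toC (intX d.2.2.1)) d.1.1.1).conj₁ (toC (intX d.2.2.2.1)) d.1.1.2).conj₁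
    (toC (intZ d.2.2.2.2)) d.1.1.2)

theorem parityOp_local (c : Bool) (d : DEdge Q) : LocalAt d.1.1.1 d.1.1.2 (parityOp c d) :=
  ((LocalAt.conj₂ _ _ _).smul 2).ite _

theorem conj₁_filter_flag (U : Bool → Matrix Bool Bool ℂ) (h : U false = 1) (b : Bool) (q : Q)
    (ρ : QState Q) : (if b = true then ρ.conj₁ (U true) q else ρ) = ρ.conj₁ (U b) q := by
  cases b
  · simp [h, conj₁_one]
  · simp

variable [Coded Q] {B : GateSet} {adj : Q → Q → Prop}

theorem list_length_eq_add {α : Type} {l : List α} {a b : ℕ} (h : l.length = a + b) :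
    ∃ l₁ l₂, l = l₁ ++ l₂ ∧ l₁.length = a ∧ l₂.length = b :=
  ⟨l.take a, l.drop a, (List.take_append_drop _ _).symm, by simp; omega, by simp; omega⟩

theorem Impl.meas {C : Circuit B Q adj} {α : Type} {k : ℕ}
    (hk : (C.one k).kraus = [[toC (intP false)], [toC (intP true)]]) (site : α → Q) (l : List α)
    (w : History) (o : List ℕ) (ρ ρ' : QState Q)
    (h : o.length = l.length → seq (fun a ρ => (2 : ℝ) • ρ.conj₁ (toC (intP (bit a.2)))
      (site a.1)) (l.zip o) ρ = ρ') :
    Impl C [⟨StageKind.meas, fun _ => l.map fun a => Instr.one k (site a)⟩] w [o] ρ ρ' := by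
  refine Impl.single ?_
  simp only [Stage.weight, List.length_map]
  rw [actLayer_meas C k hk]
  by_cases ho : o.length = l.length
  · rw [h ho]
  · simp [StageKind.weight, ho]

/-- Edges of one colour are disjoint, so CNOT, measurement and CNOT may be regrouped into one parity
projection per edge. Stating the result on all of `decorate …`, with the identity on edges of the
other colour, lets both colours be combined over the same list. -/
theorem Impl.parityBlock {C : Circuit B Q adj} {tk : Toolkit} (ht : tk.Valid C.one C.two)
    {E : List (Edge Q)} (hE : E.Pairwise EdgeSep) (hne : ∀ e ∈ E, e.1.1 ≠ e.1.2) (c x z : Bool)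
    (w : History) (o₁ o₂ : List (List ℕ)) (oe oo ot : List ℕ) (h₁ : o₁.length = tk.wC.length)
    (h₂ : o₂.length = tk.wC.length) (ρ : QState Q) :
    Impl C (tk.parityBlock E c) w (o₁ ++ ([bif c then oo else oe] ++ o₂)) ρ
      (seq (parityOp c) (decorate x z E oe oo ot) ρ) := by
  set D := decorate x z E oe oo ot with hD
  have hDE : D.map Prod.fst = E := decorate_map_fst _ _ _ _ _ _
  have hDp : D.Pairwise fun d d' => EdgeSep d.1 d'.1 := by
    rw [← hDE, List.pairwise_map] at hE
    exact hE
  have hDne : ∀ d ∈ D, d.1.1.1 ≠ d.1.1.2 := fun d hd => hne _ (hDE ▸ List.mem_map_of_mem hd)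
  have hsel : (E.filter fun e => e.2.1 == c).Pairwise fun a a' =>
      a.1.1 ≠ a'.1.1 ∧ a.1.1 ≠ a'.1.2 ∧ a.1.2 ≠ a'.1.1 ∧ a.1.2 ≠ a'.1.2 := by
    refine (List.pairwise_filter.2 (hE.imp ?_))
    intro a a' h ha ha'
    have hc : a.2.1 = a'.2.1 := by simp only [beq_iff_eq] at ha ha'; rw [ha, ha']
    exact ⟨h.1, h.2.1, h.2.2.2 (Or.inr hc), h.2.2.1⟩
  have hseq : ∀ ρ : QState Q, seq (fun (e : Edge Q) ρ => ρ.conj₂ (toC intCNOT) e.1.1 e.1.2)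
      (E.filter fun e => e.2.1 == c) ρ = seq (fun d ρ => if d.1.2.1 == c then
        QState.conj₂ (toC intCNOT) d.1.1.1 d.1.1.2 ρ else ρ) D ρ := by
    intro ρ
    rw [seq_filter, ← hDE, seq_map]
  have hne' : ∀ e ∈ E.filter (fun e => e.2.1 == c), e.1.1 ≠ e.1.2 :=
    fun e he => hne e (List.mem_of_mem_filter he)
  have I₁ := Impl.twoBlock ht.wC (edge := Prod.fst) (sel := fun _ => E.filter fun e => e.2.1 == c)
    (w := w) ρ h₁ hne' hsel
  rw [hseq] at I₁
  set ρ₁ := seq (fun (d : DEdge Q) ρ => if d.1.2.1 == c then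
        QState.conj₂ (toC intCNOT) d.1.1.1 d.1.1.2 ρ else ρ) D ρ with hρ₁
  have I₂ := Impl.meas (C := C) ht.kM (fun e : Edge Q => e.1.2) (E.filter fun e => e.2.1 == c)
    (o₁.reverse ++ w) (bif c then oo else oe) ρ₁
    (seq (fun d ρ => if d.1.2.1 == c then (2 : ℝ) • ρ.conj₁ (toC (intP d.2.1)) d.1.1.2 else ρ)
      D ρ₁)
    (fun ho => seq_zip_decorate_parity
      (fun e b ρ => (2 : ℝ) • QState.conj₁ (toC (intP b)) e.1.2 ρ) c x z E oe oo ot ho ρ₁)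
  set ρ₂ := seq (fun (d : DEdge Q) ρ =>
    if d.1.2.1 == c then (2 : ℝ) • ρ.conj₁ (toC (intP d.2.1)) d.1.1.2 else ρ) D ρ₁ with hρ₂
  have I₃ := Impl.twoBlock ht.wC (edge := Prod.fst) (sel := fun _ => E.filter fun e => e.2.1 == c)
    (w := [bif c then oo else oe].reverse ++ (o₁.reverse ++ w)) ρ₂ h₂ hne' hsel
  rw [hseq] at I₃
  have I := Impl.append (by simp [length_twoBlock, h₁]) I₁
    (Impl.append (by simp) I₂ I₃)
  refine Eq.trans I ?_
  congr 1
  rw [hρ₂, hρ₁, seq_seq, seq_seq]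
  · refine seq_congr (fun d hd ρ => ?_) ρ
    simp only [parityOp]
    by_cases hc : d.1.2.1 == c
    · simp only [if_pos hc]
      rw [conj₂_real_smul, conj₁_eq_conj₂_right _ (a := d.1.1.1), conj₂_mul _ _ (hDne d hd),
        conj₂_mul _ _ (hDne d hd), ← intCNOT_conj, toC_mul, toC_mul, toC_kronecker, toC_one]
    · simp only [if_neg hc]
  · refine hDp.imp fun {d d'} h ρ => ?_
    by_cases hc : d.1.2.1 == c
    · by_cases hc' : d'.1.2.1 == c
      · simp only [if_pos hc, if_pos hc']
        have hcc : d.1.2.1 = d'.1.2.1 := by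
          simp only [beq_iff_eq] at hc hc'; rw [hc, hc']
        simp only [conj₂_real_smul]
        rw [conj₁_conj₂_comm _ _ (h.2.2.2 (Or.inr hcc)) h.2.2.1,
          conj₂_comm _ _ h.1 h.2.1 (h.2.2.2 (Or.inr hcc)) h.2.2.1]
      · simp only [if_neg hc']
    · simp only [if_neg hc]
  · refine hDp.imp fun {d d'} h ρ => ?_
    by_cases hc : d.1.2.1 == c
    · by_cases hc' : d'.1.2.1 == c
      · simp only [if_pos hc, if_pos hc']
        rw [conj₂_real_smul, conj₁_conj₂_comm _ _ h.2.1.symm h.2.2.1.symm]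
      · simp only [if_neg hc']
    · simp only [if_neg hc]

omit [Coded Q] in
-- Both operators are diagonal; no condition on the edges is needed.
theorem parityOp_comm (c c' : Bool) (d d' : DEdge Q) (ρ : QState Q) :
    parityOp c d (parityOp c' d' ρ) = parityOp c' d' (parityOp c d ρ) := by
  simp only [parityOp]
  by_cases h : d.1.2.1 == c <;> by_cases h' : d'.1.2.1 == c'
  · simp only [if_pos h, if_pos h', conj₂_real_smul]
    have hd : ∀ s, toC (intD s) = Matrix.diagonal fun u => if xor u.1 u.2 = s then (1 : ℂ) else 0 := by
      intro s
      simp only [toC, intD]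
      rw [Matrix.diagonal_map (by simp)]
      congr 1
      funext u
      simp
    rw [hd, hd, conj₂_diagonal_comm]
  · simp only [if_neg h']
  · simp only [if_neg h]
  · simp only [if_neg h]

/-- Layer after layer is merged into the operator of each edge by `seq_seq`. In each case the new
operation on an edge has to commute with all that has been merged on later edges. By `EdgeSep` it
either acts elsewhere, or is diagonal, or is a correction, which occurs only at the end of a path.
-/
theorem Impl.moveBlock {C : Circuit B Q adj} {tk : Toolkit} (ht : tk.Valid C.one C.two)
    {E : List (Edge Q)} (hE : E.Pairwise EdgeSep) (hne : ∀ e ∈ E, e.1.1 ≠ e.1.2)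
    (w : History) {os : List (List ℕ)} (hos : os.length = (tk.moveBlock E).length) (ρ : QState Q) :
    ∃ oe oo ot, Impl C (tk.moveBlock E) w os ρ (seq edgeOp (decorate false false E oe oo ot) ρ) := by
  simp only [Toolkit.moveBlock, Toolkit.parityBlock, List.length_append,
    length_oneBlock, length_twoBlock, List.length_singleton] at hos
  obtain ⟨oA, os₁, rfl, hA, hos⟩ := list_length_eq_add hos
  obtain ⟨oB, os₂, rfl, hB, hos⟩ := list_length_eq_add hos
  obtain ⟨oC, os₃, rfl, hC, hos⟩ := list_length_eq_add hos
  obtain ⟨oD, os₄, rfl, hD, hos⟩ := list_length_eq_add hos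
  obtain ⟨oF, os₅, rfl, hF, hos⟩ := list_length_eq_add hos
  obtain ⟨oG, os₆, rfl, hG, hos⟩ := list_length_eq_add hos
  obtain ⟨oH, oI, rfl, hH, hI⟩ := list_length_eq_add hos
  obtain ⟨oB₁, oB', rfl, hB₁, hB⟩ := list_length_eq_add hB
  obtain ⟨oe', oB₂, rfl, hoe, hB₂⟩ := list_length_eq_add hB
  obtain ⟨oC₁, oC', rfl, hC₁, hC⟩ := list_length_eq_add hC
  obtain ⟨oo', oC₂, rfl, hoo, hC₂⟩ := list_length_eq_add hC
  obtain ⟨oe, rfl⟩ := List.length_eq_one_iff.1 hoe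
  obtain ⟨oo, rfl⟩ := List.length_eq_one_iff.1 hoo
  obtain ⟨ot, rfl⟩ := List.length_eq_one_iff.1 hF
  clear hoe hoo hF hB hC hos
  refine ⟨oe, oo, ot, ?_⟩
  set D := decorate false false E oe oo ot with hDdef
  have hDE : D.map Prod.fst = E := decorate_map_fst _ _ _ _ _ _
  have hDp : D.Pairwise fun d d' => EdgeSep d.1 d'.1 := by
    rw [← hDE, List.pairwise_map] at hE
    exact hE
  have hfst : D.Pairwise fun d d' => d.1.1.1 ≠ d'.1.1.1 := hDp.imp fun h => h.1
  have hsnd : D.Pairwise fun d d' => d.1.1.2 ≠ d'.1.1.2 := hDp.imp fun h => h.2.2.1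
  have eA : seq (fun (e : Edge Q) ρ => QState.conj₁ gateH e.1.2 ρ) E ρ =
      seq (fun d ρ => QState.conj₁ gateH d.1.1.2 ρ) D ρ := by
    conv_lhs => rw [← hDE, seq_map]
  have IA := Impl.oneBlock ht.wH (site := fun e : Edge Q => e.1.2) (sel := fun _ => E) (w := w) ρ
    hA (hE.imp fun h => h.2.2.1)
  rw [eA] at IA
  set ρA := seq (fun (d : DEdge Q) ρ => QState.conj₁ gateH d.1.1.2 ρ) D ρ with hρA
  have IB := Impl.parityBlock ht hE hne false false false (oA.reverse ++ w) oB₁ oB₂ oe oo ot hB₁ hB₂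
    ρA
  simp only [cond_false] at IB
  rw [← hDdef] at IB
  set ρB := seq (parityOp false) D ρA with hρB
  have IC := Impl.parityBlock ht hE hne true false false
    ((oB₁ ++ ([oe] ++ oB₂)).reverse ++ (oA.reverse ++ w)) oC₁ oC₂ oe oo ot hC₁ hC₂ ρB
  simp only [cond_true] at IC
  rw [← hDdef] at IC
  set ρC := seq (parityOp true) D ρB with hρC
  have eD : seq (fun (e : Edge Q) ρ => QState.conj₁ gateH e.1.1 ρ) E ρC =
      seq (fun d ρ => QState.conj₁ gateH d.1.1.1 ρ) D ρC := by
    conv_lhs => rw [← hDE, seq_map]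
  have ID := Impl.oneBlock ht.wH (site := fun e : Edge Q => e.1.1) (sel := fun _ => E)
    (w := (oC₁ ++ ([oo] ++ oC₂)).reverse ++ ((oB₁ ++ ([oe] ++ oB₂)).reverse ++ (oA.reverse ++ w)))
    ρC hD (hE.imp fun h => h.1)
  rw [eD] at ID
  set ρD := seq (fun (d : DEdge Q) ρ => QState.conj₁ gateH d.1.1.1 ρ) D ρC with hρD
  set w₄ := oD.reverse ++ ((oC₁ ++ ([oo] ++ oC₂)).reverse ++
    ((oB₁ ++ ([oe] ++ oB₂)).reverse ++ (oA.reverse ++ w))) with hw₄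
  have IF := Impl.meas (C := C) ht.kM (fun e : Edge Q => e.1.1) E w₄ ot ρD
    (seq (fun d ρ => (2 : ℝ) • ρ.conj₁ (toC (intP d.2.2.1)) d.1.1.1) D ρD)
    (fun ho => seq_zip_decorate_first
      (fun e b ρ => (2 : ℝ) • QState.conj₁ (toC (intP b)) e.1.1 ρ) false false E oe oo ot ho ρD)
  set ρF := seq (fun (d : DEdge Q) ρ => (2 : ℝ) • ρ.conj₁ (toC (intP d.2.2.1)) d.1.1.1) D ρD
    with hρF
  -- The two splittings of the history exhibit the positions of `oo` and `oe` behind the offsets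
  -- used by `deco`.
  have hdeco : tk.deco E ([ot].reverse ++ w₄) = D := by
    have h1 : [ot].reverse ++ w₄ = (ot :: oD.reverse ++ oC₂.reverse) ++ oo ::
        (oC₁.reverse ++ ((oB₁ ++ ([oe] ++ oB₂)).reverse ++ (oA.reverse ++ w))) := by
      simp [hw₄]
    have h2 : [ot].reverse ++ w₄ = (ot :: oD.reverse ++ oC₂.reverse ++ oo ::
        (oC₁.reverse ++ oB₂.reverse)) ++ oe :: (oB₁.reverse ++ (oA.reverse ++ w)) := by
      simp [hw₄]
    rw [Toolkit.deco, hDdef]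
    congr 1
    · rw [h2, List.drop_left' (by simp [hD, hB₂, hC₁, hC₂]; ring)]
      rfl
    · rw [h1, List.drop_left' (by simp [hD, hC₂]; ring)]
      rfl
  have IG := Impl.oneBlock ht.wX (site := fun d : DEdge Q => d.1.1.1)
    (sel := fun w => (tk.deco E w).filter fun d => d.2.2.1) (w := [ot].reverse ++ w₄) ρF hG
    (by rw [hdeco]; exact hfst.filter _)
  rw [hdeco, seq_filter] at IG
  simp only [conj₁_filter_flag (fun b => toC (intX b)) (by simp [intX_false, toC_one])] at IG
  set ρG := seq (fun (d : DEdge Q) ρ => QState.conj₁ (toC (intX d.2.2.1)) d.1.1.1 ρ) D ρF with hρG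
  have hdH : (oG.reverse ++ ([ot].reverse ++ w₄)).drop tk.wX.length = [ot].reverse ++ w₄ :=
    List.drop_left' (by simp [hG])
  have IH := Impl.oneBlock ht.wX (site := fun d : DEdge Q => d.1.1.2)
    (sel := fun w => (tk.deco E (w.drop tk.wX.length)).filter fun d => d.2.2.2.1)
    (w := oG.reverse ++ ([ot].reverse ++ w₄)) ρG hH
    (by rw [hdH, hdeco]; exact hsnd.filter _)
  rw [hdH, hdeco, seq_filter] at IH
  simp only [conj₁_filter_flag (fun b => toC (intX b)) (by simp [intX_false, toC_one])] at IH
  set ρH := seq (fun (d : DEdge Q) ρ => QState.conj₁ (toC (intX d.2.2.2.1)) d.1.1.2 ρ) D ρG with hρH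
  have hdI : (oH.reverse ++ (oG.reverse ++ ([ot].reverse ++ w₄))).drop (2 * tk.wX.length) =
      [ot].reverse ++ w₄ := by
    rw [← List.append_assoc]
    exact List.drop_left' (by simp [hG, hH]; ring)
  have II := Impl.oneBlock ht.wZ (site := fun d : DEdge Q => d.1.1.2)
    (sel := fun w => (tk.deco E (w.drop (2 * tk.wX.length))).filter fun d => d.2.2.2.2)
    (w := oH.reverse ++ (oG.reverse ++ ([ot].reverse ++ w₄))) ρH hI
    (by rw [hdI, hdeco]; exact hsnd.filter _)
  rw [hdI, hdeco, seq_filter] at II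
  simp only [conj₁_filter_flag (fun b => toC (intZ b)) (by simp [intZ_false, toC_one])] at II
  have I := Impl.append (by simp [length_oneBlock, hA]) IA
    (Impl.append (by simp [Toolkit.parityBlock, length_twoBlock, hB₁, hB₂]) IB
    (Impl.append (by simp [Toolkit.parityBlock, length_twoBlock, hC₁, hC₂]) IC
    (Impl.append (by simp [length_oneBlock, hD]) ID
    (Impl.append (by simp) IF
    (Impl.append (by simp [length_oneBlock, hG]) IG
    (Impl.append (by simp [length_oneBlock, hH]) IH II))))))
  refine Eq.trans I ?_
  congr 1
  have l₁ : ∀ d : DEdge Q, LocalAt d.1.1.1 d.1.1.2 fun ρ => QState.conj₁ gateH d.1.1.2 ρ :=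
    fun d => LocalAt.right _ _ _
  have l₂ := fun d : DEdge Q => (parityOp_local false d).comp (l₁ d)
  have l₃ := fun d : DEdge Q => (parityOp_local true d).comp (l₂ d)
  have l₄ := fun d : DEdge Q => (LocalAt.left gateH d.1.1.1 d.1.1.2).comp (l₃ d)
  have l₅ := fun d : DEdge Q =>
    ((LocalAt.left (toC (intP d.2.2.1)) d.1.1.1 d.1.1.2).smul 2).comp (l₄ d)
  have l₆ := fun d : DEdge Q => (LocalAt.left (toC (intX d.2.2.1)) d.1.1.1 d.1.1.2).comp (l₅ d)
  have l₇ := fun d : DEdge Q => (LocalAt.right (toC (intX d.2.2.2.1)) d.1.1.1 d.1.1.2).comp (l₆ d)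
  have hX : ∀ d ∈ D, d.2.2.2.1 = true → d.1.2.2 = true := fun d hd h =>
    decorate_last hd (Or.inl h)
  have hZ : ∀ d ∈ D, d.2.2.2.2 = true → d.1.2.2 = true := fun d hd h =>
    decorate_last hd (Or.inr h)
  rw [seq_seq (hDp.imp fun {d d'} h ρ =>
      ((parityOp_local false d).2 gateH d'.1.1.2 h.2.1.symm h.2.2.1.symm ρ).symm)] at hρB
  -- The edges of `d` and `d'` may share a site here; their parity operators commute because they
  -- are diagonal.
  rw [hρB, seq_seq (hDp.imp fun {d d'} h ρ => by
      rw [parityOp_comm, (parityOp_local true d).2 gateH d'.1.1.2 h.2.1.symm h.2.2.1.symm ρ])] at hρC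
  rw [hρC, seq_seq (hDp.imp fun {d d'} h ρ => (l₃ d').2 gateH d.1.1.1 h.1 h.2.1 ρ)] at hρD
  rw [hρD, seq_seq (hDp.imp fun {d d'} h ρ => by
      rw [(l₄ d').2 (toC (intP d.2.2.1)) d.1.1.1 h.1 h.2.1 ρ]
      exact ((l₄ d').1 _ _).symm)] at hρF
  rw [hρF, seq_seq (hDp.imp fun {d d'} h ρ => (l₅ d').2 (toC (intX d.2.2.1)) d.1.1.1 h.1 h.2.1 ρ)]
    at hρG
  -- The second site of `d` may be the first site of `d'`, unless `d` is a last edge. If it is not,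
  -- its correction is the identity.
  rw [hρG, seq_seq (hDp.imp_of_mem fun {d d'} hd _ h ρ => by
      by_cases hb : d.2.2.2.1 = true
      · exact (l₆ d').2 (toC (intX d.2.2.2.1)) d.1.1.2 (h.2.2.2 (Or.inl (hX d hd hb))) h.2.2.1 ρ
      · rw [Bool.not_eq_true] at hb
        simp only [hb, intX_false, toC_one, conj₁_one])] at hρH
  rw [hρH, seq_seq (hDp.imp_of_mem fun {d d'} hd _ h ρ => by
      by_cases hb : d.2.2.2.2 = true
      · exact (l₇ d').2 (toC (intZ d.2.2.2.2)) d.1.1.2 (h.2.2.2 (Or.inl (hZ d hd hb))) h.2.2.1 ρ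
      · rw [Bool.not_eq_true] at hb
        simp only [hb, intZ_false, toC_one, conj₁_one])]
  rfl

end Move

end CC

namespace CC

open Coded

/-! ### Successive hops along paths -/

section Path

variable {Q : Type}

/-- Whether the length of a list is odd. -/
def oddLength {α : Type} : List α → Bool
  | [] => false
  | _ :: l => !oddLength l

/-- The edges of a path, with alternating colours. -/
def pathEdges : List Q → List (Edge Q)
  | p :: q :: l => ((p, q), oddLength l, l.isEmpty) :: pathEdges (q :: l)
  | _ => []

theorem mem_of_mem_pathEdges {P : List Q} {e : Edge Q} (h : e ∈ pathEdges P) :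
    e.1.1 ∈ P ∧ e.1.2 ∈ P.tail := by
  induction P with
  | nil => simp [pathEdges] at h
  | cons p l ih =>
    cases l with
    | nil => simp [pathEdges] at h
    | cons q l =>
      simp only [pathEdges, List.mem_cons] at h
      rcases h with rfl | h
      · simp
      · have := ih h
        exact ⟨List.mem_cons_of_mem _ this.1, List.mem_of_mem_tail this.2⟩

theorem length_pathEdges_le (P : List Q) : (pathEdges P).length ≤ P.length := by
  induction P with
  | nil => simp [pathEdges]
  | cons p l ih =>
    cases l with
    | nil => simp [pathEdges]
    | cons q l => simpa [pathEdges] using ih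

/-- On a path without repetitions only consecutive edges meet. Their colours alternate and the first
of them is not marked as last, so the last clause of `EdgeSep` demands nothing of them. -/
theorem pathEdges_sep {P : List Q} (h : P.Nodup) : (pathEdges P).Pairwise EdgeSep := by
  induction P with
  | nil => simp [pathEdges]
  | cons p l ih =>
    cases l with
    | nil => simp [pathEdges]
    | cons q l =>
      rw [List.nodup_cons] at h
      simp only [pathEdges, List.pairwise_cons]
      refine ⟨fun e he => ?_, ih h.2⟩
      have hm := mem_of_mem_pathEdges he
      have hq := (List.nodup_cons.1 h.2).1
      refine ⟨fun (h' : p = e.1.1) => h.1 (h' ▸ hm.1),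
        fun (h' : p = e.1.2) => h.1 (h' ▸ List.mem_of_mem_tail hm.2),
        fun (h' : q = e.1.2) => hq (h' ▸ hm.2), fun hc (h' : q = e.1.1) => ?_⟩
      cases l with
      | nil => simp [pathEdges] at he
      | cons r l =>
        simp only [pathEdges, List.mem_cons] at he
        rcases he with rfl | he
        · simp [oddLength] at hc
        · exact hq (h' ▸ (mem_of_mem_pathEdges he).1)

theorem pathEdges_flatMap_sep {Ps : List (List Q)} (h : Ps.flatten.Nodup) :
    (Ps.flatMap pathEdges).Pairwise EdgeSep := by
  induction Ps with
  | nil => simp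
  | cons P Ps ih =>
    rw [List.flatten_cons, List.nodup_append] at h
    rw [List.flatMap_cons, List.pairwise_append]
    refine ⟨pathEdges_sep h.1, ih h.2.1, fun e he e' he' => ?_⟩
    obtain ⟨P', hP', he'⟩ := List.mem_flatMap.1 he'
    have h1 := mem_of_mem_pathEdges he
    have h2 := mem_of_mem_pathEdges he'
    have h3 := h.2.2
    have k : ∀ a ∈ P, ∀ b ∈ P', a ≠ b := fun a ha b hb =>
      h3 a ha b (List.mem_flatten.2 ⟨P', hP', hb⟩)
    exact ⟨k _ h1.1 _ h2.1, k _ h1.1 _ (List.mem_of_mem_tail h2.2),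
      k _ (List.mem_of_mem_tail h1.2) _ (List.mem_of_mem_tail h2.2),
      fun _ => k _ (List.mem_of_mem_tail h1.2) _ h2.1⟩

theorem pathEdges_ne {P : List Q} (h : P.Nodup) {e : Edge Q} (he : e ∈ pathEdges P) :
    e.1.1 ≠ e.1.2 := by
  induction P with
  | nil => simp [pathEdges] at he
  | cons p l ih =>
    cases l with
    | nil => simp [pathEdges] at he
    | cons q l =>
      simp only [pathEdges, List.mem_cons] at he
      rcases he with rfl | he
      · intro h'
        simp only at h'
        simp [h'] at h
      · exact ih (List.nodup_cons.1 h).2 he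

open QState

variable [DecidableEq Q] {A : Type}

/-- Move the qubits at the starting points of the paths to the end points. -/
def hopAll : List (List Q) → (A → Q) → A → Q
  | [], f => f
  | P :: Ps, f => hopAll Ps (match P with
    | [] => f
    | p :: l => hop p ((p :: l).getLast (by simp)) f)

/-- The effect of an edge on a qubit with a Pauli error. -/
theorem edgeOp_conj {d : DEdge Q} (h : d.1.1.1 ≠ d.1.1.2) {f : A → Q}
    (hq : d.1.1.2 ∉ Set.range f) (x z : Bool) (σ : QState A) :
    edgeOp d ((σ.place f).conj₁ (toC (intY x z)) d.1.1.1) =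
      (((σ.place (hop d.1.1.1 d.1.1.2 f)).conj₁
        (toC (intY (xor x d.2.1) (xor z d.2.2.1))) d.1.1.2).conj₁ (toC (intX d.2.2.2.1))
          d.1.1.2).conj₁ (toC (intZ d.2.2.2.2)) d.1.1.2 := by
  unfold edgeOp
  congr 2
  rw [← conj_hop h hq]
  have hp : ∀ ρ : QState Q, parityOp true d (parityOp false d ρ) =
      (2 : ℝ) • ρ.conj₂ (toC (intD d.2.1)) d.1.1.1 d.1.1.2 := by
    intro ρ
    obtain ⟨⟨e, c, la⟩, r⟩ := d
    cases c <;> simp [parityOp]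
  rw [hp]

theorem conj₁_intY_correct (x z : Bool) (q : Q) (ρ : QState Q) :
    ((ρ.conj₁ (toC (intY x z)) q).conj₁ (toC (intX x)) q).conj₁ (toC (intZ z)) q = ρ := by
  rw [conj₁_mul, conj₁_mul, ← intY_eq, ← toC_mul, ← toC_mul, Matrix.mul_assoc,
    ← Matrix.mul_assoc (intX x), intX_mul_intX, one_mul, intZ_mul_intZ, toC_one, conj₁_one]

theorem intY_false : intY false false = 1 := by decide

/-- Induction along the path with an arbitrary Pauli error on the moving qubit: a hop adds its
outcomes to the error, and at the last edge the correction equals the accumulated error. The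
condition `hl` excludes an error on a path without edges, which nothing would correct. The outcome
lists that remain after the path are passed on to `R`. -/
theorem seq_edgeOp_path (p : Q) (l : List Q) (hnd : (p :: l).Nodup) (R : List (Edge Q)) (f : A → Q)
    (hf : ∀ q ∈ l, q ∉ Set.range f) (x z : Bool) (hl : l = [] → x = false ∧ z = false)
    (oe oo ot : List ℕ) (σ : QState A) : ∃ oe' oo' ot',
      seq edgeOp (decorate x z (pathEdges (p :: l) ++ R) oe oo ot)
        ((σ.place f).conj₁ (toC (intY x z)) p) =
      seq edgeOp (decorate false false R oe' oo' ot')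
        (σ.place (hop p ((p :: l).getLast (by simp)) f)) := by
  induction l generalizing p f x z oe oo ot with
  | nil =>
    obtain ⟨rfl, rfl⟩ := hl rfl
    exact ⟨oe, oo, ot, by simp [pathEdges, intY_false, toC_one, conj₁_one, hop_self]⟩
  | cons q l ih =>
    have hpq : p ≠ q := fun h => by simp [h] at hnd
    have hq : q ∉ Set.range f := hf q (by simp)
    have hf' : ∀ r ∈ l, r ∉ Set.range (hop p q f) := by
      intro r hr hr'
      rcases range_hop_subset p q f hr' with rfl | h
      · simp [hr] at hnd
      · exact hf r (by simp [hr]) h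
    have hnd' := (List.nodup_cons.1 hnd).2
    simp only [pathEdges, List.cons_append, decorate, seq]
    rw [edgeOp_conj hpq hq]
    simp only
    cases l with
    | nil =>
      simp only [List.isEmpty_nil, Bool.true_and, conj₁_intY_correct]
      simp only [pathEdges, Bool.not_true, Bool.false_and, List.nil_append]
      exact ⟨_, _, _, rfl⟩
    | cons r l =>
      simp only [List.isEmpty_cons, Bool.false_and, Bool.not_false, Bool.true_and, intX_false,
        intZ_false, toC_one, conj₁_one]
      obtain ⟨oe', oo', ot', h⟩ := ih q hnd' (hop p q f) hf' _ _ (by simp) _ _ _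
      refine ⟨oe', oo', ot', h.trans ?_⟩
      rw [hop_hop hq]
      simp

theorem seq_edgeOp_paths (Ps : List (List Q)) (hnd : Ps.flatten.Nodup) (f : A → Q)
    (hf : ∀ P ∈ Ps, ∀ q ∈ P.tail, q ∉ Set.range f) (oe oo ot : List ℕ) (σ : QState A) :
    seq edgeOp (decorate false false (Ps.flatMap pathEdges) oe oo ot) (σ.place f) =
      σ.place (hopAll Ps f) := by
  induction Ps generalizing f oe oo ot with
  | nil => rfl
  | cons P Ps ih =>
    rw [List.flatten_cons, List.nodup_append] at hnd
    cases P with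
    | nil =>
      simp only [List.flatMap_cons, pathEdges, List.nil_append, hopAll]
      exact ih hnd.2.1 f (fun P hP => hf P (by simp [hP])) _ _ _
    | cons p l =>
      obtain ⟨oe', oo', ot', h⟩ := seq_edgeOp_path p l hnd.1 (Ps.flatMap pathEdges) f
        (hf (p :: l) (by simp)) false false (by simp) oe oo ot σ
      rw [intY_false, toC_one, conj₁_one] at h
      rw [List.flatMap_cons, h, ih hnd.2.1]
      · rfl
      · intro P' hP' q hq hq'
        rcases range_hop_subset _ _ _ hq' with rfl | h'
        · exact hnd.2.2 _ (List.getLast_mem (by simp)) _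
            (List.mem_flatten.2 ⟨P', hP', List.mem_of_mem_tail hq⟩) rfl
        · exact hf P' (by simp [hP']) q hq h'

/-- All edges being treated at once is equivalent to hopping edge by edge, and then the outcomes
drop out of the final state; they remain only in its weight. -/
theorem Impl.movePaths [Coded Q] {B : GateSet} {adj : Q → Q → Prop} {C : Circuit B Q adj}
    {tk : Toolkit} (ht : tk.Valid C.one C.two)
    {Ps : List (List Q)} (hnd : Ps.flatten.Nodup) {f : A → Q}
    (hf : ∀ P ∈ Ps, ∀ q ∈ P.tail, q ∉ Set.range f) (w : History) {os : List (List ℕ)}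
    (hos : os.length = (tk.moveBlock (Ps.flatMap pathEdges)).length) (σ : QState A) :
    Impl C (tk.moveBlock (Ps.flatMap pathEdges)) w os (σ.place f) (σ.place (hopAll Ps f)) := by
  obtain ⟨oe, oo, ot, h⟩ := Impl.moveBlock ht (pathEdges_flatMap_sep hnd) (fun e he => by
    obtain ⟨P, hP, he⟩ := List.mem_flatMap.1 he
    exact pathEdges_ne ((List.nodup_flatten.1 hnd).1 P hP) he) w hos (σ.place f)
  rwa [seq_edgeOp_paths Ps hnd f hf] at h

end Path

end CC

namespace CC

open Coded

/-! ### The map of sites given by disjoint paths -/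

section Hop

variable {Q A : Type} [DecidableEq Q]

/-- Moves look at sites only, so the effect on an arrangement `f` is composition with a map of
sites, obtained by taking `f = id`. -/
theorem hopAll_apply (Ps : List (List Q)) (f : A → Q) (a : A) :
    hopAll Ps f a = hopAll Ps id (f a) := by
  induction Ps generalizing A with
  | nil => rfl
  | cons P Ps ih =>
    cases P with
    | nil => exact ih f a
    | cons p l =>
      exact (ih (QState.hop p _ f) a).trans (ih (A := Q) (QState.hop p _ id) (f a)).symm

theorem hopAll_id_of_not_head {Ps : List (List Q)} {s : Q} (h : ∀ P ∈ Ps, P.head? ≠ some s) :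
    hopAll Ps id s = s := by
  induction Ps with
  | nil => rfl
  | cons P Ps ih =>
    have ih' := ih fun P hP => h P (by simp [hP])
    cases P with
    | nil => exact ih'
    | cons p l =>
      have hp : s ≠ p := fun h' => h (p :: l) (by simp) (by simp [h'])
      simp only [hopAll]
      rw [hopAll_apply]
      simpa [QState.hop, hp] using ih'

theorem hopAll_id_head {Ps : List (List Q)} (hnd : Ps.flatten.Nodup) {P : List Q} (hP : P ∈ Ps)
    {s e : Q} (hs : P.head? = some s) (he : P.getLast? = some e) : hopAll Ps id s = e := by
  induction Ps with
  | nil => simp at hP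
  | cons P' Ps ih =>
    rw [List.flatten_cons, List.nodup_append] at hnd
    rcases List.mem_cons.1 hP with rfl | hP2
    · cases P with
      | nil => simp at hs
      | cons p l =>
        simp only [List.head?_cons, Option.some.injEq] at hs
        subst hs
        simp only [hopAll]
        rw [hopAll_apply]
        have hl : (p :: l).getLast (by simp) = e := by
          rw [List.getLast?_eq_some_getLast (by simp)] at he
          exact Option.some.inj he
        simp only [QState.hop, id, if_true, hl]
        refine hopAll_id_of_not_head fun P' hP' h => ?_
        exact hnd.2.2 e (List.mem_of_getLast? he) e
          (List.mem_flatten.2 ⟨P', hP', List.mem_of_head? h⟩) rfl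
    · have ih' := ih hnd.2.1 hP2
      cases P' with
      | nil => exact ih'
      | cons p l =>
        have hp : s ≠ p := by
          rintro rfl
          exact hnd.2.2 s (by simp) s (List.mem_flatten.2 ⟨P, hP2, List.mem_of_head? hs⟩) rfl
        simp only [hopAll]
        rw [hopAll_apply]
        simpa [QState.hop, hp] using ih'

theorem hopAll_id_cases {Ps : List (List Q)} (hnd : Ps.flatten.Nodup) (s : Q) :
    (∃ P ∈ Ps, P.head? = some s ∧ P.getLast? = some (hopAll Ps id s)) ∨
      ((∀ P ∈ Ps, P.head? ≠ some s) ∧ hopAll Ps id s = s) := by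
  by_cases h : ∃ P ∈ Ps, P.head? = some s
  · obtain ⟨P, hP, hs⟩ := h
    refine Or.inl ⟨P, hP, hs, ?_⟩
    have hne : P ≠ [] := by rintro rfl; simp at hs
    rw [hopAll_id_head hnd hP hs (List.getLast?_eq_some_getLast hne)]
    exact List.getLast?_eq_some_getLast hne
  · push Not at h
    exact Or.inr ⟨h, hopAll_id_of_not_head h⟩

theorem eq_of_mem_flatten_nodup {Ps : List (List Q)} (hnd : Ps.flatten.Nodup) {P P' : List Q}
    (hP : P ∈ Ps) (hP' : P' ∈ Ps) {s : Q} (hs : s ∈ P) (hs' : s ∈ P') : P = P' := by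
  by_contra hne
  have h := (List.nodup_flatten.1 hnd).2
  have : Std.Symm (List.Disjoint : List Q → List Q → Prop) := ⟨fun _ _ h => h.symm⟩
  have := h.forall hP hP' hne
  exact this hs hs'

omit [DecidableEq Q] in
theorem flatten_map_reverse_nodup {Ps : List (List Q)} (hnd : Ps.flatten.Nodup) :
    (Ps.map List.reverse).flatten.Nodup := by
  rw [List.nodup_flatten] at hnd ⊢
  refine ⟨?_, ?_⟩
  · intro P hP
    obtain ⟨P', hP', rfl⟩ := List.mem_map.1 hP
    exact List.nodup_reverse.2 (hnd.1 P' hP')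
  · rw [List.pairwise_map]
    exact hnd.2.imp fun h => by simpa using h

/-- A qubit at the start of a path goes to its end and returns. A qubit that stays is at no end of a
path either, since a path is vacant beyond its start. -/
theorem hopAll_reverse {Ps : List (List Q)} (hnd : Ps.flatten.Nodup) {f : A → Q}
    (hf : ∀ P ∈ Ps, ∀ q ∈ P.tail, q ∉ Set.range f) :
    hopAll (Ps.map List.reverse) (hopAll Ps f) = f := by
  funext a
  rw [hopAll_apply (Ps.map List.reverse) (hopAll Ps f) a, hopAll_apply Ps f a]
  rcases hopAll_id_cases hnd (f a) with ⟨P, hP, hs, he⟩ | ⟨h, h'⟩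
  · refine hopAll_id_head (flatten_map_reverse_nodup hnd) (List.mem_map_of_mem hP) ?_ ?_
    · rw [List.head?_reverse, he]
    · rw [List.getLast?_reverse, hs]
  · rw [h']
    refine hopAll_id_of_not_head fun P hP hs => ?_
    obtain ⟨P', hP', rfl⟩ := List.mem_map.1 hP
    rw [List.head?_reverse] at hs
    cases P' with
    | nil => simp at hs
    | cons p l =>
      rcases List.mem_cons.1 (List.mem_of_getLast? hs) with rfl | hm
      · exact h _ hP' rfl
      · exact hf _ hP' _ hm ⟨a, rfl⟩

/-- After the move a path is vacant except for its end: its start has been left, its other sites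
were free, and qubits that were moved along other paths are on disjoint sites. So the way back is
free. -/
theorem tail_reverse_not_mem_range {Ps : List (List Q)} (hnd : Ps.flatten.Nodup) {f : A → Q}
    (hf : ∀ P ∈ Ps, ∀ q ∈ P.tail, q ∉ Set.range f) :
    ∀ P ∈ Ps.map List.reverse, ∀ q ∈ P.tail, q ∉ Set.range (hopAll Ps f) := by
  rintro P₀ hP₀ q hq ⟨a, ha⟩
  obtain ⟨P, hP, rfl⟩ := List.mem_map.1 hP₀
  rw [List.tail_reverse, List.mem_reverse] at hq
  have hqP : q ∈ P := List.mem_of_mem_dropLast hq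
  have hndP := (List.nodup_flatten.1 hnd).1 P hP
  rw [hopAll_apply] at ha
  rcases hopAll_id_cases hnd (f a) with ⟨P', hP', hs, he⟩ | ⟨h, h'⟩
  · rw [ha] at he
    have := eq_of_mem_flatten_nodup hnd hP hP' hqP (List.mem_of_getLast? he)
    subst this
    obtain ⟨l, rfl⟩ := List.getLast?_eq_some_iff.1 he
    rw [List.dropLast_concat] at hq
    rw [List.nodup_append] at hndP
    exact hndP.2.2 q hq q (by simp) rfl
  · rw [ha] at h'
    cases P with
    | nil => simp at hqP
    | cons p l =>
      rcases List.mem_cons.1 hqP with rfl | hm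
      · exact h _ hP (by simp [h'])
      · exact hf _ hP q hm ⟨a, h'.symm⟩

end Hop

/-! ### Routing on the grid -/

/-- The sites of row `r` in the columns `0, …, n`. -/
def rowPath (n r : ℕ) : List (ℤ × ℤ) := (List.range (n + 1)).map fun x : ℕ => ((x : ℤ), (r : ℤ))

/-- The sites of column `n` in the rows `k, …, n - 1`. -/
def colPath (k n : ℕ) : List (ℤ × ℤ) :=
  ((List.range n).drop k).map fun y : ℕ => ((n : ℤ), (y : ℤ))

/-- The shorter one of two lists. -/
def minList (u : List ℕ × List ℕ) : List ℕ := if (u.2.drop u.1.length).isEmpty then u.2 else u.1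

/-- The longer one of two lists. -/
def maxList (u : List ℕ × List ℕ) : List ℕ := if (u.2.drop u.1.length).isEmpty then u.1 else u.2

/-- Rows are carried about as lists whose length is the row, that is in unary. Comparing two rows
then amounts to dropping as many elements from one list as the other one has. -/
theorem length_minList (u : List ℕ × List ℕ) :
    (minList u).length = min u.1.length u.2.length := by
  unfold minList
  split_ifs with h <;> simp at h <;> omega

theorem length_maxList (u : List ℕ × List ℕ) :
    (maxList u).length = max u.1.length u.2.length := by
  unfold maxList
  split_ifs with h <;> simp at h <;> omega

/-- The paths along the rows for the pairs of qubits in rows given by lengths of lists. -/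
def rowPaths (U : List (List ℕ × List ℕ)) : List (List (ℤ × ℤ)) :=
  U.flatMap fun u => [rowPath (maxList u).length u.1.length, rowPath (maxList u).length u.2.length]

def colPaths (U : List (List ℕ × List ℕ)) : List (List (ℤ × ℤ)) :=
  U.map fun u => colPath (minList u).length (maxList u).length

theorem mem_rowPath {n r : ℕ} {s : ℤ × ℤ} : s ∈ rowPath n r ↔ ∃ x ≤ n, s = (↑x, ↑r) := by
  simp only [rowPath, List.mem_map, List.mem_range]
  constructor
  · rintro ⟨x, hx, rfl⟩; exact ⟨x, by omega, rfl⟩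
  · rintro ⟨x, hx, rfl⟩; exact ⟨x, by omega, rfl⟩

theorem rowPath_cons (n r : ℕ) : rowPath n r = (0, (r : ℤ)) ::
    (List.range n).map fun x : ℕ => (((x + 1 : ℕ) : ℤ), (r : ℤ)) := by
  simp [rowPath, List.range_succ_eq_map, Function.comp_def]

theorem rowPath_getLast? (n r : ℕ) : (rowPath n r).getLast? = some ((n : ℤ), (r : ℤ)) := by
  simp [rowPath, List.range_succ]

theorem rowPath_nodup (n r : ℕ) : (rowPath n r).Nodup :=
  List.Nodup.map (fun x y h => by simpa using h) List.nodup_range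

theorem colPath_cons {k n : ℕ} (h : k < n) : colPath k n = ((n : ℤ), (k : ℤ)) ::
    ((List.range n).drop (k + 1)).map fun y : ℕ => ((n : ℤ), (y : ℤ)) := by
  rw [colPath, List.drop_eq_getElem_cons (by simpa using h)]
  simp

theorem colPath_getLast? {k n : ℕ} (h : k < n) :
    (colPath k n).getLast? = some ((n : ℤ), (n : ℤ) - 1) := by
  obtain ⟨n, rfl⟩ : ∃ m, n = m + 1 := ⟨n - 1, by omega⟩
  rw [colPath, List.range_succ, List.drop_append_of_le_length (by simp; omega)]
  simp

theorem mem_drop_range {k n y : ℕ} : y ∈ (List.range n).drop k ↔ k ≤ y ∧ y < n := by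
  rw [List.mem_iff_getElem]
  constructor
  · rintro ⟨j, hj, rfl⟩
    simp at hj ⊢
    omega
  · rintro ⟨h1, h2⟩
    exact ⟨y - k, by simp; omega, by simp; omega⟩

theorem mem_colPath {k n : ℕ} {s : ℤ × ℤ} :
    s ∈ colPath k n ↔ ∃ y : ℕ, k ≤ y ∧ y < n ∧ s = (↑n, ↑y) := by
  simp only [colPath, List.mem_map, mem_drop_range]
  constructor
  · rintro ⟨y, hy, rfl⟩; exact ⟨y, hy.1, hy.2, rfl⟩
  · rintro ⟨y, h1, h2, rfl⟩; exact ⟨y, ⟨h1, h2⟩, rfl⟩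

theorem colPath_nodup (k n : ℕ) : (colPath k n).Nodup :=
  List.Nodup.map (fun x y h => by simpa using h) (List.nodup_range.sublist (List.drop_sublist _ _))

/-- The rows of all pairs are distinct. -/
def RowsNodup (U : List (List ℕ × List ℕ)) : Prop :=
  (U.flatMap fun u => [u.1.length, u.2.length]).Nodup

theorem RowsNodup.ne {U : List (List ℕ × List ℕ)} (h : RowsNodup U) {u : List ℕ × List ℕ}
    (hu : u ∈ U) : u.1.length ≠ u.2.length := by
  have := (List.nodup_flatMap.1 h).1 u hu
  simpa using this

theorem RowsNodup.pairwise {U : List (List ℕ × List ℕ)} (h : RowsNodup U) :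
    U.Pairwise fun u v => u.1.length ≠ v.1.length ∧ u.1.length ≠ v.2.length ∧
      u.2.length ≠ v.1.length ∧ u.2.length ≠ v.2.length := by
  refine (List.nodup_flatMap.1 h).2.imp fun {u v} h => ?_
  simp [Function.onFun] at h
  tauto

theorem maxList_ne_of_ne {u v : List ℕ × List ℕ}
    (h : u.1.length ≠ v.1.length ∧ u.1.length ≠ v.2.length ∧
      u.2.length ≠ v.1.length ∧ u.2.length ≠ v.2.length) :
    (maxList u).length ≠ (maxList v).length := by
  rw [length_maxList, length_maxList]
  omega

theorem rowPaths_nodup {U : List (List ℕ × List ℕ)} (h : RowsNodup U) :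
    (rowPaths U).flatten.Nodup := by
  rw [rowPaths, List.nodup_flatten]
  refine ⟨?_, ?_⟩
  · intro P hP
    obtain ⟨u, _, hP⟩ := List.mem_flatMap.1 hP
    simp only [List.mem_cons, List.not_mem_nil, or_false] at hP
    rcases hP with rfl | rfl <;> exact rowPath_nodup _ _
  · have key : ∀ n r n' r' : ℕ, r ≠ r' → List.Disjoint (rowPath n r) (rowPath n' r') := by
      intro n r n' r' hne s hs hs'
      obtain ⟨x, _, rfl⟩ := mem_rowPath.1 hs
      obtain ⟨y, _, hy⟩ := mem_rowPath.1 hs'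
      simp only [Prod.mk.injEq, Nat.cast_inj] at hy
      exact hne hy.2
    rw [List.pairwise_flatMap]
    refine ⟨fun u hu => ?_, h.pairwise.imp fun {u v} h P hP P' hP' => ?_⟩
    · simpa using key _ _ _ _ (h.ne hu)
    · simp only [List.mem_cons, List.not_mem_nil, or_false] at hP hP'
      rcases hP with rfl | rfl <;> rcases hP' with rfl | rfl <;> apply key <;> tauto

/-- The column of a pair is the larger one of its rows, and these differ for different pairs. -/
theorem colPaths_nodup {U : List (List ℕ × List ℕ)} (h : RowsNodup U) :
    (colPaths U).flatten.Nodup := by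
  rw [colPaths, List.nodup_flatten]
  refine ⟨?_, ?_⟩
  · intro P hP
    obtain ⟨u, _, rfl⟩ := List.mem_map.1 hP
    exact colPath_nodup _ _
  · rw [List.pairwise_map]
    refine h.pairwise.imp fun {u v} h s hs hs' => ?_
    obtain ⟨x, _, _, rfl⟩ := mem_colPath.1 hs
    obtain ⟨y, _, _, hy⟩ := mem_colPath.1 hs'
    simp only [Prod.mk.injEq, Nat.cast_inj] at hy
    exact maxList_ne_of_ne h hy.1

/-- The site of a qubit in row `r` while it interacts with the qubit in row `r'`. -/
def meetSite (r r' : ℕ) : ℤ × ℤ := if r < r' then ((r' : ℤ), (r' : ℤ) - 1) else ((r : ℤ), (r : ℤ))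

theorem gridAdj_meetSite {r r' : ℕ} (h : r ≠ r') : GridAdj (meetSite r r') (meetSite r' r) := by
  unfold meetSite GridAdj
  rcases lt_or_gt_of_ne h with h1 | h1
  · rw [if_pos h1, if_neg (by omega)]; simp
  · rw [if_neg (by omega), if_pos h1]; simp

/-! ### Vacancy of the paths and the meeting places -/

section Routing

variable {U : List (List ℕ × List ℕ)} (hU : RowsNodup U) {A : Type} {f : A → ℤ × ℤ}
  (hf : ∀ a, (f a).1 ≤ 0)

include hf in
-- Qubits at rest have first coordinate at most 0, and a row path leaves the first column at once.
theorem rowPaths_tail_not_mem : ∀ P ∈ rowPaths U, ∀ q ∈ P.tail, q ∉ Set.range f := by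
  rintro P hP q hq ⟨a, rfl⟩
  obtain ⟨u, _, hP⟩ := List.mem_flatMap.1 hP
  have h1 := hf a
  simp only [List.mem_cons, List.not_mem_nil, or_false] at hP
  rcases hP with rfl | rfl <;>
  · rw [rowPath_cons, List.tail_cons, List.mem_map] at hq
    obtain ⟨x, _, hx⟩ := hq
    rw [← hx] at h1
    simp only at h1
    omega

include hU hf in
-- A qubit in the column of `u` came along a row of a pair whose larger row is that of `u`, hence of
-- `u` itself; but the tail of the column path lies strictly between the two rows of `u`. Qubits
-- that have not moved are in columns at most 0, while the column of `u` is positive.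
theorem colPaths_tail_not_mem :
    ∀ P ∈ colPaths U, ∀ q ∈ P.tail, q ∉ Set.range (hopAll (rowPaths U) f) := by
  rintro P hP q hq ⟨a, ha⟩
  obtain ⟨u, hu, rfl⟩ := List.mem_map.1 hP
  have hne := hU.ne hu
  have hlt : (minList u).length < (maxList u).length := by
    rw [length_minList, length_maxList]; omega
  rw [colPath_cons hlt, List.tail_cons, List.mem_map] at hq
  obtain ⟨y, hy, rfl⟩ := hq
  rw [mem_drop_range] at hy
  rw [hopAll_apply] at ha
  rcases hopAll_id_cases (rowPaths_nodup hU) (f a) with ⟨P', hP', hs, he⟩ | ⟨h, h'⟩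
  · rw [ha] at he
    obtain ⟨v, hv, hP'⟩ := List.mem_flatMap.1 hP'
    have huv : (maxList u).length = (maxList v).length ∧
        (y = v.1.length ∨ y = v.2.length) := by
      simp only [List.mem_cons, List.not_mem_nil, or_false] at hP'
      rcases hP' with rfl | rfl <;>
      · rw [rowPath_getLast?] at he
        simp only [Option.some.injEq, Prod.mk.injEq, Nat.cast_inj] at he
        omega
    have : u = v := by
      by_contra huv'
      have : Std.Symm fun u v : List ℕ × List ℕ => u.1.length ≠ v.1.length ∧
          u.1.length ≠ v.2.length ∧ u.2.length ≠ v.1.length ∧ u.2.length ≠ v.2.length :=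
        ⟨fun _ _ h => ⟨h.1.symm, h.2.2.1.symm, h.2.1.symm, h.2.2.2.symm⟩⟩
      have := hU.pairwise.forall hu hv huv'
      exact maxList_ne_of_ne this huv.1
    subst this
    rw [length_minList, length_maxList] at hy
    omega
  · rw [ha] at h'
    have := hf a
    rw [← h'] at this
    simp only at this
    rw [length_minList] at hlt
    omega

include hU in
-- With n the larger row, both qubits reach column n. The one from the smaller row continues to (n,
-- n-1). The other one stays at (n, n), because a column path starts in a row smaller than its
-- column.
theorem hopAll_meetSite {u : List ℕ × List ℕ} (hu : u ∈ U) :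
    hopAll (colPaths U) id (hopAll (rowPaths U) id (0, (u.1.length : ℤ))) =
      meetSite u.1.length u.2.length ∧
    hopAll (colPaths U) id (hopAll (rowPaths U) id (0, (u.2.length : ℤ))) =
      meetSite u.2.length u.1.length := by
  have hne := hU.ne hu
  have h1 : hopAll (rowPaths U) id (0, (u.1.length : ℤ)) =
      (((maxList u).length : ℤ), (u.1.length : ℤ)) :=
    hopAll_id_head (rowPaths_nodup hU) (List.mem_flatMap.2 ⟨u, hu, by simp⟩)
      (by rw [rowPath_cons]; rfl) (rowPath_getLast? (maxList u).length u.1.length)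
  have h2 : hopAll (rowPaths U) id (0, (u.2.length : ℤ)) =
      (((maxList u).length : ℤ), (u.2.length : ℤ)) :=
    hopAll_id_head (rowPaths_nodup hU) (List.mem_flatMap.2 ⟨u, hu, by simp⟩)
      (by rw [rowPath_cons]; rfl) (rowPath_getLast? (maxList u).length u.2.length)
  have hlt : (minList u).length < (maxList u).length := by
    rw [length_minList, length_maxList]; omega
  have hmem : colPath (minList u).length (maxList u).length ∈ colPaths U :=
    List.mem_map_of_mem hu
  have h3 : hopAll (colPaths U) id (((maxList u).length : ℤ), ((minList u).length : ℤ)) =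
      (((maxList u).length : ℤ), ((maxList u).length : ℤ) - 1) :=
    hopAll_id_head (colPaths_nodup hU) hmem (by rw [colPath_cons hlt]; rfl) (colPath_getLast? hlt)
  have h4 : hopAll (colPaths U) id (((maxList u).length : ℤ), ((maxList u).length : ℤ)) =
      (((maxList u).length : ℤ), ((maxList u).length : ℤ)) := by
    refine hopAll_id_of_not_head fun P hP hs => ?_
    obtain ⟨v, hv, rfl⟩ := List.mem_map.1 hP
    have hv' := hU.ne hv
    have hlt' : (minList v).length < (maxList v).length := by
      rw [length_minList, length_maxList]; omega
    rw [colPath_cons hlt'] at hs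
    simp only [List.head?_cons, Option.some.injEq, Prod.mk.injEq, Nat.cast_inj] at hs
    omega
  rw [h1, h2]
  rw [length_minList] at h3 hlt
  rw [length_maxList] at h3 h4 hlt ⊢
  unfold meetSite
  rcases lt_or_gt_of_ne hne with h | h
  · rw [if_pos h, if_neg (by omega)]
    rw [min_eq_left h.le, max_eq_right h.le] at h3
    rw [max_eq_right h.le] at h4 ⊢
    exact ⟨h3, h4⟩
  · rw [if_neg (by omega), if_pos h]
    rw [min_eq_right h.le, max_eq_left h.le] at h3
    rw [max_eq_left h.le] at h4 ⊢
    exact ⟨h4, h3⟩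

include hU in
theorem hopAll_unmoved {r : ℕ} (hr : ∀ u ∈ U, r ≠ u.1.length ∧ r ≠ u.2.length) :
    hopAll (colPaths U) id (hopAll (rowPaths U) id (0, (r : ℤ))) = (0, (r : ℤ)) := by
  have h1 : hopAll (rowPaths U) id (0, (r : ℤ)) = (0, (r : ℤ)) := by
    refine hopAll_id_of_not_head fun P hP hs => ?_
    obtain ⟨u, hu, hP⟩ := List.mem_flatMap.1 hP
    have := hr u hu
    simp only [List.mem_cons, List.not_mem_nil, or_false] at hP
    rcases hP with rfl | rfl <;>
    · rw [rowPath_cons] at hs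
      simp at hs
      omega
  rw [h1]
  refine hopAll_id_of_not_head fun P hP hs => ?_
  obtain ⟨v, hv, rfl⟩ := List.mem_map.1 hP
  have hv' := hU.ne hv
  have hlt' : (minList v).length < (maxList v).length := by
    rw [length_minList, length_maxList]; omega
  rw [colPath_cons hlt'] at hs
  simp only [List.head?_cons, Option.some.injEq, Prod.mk.injEq, Nat.cast_inj] at hs
  omega

end Routing

end CC

namespace CC

open Coded

/-- A move to a vacant site is a swap of sites, and the vacancy of the remaining paths survives it
because the paths are disjoint. -/
theorem hopAll_injective {Q A : Type} [DecidableEq Q] {Ps : List (List Q)}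
    (hnd : Ps.flatten.Nodup) {f : A → Q} (hf : ∀ P ∈ Ps, ∀ q ∈ P.tail, q ∉ Set.range f)
    (hi : Function.Injective f) : Function.Injective (hopAll Ps f) := by
  induction Ps generalizing f with
  | nil => exact hi
  | cons P Ps ih =>
    rw [List.flatten_cons, List.nodup_append] at hnd
    cases P with
    | nil => exact ih hnd.2.1 (fun P hP => hf P (by simp [hP])) hi
    | cons p l =>
      refine ih hnd.2.1 (fun P hP q hq hq' => ?_) ?_
      · rcases QState.range_hop_subset _ _ _ hq' with rfl | h'
        · exact hnd.2.2 _ (List.getLast_mem (by simp)) _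
            (List.mem_flatten.2 ⟨P, hP, List.mem_of_mem_tail hq⟩) rfl
        · exact hf P (by simp [hP]) q hq h'
      · change Function.Injective (QState.hop p ((p :: l).getLast (by simp)) f)
        rcases List.eq_nil_or_concat l with rfl | ⟨l', e, rfl⟩
        · simpa [QState.hop_self] using hi
        · have he : (p :: l'.concat e).getLast (by simp) = e := by
            simp only [List.concat_eq_append, ← List.cons_append, List.getLast_concat]
          rw [he, QState.hop_eq_swap (hf _ List.mem_cons_self _ (by simp))]
          exact (Equiv.swap _ _).injective.comp hi

/-! ### The rows of the qubits -/

/-- The elements of a list that follow `q`. -/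
def after : List ℕ → ℕ → List ℕ
  | [], _ => []
  | a :: l, q => if a = q then l else after l q

/-- Add an element to a list unless it is there already. -/
def insertNew (S : List ℕ) (q : ℕ) : List ℕ := if q ∈ S then S else q :: S

theorem mem_insertNew {S : List ℕ} {q a : ℕ} : a ∈ insertNew S q ↔ a = q ∨ a ∈ S := by
  unfold insertNew
  split_ifs with h
  · exact ⟨Or.inr, fun h' => h'.elim (fun e => e ▸ h) id⟩
  · exact List.mem_cons

theorem mem_foldl_insertNew {l S : List ℕ} {a : ℕ} :
    a ∈ l.foldl insertNew S ↔ a ∈ l ∨ a ∈ S := by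
  induction l generalizing S with
  | nil => simp
  | cons q l ih => rw [List.foldl_cons, ih, mem_insertNew, List.mem_cons]; tauto

theorem suffix_foldl_insertNew (l S : List ℕ) : S <:+ l.foldl insertNew S := by
  induction l generalizing S with
  | nil => exact List.suffix_rfl
  | cons q l ih =>
    refine List.IsSuffix.trans ?_ (ih _)
    unfold insertNew
    split_ifs
    · exact List.suffix_rfl
    · exact List.suffix_cons _ _

theorem foldl_insertNew_nodup {l S : List ℕ} (h : S.Nodup) : (l.foldl insertNew S).Nodup := by
  induction l generalizing S with
  | nil => exact h
  | cons q l ih =>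
    refine ih ?_
    unfold insertNew
    split_ifs with hq
    · exact h
    · exact List.nodup_cons.2 ⟨hq, h⟩

theorem after_append {S T : List ℕ} {q : ℕ} (h : q ∉ T) : after (T ++ S) q = after S q := by
  induction T with
  | nil => rfl
  | cons a T ih =>
    rw [List.mem_cons, not_or] at h
    simp only [List.cons_append, after]
    rw [if_neg (Ne.symm h.1), ih h.2]

/-- New qubits are put in front of the list, so the number of elements behind a qubit, which is its
row, never changes. -/
theorem after_eq_of_suffix {S S' : List ℕ} (h : S <:+ S') (hnd : S'.Nodup) {q : ℕ} (hq : q ∈ S) :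
    after S' q = after S q := by
  obtain ⟨T, rfl⟩ := h
  exact after_append fun h => (List.nodup_append.1 hnd).2.2 q h q hq rfl

theorem length_after_lt {S : List ℕ} {q : ℕ} (h : q ∈ S) : (after S q).length < S.length := by
  induction S with
  | nil => simp at h
  | cons a S ih =>
    simp only [after, List.length_cons]
    split_ifs with ha
    · omega
    · have := ih ((List.mem_cons.1 h).resolve_left (Ne.symm ha)); omega

theorem length_after_injOn {S : List ℕ} {q q' : ℕ} (h : q ∈ S) (h' : q' ∈ S)
    (he : (after S q).length = (after S q').length) : q = q' := by
  induction S with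
  | nil => simp at h
  | cons a S ih =>
    simp only [after] at he
    split_ifs at he with h1 h2 h2
    · exact h1.symm.trans h2
    · have := length_after_lt ((List.mem_cons.1 h').resolve_left (Ne.symm h2)); omega
    · have := length_after_lt ((List.mem_cons.1 h).resolve_left (Ne.symm h1)); omega
    · exact ih ((List.mem_cons.1 h).resolve_left (Ne.symm h1))
        ((List.mem_cons.1 h').resolve_left (Ne.symm h2)) he

theorem length_after_range {m j : ℕ} (h : j < m) :
    (after (List.range m).reverse j).length = j := by
  induction m with
  | zero => omega
  | succ m ih =>
    simp only [List.range_succ, List.reverse_append, List.reverse_cons, List.reverse_nil,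
      List.nil_append, List.singleton_append, after]
    split_ifs with hj
    · simp [hj]
    · exact ih (by omega)

/-- The site of a qubit that is at rest: those in the list `S` are in the first column, the others
are out of the way. -/
def restSite (S : List ℕ) (q : ℕ) : ℤ × ℤ :=
  -- Qubits not seen yet are parked at distinct sites with negative first coordinate, which makes
  -- the map injective on all of `ℕ`.
  if q ∈ S then (0, ((after S q).length : ℤ)) else (-((q : ℤ) + 1), 0)

theorem restSite_injective (S : List ℕ) : Function.Injective (restSite S) := by
  intro q q' h
  unfold restSite at h
  split_ifs at h with h1 h2 h2
  · simp only [Prod.mk.injEq, Nat.cast_inj, true_and] at h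
    exact length_after_injOn h1 h2 h
  · simp only [Prod.mk.injEq] at h; omega
  · simp only [Prod.mk.injEq] at h; omega
  · simp only [Prod.mk.injEq] at h; omega

theorem restSite_fst (S : List ℕ) (q : ℕ) : (restSite S q).1 ≤ 0 := by
  unfold restSite
  split_ifs
  · exact le_rfl
  · simp only; omega

theorem restSite_of_suffix {S S' : List ℕ} (h : S <:+ S') (hnd : S'.Nodup) {q : ℕ} (hq : q ∈ S) :
    restSite S' q = restSite S q := by
  unfold restSite
  rw [if_pos hq, if_pos (h.subset hq), after_eq_of_suffix h hnd hq]

/-! ### The timesteps that simulate one timestep -/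

/-- The qubits acted on in the timestep ordered by the controller, if any. -/
def orderedQubits (o : Option (List (Instr ℕ))) : List ℕ := (o.getD []).flatMap Instr.qubits

/-- The pairs of qubits that interact. -/
def pairsOf (S : List ℕ) (L : List (Instr ℕ)) : List (List ℕ × List ℕ) :=
  L.flatMap fun
    | Instr.one _ _ => []
    | Instr.two _ a b => [(after S a, after S b)]

/-- The names of the operations are shifted and the qubits are at rest or at their meeting place. -/
def gridInstr (n₁ n₂ : ℕ) (S : List ℕ) : Instr ℕ → Instr (ℤ × ℤ)
  | Instr.one g q => Instr.one (g + n₁) (0, ((after S q).length : ℤ))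
  | Instr.two g a b => Instr.two (g + n₂) (meetSite (after S a).length (after S b).length)
      (meetSite (after S b).length (after S a).length)

/-- The timesteps that simulate the operations `L` on the qubits in the list `S`. -/
def chunk (tk : Toolkit) (n₁ n₂ : ℕ) (S : List ℕ) (L : List (Instr ℕ)) : List (Stage (ℤ × ℤ)) :=
  tk.moveBlock ((rowPaths (pairsOf S L)).flatMap pathEdges) ++
  (tk.moveBlock ((colPaths (pairsOf S L)).flatMap pathEdges) ++
  ([⟨StageKind.free, fun _ => L.map (gridInstr n₁ n₂ S)⟩] ++
  (tk.moveBlock (((colPaths (pairsOf S L)).map List.reverse).flatMap pathEdges) ++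
  tk.moveBlock (((rowPaths (pairsOf S L)).map List.reverse).flatMap pathEdges))))

/-- The number of timesteps of a move. -/
def Toolkit.moveLength (tk : Toolkit) : ℕ :=
  2 * tk.wH.length + 4 * tk.wC.length + 2 * tk.wX.length + tk.wZ.length + 3

theorem Toolkit.length_moveBlock {Q : Type} (tk : Toolkit) (E : List (Edge Q)) :
    (tk.moveBlock E).length = tk.moveLength := by
  simp only [Toolkit.moveBlock, Toolkit.parityBlock, List.length_append, CC.length_oneBlock,
    CC.length_twoBlock, List.length_cons, List.length_nil, Toolkit.moveLength]
  omega

theorem length_chunk (tk : Toolkit) (n₁ n₂ : ℕ) (S : List ℕ) (L : List (Instr ℕ)) :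
    (chunk tk n₁ n₂ S L).length = 4 * tk.moveLength + 1 := by
  simp only [chunk, List.length_append, Toolkit.length_moveBlock, List.length_singleton]
  omega

theorem mem_pairsOf {S : List ℕ} {L : List (Instr ℕ)} {u : List ℕ × List ℕ} :
    u ∈ pairsOf S L ↔ ∃ g a b, Instr.two g a b ∈ L ∧ u = (after S a, after S b) := by
  rw [pairsOf, List.mem_flatMap]
  constructor
  · rintro ⟨i, hi, hu⟩
    cases i with
    | one g q => simp at hu
    | two g a b => exact ⟨g, a, b, hi, by simpa using hu⟩
  · rintro ⟨g, a, b, hi, rfl⟩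
    exact ⟨_, hi, by simp⟩

theorem rowsNodup_pairsOf {S : List ℕ} {L : List (Instr ℕ)} (hL : (L.flatMap Instr.qubits).Nodup)
    (hS : ∀ q ∈ L.flatMap Instr.qubits, q ∈ S) : RowsNodup (pairsOf S L) := by
  have h : ((L.flatMap Instr.qubits).map fun q => (after S q).length).Nodup :=
    hL.map_on fun q hq q' hq' h => length_after_injOn (hS q hq) (hS q' hq') h
  refine List.Nodup.sublist ?_ h
  clear h hL hS
  unfold pairsOf
  induction L with
  | nil => simp
  | cons i L ih =>
    cases i with
    | one g q =>
      simp only [List.flatMap_cons, List.nil_append, Instr.qubits, List.map_cons,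
        List.singleton_append]
      exact ih.cons _
    | two g a b =>
      simp only [List.flatMap_cons, Instr.qubits, List.map_cons, List.cons_append,
        List.nil_append]
      exact (ih.cons_cons _).cons_cons _

theorem nodup_flatMap_qubits {L : List (Instr ℕ)} (hL : (L.flatMap Instr.qubits).Nodup)
    {i j : Instr ℕ} (hi : i ∈ L) (hj : j ∈ L) {q : ℕ} (hq : q ∈ i.qubits) (hq' : q ∈ j.qubits) :
    i = j := by
  by_contra hne
  have : Std.Symm (Function.onFun List.Disjoint (Instr.qubits : Instr ℕ → List ℕ)) :=
    ⟨fun _ _ h => h.symm⟩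
  exact ((List.nodup_flatMap.1 hL).2.forall hi hj hne) hq hq'

/-! ### Correctness of the simulation of one timestep -/

section Layer

variable {B : GateSet} {Q R : Type} [Coded Q] [DecidableEq Q] [Coded R] [DecidableEq R]
  {adj : Q → Q → Prop} {adj' : R → R → Prop}

open QState Circuit

/-- An operation with its name shifted and its qubits moved. -/
def Instr.relabel (n₁ n₂ : ℕ) (f : Q → R) : Instr Q → Instr R
  | Instr.one g q => Instr.one (g + n₁) (f q)
  | Instr.two g a b => Instr.two (g + n₂) (f a) (f b)

theorem act_place {C : Circuit B Q adj} {C' : Circuit B R adj'} {n₁ n₂ : ℕ}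
    (h₁ : ∀ g, C'.one (g + n₁) = C.one g) (h₂ : ∀ g, C'.two (g + n₂) = C.two g) {f : Q → R}
    (hf : Function.Injective f) (o : ℕ) (σ : QState Q) (i : Instr Q) :
    C'.act o (σ.place f) (i.relabel n₁ n₂ f) = (C.act o σ i).place f := by
  have key : ∀ {ι : Type} (l : List ι) (F : ι → QState Q),
      (l.map fun K => (F K).place f).sum = ((l.map F).sum).place f := by
    intro ι l F
    induction l with
    | nil => simp [place_zero]
    | cons K l ih => simp [place_add, ih]
  cases i with
  | one g q =>
    simp only [Circuit.act, Instr.relabel, h₁, conj₁_place hf]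
    exact key _ _
  | two g a b =>
    simp only [Circuit.act, Instr.relabel, h₂, conj₂_place hf]
    exact key _ _

theorem actLayer_place {C : Circuit B Q adj} {C' : Circuit B R adj'} {n₁ n₂ : ℕ}
    (h₁ : ∀ g, C'.one (g + n₁) = C.one g) (h₂ : ∀ g, C'.two (g + n₂) = C.two g) {f : Q → R}
    (hf : Function.Injective f) (L : List (Instr Q)) (os : List ℕ) (σ : QState Q) :
    C'.actLayer (L.map (Instr.relabel n₁ n₂ f)) os (σ.place f) = (C.actLayer L os σ).place f := by
  induction L generalizing os σ with
  | nil => cases os <;> simp [actLayer, place_zero]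
  | cons i L ih =>
    cases os with
    | nil => simp [actLayer, place_zero]
    | cons o os => simp only [List.map_cons, actLayer, act_place h₁ h₂ hf, ih]

theorem act_supportedOn (C : Circuit B Q adj) {S : Set Q} {i : Instr Q} (h : ∀ q ∈ i.qubits, q ∈ S)
    {ρ : QState Q} (hρ : SupportedOn S ρ) (o : ℕ) : SupportedOn S (C.act o ρ i) := by
  have key : ∀ (l : List (QState Q)), (∀ σ ∈ l, SupportedOn S σ) → SupportedOn S l.sum := by
    intro l hl
    induction l with
    | nil => exact SupportedOn.zero S
    | cons σ l ih =>
      rw [List.sum_cons]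
      exact (hl σ (by simp)).add (ih fun τ hτ => hl τ (by simp [hτ]))
  cases i with
  | one g q =>
    refine key _ fun σ hσ => ?_
    obtain ⟨K, _, rfl⟩ := List.mem_map.1 hσ
    exact hρ.conj₁ K (h q (by simp [Instr.qubits]))
  | two g a b =>
    refine key _ fun σ hσ => ?_
    obtain ⟨K, _, rfl⟩ := List.mem_map.1 hσ
    exact hρ.conj₂ K (h a (by simp [Instr.qubits])) (h b (by simp [Instr.qubits]))

theorem actLayer_supportedOn (C : Circuit B Q adj) {S : Set Q} {L : List (Instr Q)}
    (h : ∀ q ∈ L.flatMap Instr.qubits, q ∈ S) {ρ : QState Q} (hρ : SupportedOn S ρ)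
    (os : List ℕ) : SupportedOn S (C.actLayer L os ρ) := by
  induction L generalizing os ρ with
  | nil =>
    cases os with
    | nil => exact hρ
    | cons => exact SupportedOn.zero S
  | cons i L ih =>
    cases os with
    | nil => exact SupportedOn.zero S
    | cons o os =>
      rw [List.flatMap_cons] at h
      exact ih (fun q hq => h q (List.mem_append_right _ hq))
        (act_supportedOn C (fun q hq => h q (List.mem_append_left _ hq)) hρ o) os

/-- The controller computes the sites by explicit formulas, whereas the state is described by the
composition of the moves. Operations on a single qubit stay at the home of that qubit, because no
pair of the same timestep contains it. -/
theorem map_gridInstr (n₁ n₂ : ℕ) {S : List ℕ} {L : List (Instr ℕ)}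
    (hL : (L.flatMap Instr.qubits).Nodup) (hS : ∀ q ∈ L.flatMap Instr.qubits, q ∈ S) :
    L.map (gridInstr n₁ n₂ S) = L.map (Instr.relabel n₁ n₂
      (hopAll (colPaths (pairsOf S L)) (hopAll (rowPaths (pairsOf S L)) (restSite S)))) := by
  have hU := rowsNodup_pairsOf hL hS
  set U := pairsOf S L
  have hfa : ∀ q, hopAll (colPaths U) (hopAll (rowPaths U) (restSite S)) q =
      hopAll (colPaths U) id (hopAll (rowPaths U) id (restSite S q)) := fun q => by
    rw [hopAll_apply (colPaths U), hopAll_apply (rowPaths U)]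
  refine List.map_congr_left fun i hi => ?_
  have hq : ∀ q ∈ i.qubits, q ∈ S := fun q hq => hS q (List.mem_flatMap.2 ⟨i, hi, hq⟩)
  cases i with
  | one g q =>
    simp only [Instr.qubits, List.mem_singleton, forall_eq] at hq
    simp only [gridInstr, Instr.relabel, hfa, restSite, if_pos hq]
    rw [hopAll_unmoved hU]
    intro u hu
    obtain ⟨g', a, b, hi', rfl⟩ := mem_pairsOf.1 hu
    have ha : a ∈ S := hS a (List.mem_flatMap.2 ⟨_, hi', by simp [Instr.qubits]⟩)
    have hb : b ∈ S := hS b (List.mem_flatMap.2 ⟨_, hi', by simp [Instr.qubits]⟩)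
    constructor
    · intro he
      have := length_after_injOn hq ha he
      subst this
      have := nodup_flatMap_qubits hL hi hi' (q := q) (by simp [Instr.qubits])
        (by simp [Instr.qubits])
      cases this
    · intro he
      have := length_after_injOn hq hb he
      subst this
      have := nodup_flatMap_qubits hL hi hi' (q := q) (by simp [Instr.qubits])
        (by simp [Instr.qubits])
      cases this
  | two g a b =>
    have ha : a ∈ S := hq a (by simp [Instr.qubits])
    have hb : b ∈ S := hq b (by simp [Instr.qubits])
    have hu : (after S a, after S b) ∈ U := mem_pairsOf.2 ⟨g, a, b, hi, rfl⟩
    have := hopAll_meetSite hU hu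
    simp only [gridInstr, Instr.relabel, hfa, restSite, if_pos ha, if_pos hb]
    rw [this.1, this.2]

/-- The way out along rows and columns brings interacting qubits together, the operations act as on
the given circuit after relabelling, and the reversed paths undo the moves. Two moves of μ timesteps
precede the operations, so the outcomes at position 2μ are those of the simulated timestep. -/
theorem Impl.chunk {C : CCAC B} {C' : CCNTC B} {tk : Toolkit} (ht : tk.Valid C'.one C'.two)
    {n₁ n₂ : ℕ} (h₁ : ∀ g, C'.one (g + n₁) = C.one g) (h₂ : ∀ g, C'.two (g + n₂) = C.two g)
    {S : List ℕ} {L : List (Instr ℕ)} (hL : (L.flatMap Instr.qubits).Nodup)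
    (hS : ∀ q ∈ L.flatMap Instr.qubits, q ∈ S) (w : History) {os : List (List ℕ)}
    (hos : os.length = 4 * tk.moveLength + 1) (σ : QState ℕ) :
    Impl C' (chunk tk n₁ n₂ S L) w os (σ.place (restSite S))
      ((C.actLayer L (os.getD (2 * tk.moveLength) []) σ).place (restSite S)) := by
  have hU := rowsNodup_pairsOf hL hS
  set U := pairsOf S L
  have hr := rowPaths_tail_not_mem (U := U) (restSite_fst S)
  have hc := colPaths_tail_not_mem hU (restSite_fst S)
  have hrn := rowPaths_nodup hU
  have hcn := colPaths_nodup hU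
  set μ := tk.moveLength
  obtain ⟨o₁, os, rfl, ho₁, hos⟩ := list_length_eq_add (a := μ) (b := 3 * μ + 1)
    (hos.trans (by omega))
  obtain ⟨o₂, os, rfl, ho₂, hos⟩ := list_length_eq_add (a := μ) (b := 2 * μ + 1)
    (hos.trans (by omega))
  obtain ⟨o₃, os, rfl, ho₃, hos⟩ := list_length_eq_add (a := 1) (b := 2 * μ)
    (hos.trans (by omega))
  obtain ⟨o₄, o₅, rfl, ho₄, ho₅⟩ := list_length_eq_add (a := μ) (b := μ)
    (hos.trans (by omega))
  obtain ⟨o, rfl⟩ := List.length_eq_one_iff.1 ho₃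
  have hget : (o₁ ++ (o₂ ++ ([o] ++ (o₄ ++ o₅)))).getD (2 * μ) [] = o := by
    rw [← List.append_assoc, List.getD_append_right _ _ _ _ (by simp; omega)]
    simp [ho₁, ho₂, two_mul]
  rw [hget]
  have hlen : ∀ {E : List (Edge (ℤ × ℤ))} {os : List (List ℕ)}, os.length = μ →
      os.length = (tk.moveBlock E).length := fun h => h.trans (tk.length_moveBlock _).symm
  set f := hopAll (colPaths U) (hopAll (rowPaths U) (restSite S))
  have hfi : Function.Injective f :=
    hopAll_injective hcn hc (hopAll_injective hrn hr (restSite_injective S))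
  have hmap : L.map (gridInstr n₁ n₂ S) = L.map (Instr.relabel n₁ n₂ f) :=
    map_gridInstr n₁ n₂ hL hS
  unfold CC.chunk
  refine Impl.append (hlen ho₁) (Impl.movePaths ht hrn hr w (hlen ho₁) σ) ?_
  refine Impl.append (hlen ho₂) (Impl.movePaths ht hcn hc _ (hlen ho₂) σ) ?_
  refine Impl.append rfl (Impl.single (ρ' := (C.actLayer L o σ).place f) ?_) ?_
  · simp only [Stage.weight, StageKind.weight, NNReal.coe_one, one_smul]
    rw [hmap]
    exact actLayer_place h₁ h₂ hfi L o σ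
  · refine Impl.append (hlen ho₄) (Impl.movePaths ht (flatten_map_reverse_nodup hcn)
      (tail_reverse_not_mem_range hcn hc) _ (hlen ho₄) _) ?_
    rw [hopAll_reverse hcn hc]
    have := Impl.movePaths ht (flatten_map_reverse_nodup hrn)
      (tail_reverse_not_mem_range hrn hr) (o₄.reverse ++ ([o].reverse ++ (o₂.reverse ++
        (o₁.reverse ++ w)))) (hlen ho₅) (C.actLayer L o σ)
    rwa [hopAll_reverse hrn hr] at this

end Layer

end CC

namespace CC

open Coded

/-! ### Polynomial-time computability of the routing -/

namespace PolyTime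

variable {α β γ δ σ Q : Type} [Coded α] [Coded β] [Coded γ] [Coded δ] [Coded σ] [Coded Q]

theorem instrCases {i : α → Instr Q} {h : α → γ} {g₁ : α × ℕ × Q → γ} {g₂ : α × ℕ × Q × Q → γ}
    (hi : PolyTime i) (hg₁ : PolyTime g₁) (hg₂ : PolyTime g₂)
    (h₁ : ∀ a g q, i a = Instr.one g q → h a = g₁ (a, g, q))
    (h₂ : ∀ a g q q', i a = Instr.two g q q' → h a = g₂ (a, g, q, q')) : PolyTime h := by
  obtain ⟨r, R, hr⟩ := hi
  obtain ⟨p, P, hp⟩ := hg₁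
  obtain ⟨p', P', hp'⟩ := hg₂
  refine ⟨Prog.cond (Prog.comp Prog.head r)
      (Prog.comp p' (Prog.cons Prog.id (Prog.comp Prog.tail r)))
      (Prog.comp p (Prog.cons Prog.id (Prog.comp Prog.tail r))),
    Polynomial.X + (Polynomial.X + R + R) + (Polynomial.X +
      (Polynomial.X + Polynomial.X + (Polynomial.X + R + R) + 2) +
      (P + P').comp (Polynomial.X + R + 1)), fun a => ?_⟩
  obtain ⟨u, hu, hru⟩ := hr a
  simp only [Polynomial.eval_add, Polynomial.eval_X, Polynomial.eval_one, Polynomial.eval_comp,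
    Polynomial.eval_ofNat]
  cases hia : i a with
  | one g q =>
    rw [hia] at hru
    obtain ⟨t, ht, hrt⟩ := hp (a, g, q)
    rw [h₁ a g q hia]
    have h2 : (code (Instr.one g q)).size ≤ u := hru.size_le
    have h3 : (code (Instr.one g q)).size = 1 + csize (g, q) + 1 := rfl
    refine ⟨_, ?_, Run.condFalse (Run.comp hru (Run.head _)) (Run.comp (Run.cons (Run.id _)
      (Run.comp hru (Run.tail _))) hrt)⟩
    have h1 : csize (a, g, q) ≤ csize a + R.eval (csize a) + 1 := by
      rw [csize_pair]
      simp only [csize] at *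
      omega
    have := polynomial_eval_mono P h1
    simp only [csize] at *
    omega
  | two g q q' =>
    rw [hia] at hru
    obtain ⟨t, ht, hrt⟩ := hp' (a, g, q, q')
    rw [h₂ a g q q' hia]
    have h2 : (code (Instr.two g q q')).size ≤ u := hru.size_le
    have h3 : (code (Instr.two g q q')).size = 3 + csize (g, q, q') + 1 := rfl
    refine ⟨_, ?_, Run.condTrue (Run.comp hru (Run.head _)) (Run.comp (Run.cons (Run.id _)
      (Run.comp hru (Run.tail _))) hrt)⟩
    have h1 : csize (a, g, q, q') ≤ csize a + R.eval (csize a) + 1 := by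
      rw [csize_pair]
      simp only [csize] at *
      omega
    have := polynomial_eval_mono P' h1
    simp only [csize] at *
    omega

theorem instrOne {g : α → ℕ} {q : α → Q} (hg : PolyTime g) (hq : PolyTime q) :
    PolyTime fun a => Instr.one (g a) (q a) :=
  (pair (PolyTime.const false) (pair hg hq)).of_code_eq fun _ => rfl

theorem instrTwo {g : α → ℕ} {q q' : α → Q} (hg : PolyTime g) (hq : PolyTime q)
    (hq' : PolyTime q') : PolyTime fun a => Instr.two (g a) (q a) (q' a) :=
  (pair (PolyTime.const true) (pair hg (pair hq hq'))).of_code_eq fun _ => rfl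

theorem dropConst {l : α → List β} (hl : PolyTime l) (k : ℕ) : PolyTime fun a => (l a).drop k := by
  induction k with
  | zero => exact hl.congr fun a => rfl
  | succ k ih => exact (tail ih).congr fun a => by rw [List.tail_drop]

theorem getDConst {l : α → List β} (hl : PolyTime l) (k : ℕ) (d : β) :
    PolyTime fun a => (l a).getD k d :=
  (headD (dropConst hl k) (PolyTime.const d)).congr fun a => by
    rw [List.headD_eq_head?_getD, List.head?_drop, List.getD_eq_getElem?_getD]

theorem foldrAdd {l : α → List β} {s : α → σ} {step : α → β → σ → σ} (hl : PolyTime l)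
    (hs : PolyTime s) (hstep : PolyTime fun p : α × σ × β => step p.1 p.2.2 p.2.1)
    (hB : ∃ P : Polynomial ℕ, ∀ a x b,
      csize (step a b x) ≤ csize x + P.eval (csize a + csize b)) :
    PolyTime fun a => (l a).foldr (step a) (s a) :=
  (foldlAdd (step := fun a x b => step a b x) (reverse hl) hs hstep hB).congr fun a => by
    rw [List.foldl_reverse]

theorem optionGetD {f : α → Option β} {d : α → β} (hf : PolyTime f) (hd : PolyTime d) :
    PolyTime fun a => (f a).getD (d a) :=
  optionCases (g := fun p => p.2) hf hd (snd PolyTime.id) (fun a h => by simp [h])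
    (fun a x h => by simp [h])

theorem optionMap {f : α → Option β} {g : α → β → γ} (hf : PolyTime f)
    (hg : PolyTime fun p : α × β => g p.1 p.2) : PolyTime fun a => (f a).map (g a) :=
  optionCases (f := fun _ => none) (g := fun p => Option.some (g p.1 p.2)) hf (PolyTime.const _)
    (some hg) (fun a h => by simp [h]) (fun a x h => by simp [h])

theorem replicateInput {f : α → Input} (hf : PolyTime f) :
    PolyTime fun a => List.replicate (f a).m false := by
  have h : PolyTime fun a => ((f a).x, List.replicate (f a).m false, (f a).r) :=
    hf.of_code_eq fun _ => rfl
  exact fst (snd h)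

/-! The controller of the simulating circuit -/

/-- The elements behind `q` form the tail of the first tail of the list that begins with `q`. -/
theorem after {S : α → List ℕ} {q : α → ℕ} (hS : PolyTime S) (hq : PolyTime q) :
    PolyTime fun a => after (S a) (q a) := by
  have h : PolyTime fun a =>
      (((S a).tails.filter fun t => decide (t.head? = Option.some (q a))).headD []).tail := by
    refine tail (headD (filter (f := fun a t => decide (t.head? = Option.some (q a))) (tails hS) ?_)
      (PolyTime.const _))
    refine listCases (f := fun _ => false) (g := fun p => decide (p.2.1 = q p.1.1))
      (snd PolyTime.id) (PolyTime.const _)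
      (natEq (fst (snd PolyTime.id)) (hq.comp (fst (fst PolyTime.id)))) ?_ ?_
    · intro a h; simp [h]
    · intro a x xs h; simp [h]
  refine h.congr fun a => ?_
  induction S a with
  | nil => rfl
  | cons b l ih =>
    rw [List.tails_cons, List.filter_cons, CC.after]
    by_cases hb : b = q a
    · simp [hb]
    · rw [if_neg hb, if_neg (by simpa using hb), ih]

theorem insertNew {S : α → List ℕ} {q : α → ℕ} (hS : PolyTime S) (hq : PolyTime q) :
    PolyTime fun a => insertNew (S a) (q a) :=
  ite (natMem hq hS) hS (cons hq hS)

theorem foldlInsertNew {l S : α → List ℕ} (hl : PolyTime l) (hS : PolyTime S) :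
    PolyTime fun a => (l a).foldl CC.insertNew (S a) :=
  foldlAdd hl hS (insertNew (fst (snd PolyTime.id)) (snd (snd PolyTime.id)))
    ⟨Polynomial.X + 1, fun a x b => by
      simp only [CC.insertNew, Polynomial.eval_add, Polynomial.eval_X, Polynomial.eval_one]
      split_ifs
      · omega
      · rw [csize_cons]; omega⟩

theorem qubits {i : α → Instr Q} (hi : PolyTime i) : PolyTime fun a => (i a).qubits :=
  instrCases (g₁ := fun p => [p.2.2]) (g₂ := fun p => [p.2.2.1, p.2.2.2]) hi
    (singleton (snd (snd PolyTime.id)))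
    (cons (fst (snd (snd PolyTime.id))) (singleton (snd (snd (snd PolyTime.id)))))
    (fun a g q h => by rw [h]; rfl) (fun a g q q' h => by rw [h]; rfl)

theorem orderedQubits {o : α → Option (List (Instr ℕ))} (ho : PolyTime o) :
    PolyTime fun a => orderedQubits (o a) :=
  flatMap (f := fun _ (i : Instr ℕ) => i.qubits) (optionGetD ho (PolyTime.const []))
    (qubits (snd PolyTime.id))

/-- A fold from the end of the path. Its state holds the site visited last, the colour of the next
edge and the edges so far; an edge is a last one if no edge has been produced before it. -/
theorem pathEdges {P : α → List Q} (hP : PolyTime P) : PolyTime fun a => pathEdges (P a) := by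
  have hs : PolyTime fun p : α × (Option Q × Bool × List (Edge Q)) × Q =>
      ((Option.some p.2.2, !p.2.1.2.1, (p.2.1.1.map fun q => (((p.2.2, q), p.2.1.2.1,
        p.2.1.2.2.isEmpty) : Edge Q)).toList ++ p.2.1.2.2) :
        Option Q × Bool × List (Edge Q)) := by
    have hx : PolyTime fun p : α × (Option Q × Bool × List (Edge Q)) × Q => p.2.1 :=
      fst (snd PolyTime.id)
    have hq : PolyTime fun p : α × (Option Q × Bool × List (Edge Q)) × Q => p.2.2 :=
      snd (snd PolyTime.id)
    refine pair (some hq) (pair (boolFn (fun b => !b) (fst (snd hx))) (append ?_ (snd (snd hx))))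
    exact optionCases (f := fun _ => []) (g := fun p => [((p.1.2.2, p.2), p.1.2.1.2.1,
        p.1.2.1.2.2.isEmpty)]) (fst hx) (PolyTime.const _)
      (singleton (pair (pair (hq.comp (fst PolyTime.id)) (snd PolyTime.id))
        (pair ((fst (snd hx)).comp (fst PolyTime.id))
          (isEmpty ((snd (snd hx)).comp (fst PolyTime.id))))))
      (fun a h => by simp [h]) (fun a x h => by simp [h])
  have h := foldrAdd (s := fun _ => ((none, true, []) : Option Q × Bool × List (Edge Q)))
    (step := fun _ p x => (Option.some p, !x.2.1,
      (x.1.map fun q => (((p, q), x.2.1, x.2.2.isEmpty) : Edge Q)).toList ++ x.2.2)) hP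
    (PolyTime.const _) hs ⟨2 * Polynomial.X + 30, fun a x b => by
      obtain ⟨n, k, out⟩ := x
      simp only [csize_pair, Polynomial.eval_add, Polynomial.eval_X, Polynomial.eval_mul,
        Polynomial.eval_ofNat]
      have h1 := csize_bool_le (!k)
      have h2 := csize_bool_le k
      have h3 := csize_bool_le out.isEmpty
      have h4 : csize (Option.some b) = csize b + 2 := by
        change 1 + csize b + 1 = _
        omega
      cases n with
      | none => simp; omega
      | some q =>
        have h5 : csize (Option.some q) = csize q + 2 := by
          change 1 + csize q + 1 = _
          omega
        simp only [Option.map_some, Option.toList_some, List.singleton_append, csize_cons,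
          csize_pair]
        omega⟩
  refine (snd (snd h)).congr fun a => ?_
  have key : ∀ l : List Q, l.foldr (fun p (x : Option Q × Bool × List (Edge Q)) =>
      (Option.some p, !x.2.1,
        (x.1.map fun q => (((p, q), x.2.1, x.2.2.isEmpty) : Edge Q)).toList ++ x.2.2))
      (none, true, []) = (l.head?, !CC.oddLength l, CC.pathEdges l) := by
    intro l
    induction l with
    | nil => rfl
    | cons p l ih =>
      rw [List.foldr_cons, ih]
      cases l with
      | nil => rfl
      | cons q l =>
        cases l <;> simp [CC.oddLength, CC.pathEdges]
  rw [key]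

theorem decorate {E : α → List (Edge Q)} {oe oo ot : α → List ℕ} (hE : PolyTime E)
    (he : PolyTime oe) (ho : PolyTime oo) (ht : PolyTime ot) :
    PolyTime fun a => decorate false false (E a) (oe a) (oo a) (ot a) := by
  let St : Type := (Bool × Bool) × (List ℕ × List ℕ × List ℕ) × List (DEdge Q)
  let step : St → Edge Q → St := fun x e =>
    let o := bit ((bif e.2.1 then x.2.1.2.1 else x.2.1.1).headD 0)
    let x' := xor x.1.1 o
    let z' := xor x.1.2 (bit (x.2.1.2.2.headD 0))
    ((!e.2.2 && x', !e.2.2 && z'),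
      (bif e.2.1 then x.2.1.1 else x.2.1.1.tail, bif e.2.1 then x.2.1.2.1.tail else x.2.1.2.1,
        x.2.1.2.2.tail),
      (e, o, bit (x.2.1.2.2.headD 0), e.2.2 && x', e.2.2 && z') :: x.2.2)
  have hbit : ∀ {ε : Type} [Coded ε] {f : ε → ℕ}, PolyTime f → PolyTime fun a => bit (f a) :=
    fun hf => natEq hf (PolyTime.const 1)
  have hs : PolyTime fun p : α × St × Edge Q => step p.2.1 p.2.2 := by
    have hx : PolyTime fun p : α × St × Edge Q => p.2.1 := fst (snd PolyTime.id)
    have hq : PolyTime fun p : α × St × Edge Q => p.2.2 := snd (snd PolyTime.id)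
    have hc := fst (snd hq)
    have hl := snd (snd hq)
    have h1 := fst (fst (snd hx))
    have h2 := fst (snd (fst (snd hx)))
    have h3 := snd (snd (fst (snd hx)))
    have hoo := hbit (headD (cond hc h2 h1) (PolyTime.const 0))
    have hot := hbit (headD h3 (PolyTime.const 0))
    have hx' := boolFn₂ xor (fst (fst hx)) hoo
    have hz' := boolFn₂ xor (snd (fst hx)) hot
    exact pair (pair (boolFn₂ (fun a b => !a && b) hl hx') (boolFn₂ (fun a b => !a && b) hl hz'))
      (pair (pair (cond hc h1 (tail h1)) (pair (cond hc (tail h2) h2) (tail h3)))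
        (cons (pair hq (pair hoo (pair hot (pair (boolFn₂ (fun a b => a && b) hl hx')
          (boolFn₂ (fun a b => a && b) hl hz'))))) (snd (snd hx))))
  have h := foldlAdd (s := fun a => (((false, false), (oe a, oo a, ot a), []) : St))
    (step := fun _ => step) hE (pair (PolyTime.const _) (pair (pair he (pair ho ht))
      (PolyTime.const _))) hs ⟨Polynomial.X + 30, fun a x e => by
      obtain ⟨⟨u, v⟩, ⟨l₁, l₂, l₃⟩, out⟩ := x
      simp only [step, csize_pair, csize_cons, Polynomial.eval_add, Polynomial.eval_X,
        Polynomial.eval_ofNat]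
      have k1 : csize (bif e.2.1 then l₁ else l₁.tail) ≤ csize l₁ := by
        cases e.2.1
        · exact csize_suffix_le l₁.tail_suffix
        · exact le_rfl
      have k2 : csize (bif e.2.1 then l₂.tail else l₂) ≤ csize l₂ := by
        cases e.2.1
        · exact le_rfl
        · exact csize_suffix_le l₂.tail_suffix
      have k3 := csize_suffix_le l₃.tail_suffix
      have k4 : ∀ b : Bool, 1 ≤ csize b := fun b => csize_pos b
      have k5 := fun b : Bool => csize_bool_le b
      have := k4 u
      have := k4 v
      have := k5 (!e.2.2 && xor u (bit ((bif e.2.1 then l₂ else l₁).headD 0)))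
      have := k5 (!e.2.2 && xor v (bit (l₃.headD 0)))
      have := k5 (e.2.2 && xor u (bit ((bif e.2.1 then l₂ else l₁).headD 0)))
      have := k5 (e.2.2 && xor v (bit (l₃.headD 0)))
      have := k5 (bit ((bif e.2.1 then l₂ else l₁).headD 0))
      have := k5 (bit (l₃.headD 0))
      omega⟩
  refine (reverse (snd (snd h))).congr fun a => ?_
  have key : ∀ (l : List (Edge Q)) (x z : Bool) (l₁ l₂ l₃ : List ℕ) (out : List (DEdge Q)),
      (l.foldl step ((x, z), (l₁, l₂, l₃), out)).2.2 =
        (CC.decorate x z l l₁ l₂ l₃).reverse ++ out := by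
    intro l
    induction l with
    | nil => intros; rfl
    | cons e l ih =>
      intro x z l₁ l₂ l₃ out
      rw [List.foldl_cons]
      simp only [CC.decorate, List.reverse_cons, List.append_assoc, List.singleton_append]
      exact ih _ _ _ _ _ _
  rw [key, List.append_nil, List.reverse_reverse]

theorem rowPath {l : α → List β} {l' : α → List γ} (hl : PolyTime l) (hl' : PolyTime l') :
    PolyTime fun a => rowPath (l a).length (l' a).length :=
  (map (f := fun a (x : ℕ) => ((x : ℤ), ((l' a).length : ℤ)))
    (range (cons (PolyTime.const false) (map (f := fun _ _ => false) hl (PolyTime.const _))))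
    (pair (intOfNat (snd PolyTime.id)) (intOfNat (length (hl'.comp (fst PolyTime.id)))))).congr
    fun a => by simp [CC.rowPath]

theorem colPath {l : α → List β} {l' : α → List γ} (hl : PolyTime l) (hl' : PolyTime l') :
    PolyTime fun a => colPath (l a).length (l' a).length :=
  map (f := fun a (y : ℕ) => (((l' a).length : ℤ), (y : ℤ))) (dropLength (range hl') hl)
    (pair (intOfNat (length (hl'.comp (fst PolyTime.id)))) (intOfNat (snd PolyTime.id)))

theorem minList {u : α → List ℕ × List ℕ} (hu : PolyTime u) : PolyTime fun a => minList (u a) :=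
  (cond (isEmpty (dropLength (snd hu) (fst hu))) (snd hu) (fst hu)).congr fun a => by
    simp only [CC.minList]
    cases ((u a).2.drop (u a).1.length).isEmpty <;> rfl

theorem maxList {u : α → List ℕ × List ℕ} (hu : PolyTime u) : PolyTime fun a => maxList (u a) :=
  (cond (isEmpty (dropLength (snd hu) (fst hu))) (fst hu) (snd hu)).congr fun a => by
    simp only [CC.maxList]
    cases ((u a).2.drop (u a).1.length).isEmpty <;> rfl

theorem rowPaths {U : α → List (List ℕ × List ℕ)} (hU : PolyTime U) :
    PolyTime fun a => rowPaths (U a) :=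
  flatMap (f := fun _ u => [CC.rowPath (CC.maxList u).length u.1.length,
      CC.rowPath (CC.maxList u).length u.2.length]) hU
    (cons (rowPath (maxList (snd PolyTime.id)) (fst (snd PolyTime.id)))
      (singleton (rowPath (maxList (snd PolyTime.id)) (snd (snd PolyTime.id)))))

theorem colPaths {U : α → List (List ℕ × List ℕ)} (hU : PolyTime U) :
    PolyTime fun a => colPaths (U a) :=
  map (f := fun _ u => CC.colPath (CC.minList u).length (CC.maxList u).length) hU
    (colPath (minList (snd PolyTime.id)) (maxList (snd PolyTime.id)))

theorem meetSite {l l' : α → List ℕ} (hl : PolyTime l) (hl' : PolyTime l') :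
    PolyTime fun a => meetSite (l a).length (l' a).length := by
  have h : PolyTime fun a => bif ((l' a).drop (l a).length).isEmpty
      then (((l a).length : ℤ), ((l a).length : ℤ))
      else (((l' a).length : ℤ), ((l' a).tail.length : ℤ)) :=
    cond (isEmpty (dropLength hl' hl)) (pair (intOfNat (length hl)) (intOfNat (length hl)))
      (pair (intOfNat (length hl')) (intOfNat (length (tail hl'))))
  refine h.congr fun a => ?_
  unfold CC.meetSite
  by_cases hlt : (l a).length < (l' a).length
  · have : ((l' a).drop (l a).length).isEmpty = false := by
      rw [List.isEmpty_eq_false_iff, ← List.length_pos_iff, List.length_drop]; omega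
    rw [if_pos hlt, this, cond_false, List.length_tail]
    congr 1
    omega
  · have : ((l' a).drop (l a).length).isEmpty = true := by
      rw [List.isEmpty_iff, List.drop_eq_nil_iff]; omega
    rw [if_neg hlt, this, cond_true]

theorem pairsOf {S : α → List ℕ} {L : α → List (Instr ℕ)} (hS : PolyTime S) (hL : PolyTime L) :
    PolyTime fun a => pairsOf (S a) (L a) := by
  refine flatMap (f := fun a i => match i with
    | Instr.one _ _ => []
    | Instr.two _ q q' => [(CC.after (S a) q, CC.after (S a) q')]) hL ?_
  refine instrCases (g₁ := fun _ => [])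
    (g₂ := fun p => [(CC.after (S p.1.1) p.2.2.1, CC.after (S p.1.1) p.2.2.2)])
    (snd PolyTime.id) (PolyTime.const _) ?_ ?_ ?_
  · have hS' := hS.comp (fst (fst (PolyTime.id (α := (α × Instr ℕ) × ℕ × ℕ × ℕ))))
    exact singleton (pair (after hS' (fst (snd (snd PolyTime.id))))
      (after hS' (snd (snd (snd PolyTime.id)))))
  · intro a g q h; simp [h]
  · intro a g q q' h; simp [h]

theorem gridInstr (n₁ n₂ : ℕ) {S : α → List ℕ} {i : α → Instr ℕ} (hS : PolyTime S)
    (hi : PolyTime i) : PolyTime fun a => gridInstr n₁ n₂ (S a) (i a) := by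
  refine instrCases
    (g₁ := fun p => Instr.one (p.2.1 + n₁) (0, ((CC.after (S p.1) p.2.2).length : ℤ)))
    (g₂ := fun p => Instr.two (p.2.1 + n₂)
      (CC.meetSite (CC.after (S p.1) p.2.2.1).length (CC.after (S p.1) p.2.2.2).length)
      (CC.meetSite (CC.after (S p.1) p.2.2.2).length (CC.after (S p.1) p.2.2.1).length))
    hi ?_ ?_ ?_ ?_
  · exact instrOne (addConst (fst (snd PolyTime.id)) _) (pair (PolyTime.const 0)
      (intOfNat (length (after (hS.comp (fst PolyTime.id)) (snd (snd PolyTime.id))))))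
  · have h1 := after (hS.comp (fst (PolyTime.id (α := α × ℕ × ℕ × ℕ))))
      (fst (snd (snd PolyTime.id)))
    have h2 := after (hS.comp (fst (PolyTime.id (α := α × ℕ × ℕ × ℕ))))
      (snd (snd (snd PolyTime.id)))
    exact instrTwo (addConst (fst (snd PolyTime.id)) _) (meetSite h1 h2) (meetSite h2 h1)
  · intro a g q h; rw [h]; rfl
  · intro a g q q' h; rw [h]; rfl

theorem restSite {S : α → List ℕ} {q : α → ℕ} (hS : PolyTime S) (hq : PolyTime q) :
    PolyTime fun a => restSite (S a) (q a) :=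
  ite (natMem hq hS) (pair (PolyTime.const 0) (intOfNat (length (after hS hq))))
    (pair (intNegSucc hq) (PolyTime.const 0))

end PolyTime

end CC

/-! ### Programs whose timesteps are computed in polynomial time -/

namespace CC

open Coded

/-- The operations of the `k`-th timestep of a program. -/
def layerAt {Q : Type} (prog : List (Stage Q)) (k : ℕ) (w : History) : List (Instr Q) :=
  (prog[k]?.map fun st => st.layer w).getD []

/-- Each timestep of the programs is computed in polynomial time. -/
def PolyProg {α Q : Type} [Coded α] [Coded Q] (prog : α → List (Stage Q)) : Prop :=
  ∀ k, PolyTime fun p : α × History => layerAt (prog p.1) k p.2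

namespace PolyProg

variable {α β Q : Type} [Coded α] [Coded β] [Coded Q]

/-- Since the first parts have a common length `n`, a fixed index falls into the same part for all
arguments. -/
theorem append {p p' : α → List (Stage Q)} (n : ℕ) (hn : ∀ a, (p a).length = n)
    (h : PolyProg p) (h' : PolyProg p') : PolyProg fun a => p a ++ p' a := by
  intro k
  by_cases hk : k < n
  · refine (h k).congr fun a => ?_
    rw [layerAt, layerAt, List.getElem?_append_left (by rw [hn]; exact hk)]
  · refine (h' (k - n)).congr fun a => ?_
    rw [layerAt, layerAt, List.getElem?_append_right (by rw [hn]; omega), hn]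

theorem single {kind : StageKind} {layer : α → History → List (Instr Q)}
    (h : PolyTime fun p : α × History => layer p.1 p.2) :
    PolyProg fun a => [⟨kind, layer a⟩] := by
  intro k
  cases k with
  | zero => exact h.congr fun a => rfl
  | succ k => exact (PolyTime.const []).congr fun a => rfl

theorem wordBlock {γ : Type} {inst : γ → β → Instr Q} (hinst : ∀ g, PolyTime (inst g))
    (word : List γ) {sel : α → History → List β}
    (h : PolyTime fun p : α × History => sel p.1 p.2) :
    PolyProg fun a => wordBlock inst word (sel a) := by
  induction word generalizing sel with
  | nil => exact fun k => (PolyTime.const []).congr fun a => rfl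
  | cons g gs ih =>
    intro k
    cases k with
    | zero =>
      exact (PolyTime.map (f := fun _ b => inst g b) h
        ((hinst g).comp (PolyTime.snd PolyTime.id))).congr fun a => rfl
    | succ k =>
      exact (ih (sel := fun a w => sel a w.tail) (h.comp (PolyTime.pair (PolyTime.fst PolyTime.id)
        (PolyTime.tail (PolyTime.snd PolyTime.id)))) k).congr fun a => rfl

theorem oneBlock (word : List (ℕ × Matrix Bool Bool ℂ)) {site : β → Q} (hs : PolyTime site)
    {sel : α → History → List β} (h : PolyTime fun p : α × History => sel p.1 p.2) :
    PolyProg fun a => oneBlock word site (sel a) :=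
  wordBlock (fun _ => PolyTime.instrOne (PolyTime.const _) hs) word h

theorem twoBlock (word : List (Gate × Matrix (Bool × Bool) (Bool × Bool) ℂ)) {edge : β → Q × Q}
    (he : PolyTime edge) {sel : α → History → List β}
    (h : PolyTime fun p : α × History => sel p.1 p.2) :
    PolyProg fun a => twoBlock word edge (sel a) := by
  refine wordBlock (fun g => ?_) word h
  obtain ⟨g, V⟩ := g
  have h1 := PolyTime.fst he
  have h2 := PolyTime.snd he
  cases g with
  | fst k => exact PolyTime.instrOne (PolyTime.const k) h1
  | snd k => exact PolyTime.instrOne (PolyTime.const k) h2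
  | both k => exact PolyTime.instrTwo (PolyTime.const k) h1 h2
  | swapped k => exact PolyTime.instrTwo (PolyTime.const k) h2 h1

theorem moveBlock (tk : Toolkit) {E : α → List (Edge Q)} (hE : PolyTime E) :
    PolyProg fun a => tk.moveBlock (E a) := by
  have hE' : PolyTime fun p : α × History => E p.1 := hE.comp (PolyTime.fst PolyTime.id)
  have hid := PolyTime.id (α := Edge Q)
  have hfilter : ∀ c : Bool, PolyTime fun p : α × History => (E p.1).filter fun e => e.2.1 == c :=
    fun c => PolyTime.filter (f := fun _ e => e.2.1 == c) hE'
      (PolyTime.boolFn (· == c) (PolyTime.fst (PolyTime.snd (PolyTime.snd PolyTime.id))))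
  have hmeas : ∀ {sel : α → List (Edge Q)} {site : Edge Q → Q},
      (PolyTime fun p : α × History => sel p.1) → PolyTime site →
      PolyProg fun a => [(⟨StageKind.meas, fun _ => (sel a).map fun e => Instr.one tk.kM (site e)⟩ :
        Stage Q)] := fun {sel site} h hs =>
    single (layer := fun a _ => (sel a).map fun e => Instr.one tk.kM (site e))
      (PolyTime.map (f := fun _ e => Instr.one tk.kM (site e)) h
        (PolyTime.instrOne (PolyTime.const _) (hs.comp (PolyTime.snd PolyTime.id))))
  have hpar : ∀ c, PolyProg fun a => tk.parityBlock (E a) c := fun c => by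
    unfold Toolkit.parityBlock
    exact append tk.wC.length (fun a => length_twoBlock _ _ _)
      (twoBlock tk.wC (PolyTime.fst hid) (hfilter c)) (append 1 (fun a => rfl)
        (hmeas (hfilter c) (PolyTime.snd (PolyTime.fst hid)))
        (twoBlock tk.wC (PolyTime.fst hid) (hfilter c)))
  have hlenp : ∀ c a, (tk.parityBlock (E a) c).length = 2 * tk.wC.length + 1 := fun c a => by
    simp only [Toolkit.parityBlock, List.length_append, length_twoBlock, List.length_singleton]
    omega
  have hdeco : ∀ (k : ℕ) (f : DEdge Q → Bool), PolyTime f →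
      PolyTime fun p : α × History => (tk.deco (E p.1) (p.2.drop k)).filter fun d => f d := by
    intro k f hf
    refine PolyTime.filter (f := fun _ d => f d) ?_ (hf.comp (PolyTime.snd PolyTime.id))
    have hd := PolyTime.dropConst (PolyTime.snd (PolyTime.id (α := α × History))) k
    exact PolyTime.decorate hE' (PolyTime.headD (PolyTime.dropConst hd _) (PolyTime.const _))
      (PolyTime.headD (PolyTime.dropConst hd _) (PolyTime.const _))
      (PolyTime.headD hd (PolyTime.const _))
  have hD := PolyTime.id (α := DEdge Q)
  unfold Toolkit.moveBlock
  refine append _ (fun a => length_oneBlock _ _ _)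
    (oneBlock tk.wH (PolyTime.snd (PolyTime.fst hid)) hE') ?_
  refine append _ (hlenp _) (hpar _) ?_
  refine append _ (hlenp _) (hpar _) ?_
  refine append _ (fun a => length_oneBlock _ _ _)
    (oneBlock tk.wH (PolyTime.fst (PolyTime.fst hid)) hE') ?_
  refine append 1 (fun a => rfl) (hmeas hE' (PolyTime.fst (PolyTime.fst hid))) ?_
  refine append _ (fun a => length_oneBlock _ _ _)
    (oneBlock tk.wX (PolyTime.fst (PolyTime.fst (PolyTime.fst hD)))
      (hdeco 0 (fun d => d.2.2.1) (PolyTime.fst (PolyTime.snd (PolyTime.snd hD))))) ?_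
  refine append _ (fun a => length_oneBlock _ _ _)
    (oneBlock tk.wX (PolyTime.snd (PolyTime.fst (PolyTime.fst hD)))
      (hdeco _ (fun d => d.2.2.2.1)
        (PolyTime.fst (PolyTime.snd (PolyTime.snd (PolyTime.snd hD)))))) ?_
  exact oneBlock tk.wZ (PolyTime.snd (PolyTime.fst (PolyTime.fst hD)))
      (hdeco _ (fun d => d.2.2.2.2)
        (PolyTime.snd (PolyTime.snd (PolyTime.snd (PolyTime.snd hD)))))

theorem chunk (tk : Toolkit) (n₁ n₂ : ℕ) :
    PolyProg fun a : List ℕ × List (Instr ℕ) => chunk tk n₁ n₂ a.1 a.2 := by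
  have hU : PolyTime fun a : List ℕ × List (Instr ℕ) => pairsOf a.1 a.2 :=
    PolyTime.pairsOf (PolyTime.fst PolyTime.id) (PolyTime.snd PolyTime.id)
  have hE : ∀ {Ps : List ℕ × List (Instr ℕ) → List (List (ℤ × ℤ))}, PolyTime Ps →
      PolyTime fun a => (Ps a).flatMap pathEdges := fun h =>
    PolyTime.flatMap (f := fun _ P => pathEdges P) h (PolyTime.pathEdges (PolyTime.snd PolyTime.id))
  have hrev : ∀ {Ps : List ℕ × List (Instr ℕ) → List (List (ℤ × ℤ))}, PolyTime Ps →
      PolyTime fun a => (Ps a).map List.reverse := fun h =>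
    PolyTime.map (f := fun _ P => List.reverse P) h (PolyTime.reverse (PolyTime.snd PolyTime.id))
  have hr := PolyTime.rowPaths hU
  have hc := PolyTime.colPaths hU
  unfold CC.chunk
  refine append _ (fun a => tk.length_moveBlock _) (moveBlock tk (hE hr)) ?_
  refine append _ (fun a => tk.length_moveBlock _) (moveBlock tk (hE hc)) ?_
  refine append 1 (fun a => rfl) (single ?_) ?_
  · exact PolyTime.map (f := fun (p : (List ℕ × List (Instr ℕ)) × History) i =>
      gridInstr n₁ n₂ p.1.1 i) (PolyTime.snd (PolyTime.fst PolyTime.id))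
      (PolyTime.gridInstr n₁ n₂ (PolyTime.fst (PolyTime.fst (PolyTime.fst PolyTime.id)))
        (PolyTime.snd PolyTime.id))
  · exact append _ (fun a => tk.length_moveBlock _) (moveBlock tk (hE (hrev hc)))
      (moveBlock tk (hE (hrev hr)))

/-- The index is now computed from the history. As all programs have `n` timesteps, removing one
entry of the history at a time is a case distinction with boundedly many branches, in each of which
the index is fixed. -/
theorem layerAt_length {prog : α → List (Stage Q)} (n : ℕ) (hn : ∀ a, (prog a).length = n)
    (h : PolyProg prog) :
    PolyTime fun p : α × History => layerAt (prog p.1) p.2.length p.2 := by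
  have key : ∀ j k, j + k = n → PolyTime fun p : (α × History) × History =>
      layerAt (prog p.1.1) (k + p.2.length) p.1.2 := by
    intro j
    induction j with
    | zero =>
      intro k hk
      refine (PolyTime.const []).congr fun a => ?_
      rw [layerAt, List.getElem?_eq_none (by rw [hn]; omega)]
      rfl
    | succ j ih =>
      intro k hk
      refine PolyTime.listCases (f := fun p => layerAt (prog p.1.1) k p.1.2)
        (g := fun p => layerAt (prog p.1.1.1) (k + 1 + p.2.2.length) p.1.1.2)
        (PolyTime.snd PolyTime.id) ((h k).comp (PolyTime.fst PolyTime.id))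
        ((ih (k + 1) (by omega)).comp (PolyTime.pair (PolyTime.fst (PolyTime.fst PolyTime.id))
          (PolyTime.snd (PolyTime.snd PolyTime.id)))) ?_ ?_
      · intro a ha; simp [ha]
      · intro a x xs ha
        simp only [ha, List.length_cons]
        congr 1
        omega
  refine ((key n 0 rfl).comp (g := fun p : α × History => (p, p.2))
    (PolyTime.pair PolyTime.id (PolyTime.snd PolyTime.id))).congr fun p => ?_
  simp

end PolyProg

/-! ### The simulating circuit -/

/-- The qubits that the controller orders operations on up to and in response to `h`, and the input
qubits, the latest first. -/
def seen (ctrl : Input → History → Option (List (Instr ℕ))) (i : Input) : History → List ℕ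
  | [] => (orderedQubits (ctrl i [])).foldl insertNew (List.range i.m).reverse
  | o :: h => (orderedQubits (ctrl i (o :: h))).foldl insertNew (seen ctrl i h)

/-- The recursion over histories as a single fold over all earlier histories, oldest first; in this
form it is computed in polynomial time. -/
theorem seen_eq (ctrl : Input → History → Option (List (Instr ℕ))) (i : Input) (h : History) :
    seen ctrl i h = (h.tails.reverse.flatMap fun t => orderedQubits (ctrl i t)).foldl insertNew
      (List.range i.m).reverse := by
  induction h with
  | nil => simp [seen]
  | cons o h ih =>
    rw [seen, ih, List.tails_cons, List.reverse_cons, List.flatMap_append, List.foldl_append]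
    simp

/-- Split the outcomes of the simulating circuit into the outcomes of complete blocks of `4 * μ + 1`
timesteps and the rest; of a complete block only the outcomes in the middle are kept. -/
def splitHistory (μ : ℕ) (h' : History) : History × History :=
  h'.foldr (fun o s => if s.2.length = 4 * μ then ((o :: s.2).getD (2 * μ) [] :: s.1, [])
    else (s.1, o :: s.2)) ([], [])

/-- The controller of the simulating circuit. -/
def gridCtrl (tk : Toolkit) (n₁ n₂ : ℕ) (ctrl : Input → History → Option (List (Instr ℕ)))
    (i : Input) (h' : History) : Option (List (Instr (ℤ × ℤ))) :=
  (ctrl i (splitHistory tk.moveLength h').1).map fun L =>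
    layerAt (chunk tk n₁ n₂ (seen ctrl i (splitHistory tk.moveLength h').1) L)
      (splitHistory tk.moveLength h').2.length (splitHistory tk.moveLength h').2

namespace PolyTime

variable {α : Type} [Coded α]

theorem seen {ctrl : Input → History → Option (List (Instr ℕ))}
    (hctrl : PolyTime fun p : Input × History => ctrl p.1 p.2) {i : α → Input} {h : α → History}
    (hi : PolyTime i) (hh : PolyTime h) : PolyTime fun a => seen ctrl (i a) (h a) := by
  have hr : PolyTime fun a => (List.range (i a).m).reverse :=
    (reverse (range (replicateInput hi))).congr fun a => by rw [List.length_replicate]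
  refine (foldlInsertNew (flatMap (f := fun a t => CC.orderedQubits (ctrl (i a) t))
    (reverse (tails hh)) (orderedQubits ?_)) hr).congr fun a => seen_eq _ _ _
  exact hctrl.comp (pair (hi.comp (fst PolyTime.id)) (snd PolyTime.id))

theorem splitHistory (μ : ℕ) {h : α → History} (hh : PolyTime h) :
    PolyTime fun a => splitHistory μ (h a) := by
  refine foldrAdd (s := fun _ => (([], []) : History × History)) (step := fun _ o s =>
    if s.2.length = 4 * μ then ((o :: s.2).getD (2 * μ) [] :: s.1, []) else (s.1, o :: s.2)) hh
    (PolyTime.const _) ?_ ⟨Polynomial.X + 10, fun a x b => ?_⟩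
  · have hx : PolyTime fun p : α × (History × History) × List ℕ => p.2.1 := fst (snd PolyTime.id)
    have ho : PolyTime fun p : α × (History × History) × List ℕ => p.2.2 := snd (snd PolyTime.id)
    exact ite (natEq (length (snd hx)) (PolyTime.const _))
      (pair (cons (getDConst (cons ho (snd hx)) _ _) (fst hx)) (PolyTime.const []))
      (pair (fst hx) (cons ho (snd hx)))
  · obtain ⟨h, w⟩ := x
    simp only [Polynomial.eval_add, Polynomial.eval_X, Polynomial.eval_ofNat]
    split_ifs
    · have : csize ((b :: w).getD (2 * μ) []) ≤ csize b + csize w + 1 := by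
        rw [List.getD_eq_getElem?_getD]
        cases hg : (b :: w)[2 * μ]? with
        | none => rw [Option.getD_none, csize_nil]; omega
        | some c =>
          exact csize_mem_le (List.mem_of_getElem? hg)
      simp only [csize_pair, csize_cons, csize_nil] at *
      omega
    · simp only [csize_pair, csize_cons]
      omega

theorem controlled {β : Type} [Coded β] {ctrl : Input → History → Option (List (Instr ℕ))}
    (hctrl : PolyTime fun p : Input × History => ctrl p.1 p.2)
    {F : (List ℕ × List (Instr ℕ)) × History → β} (hF : PolyTime F)
    {s : History → History × History} (hs : PolyTime s) :
    PolyTime fun p : Input × History => (ctrl p.1 (s p.2).1).map fun L =>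
      F ((CC.seen ctrl p.1 (s p.2).1, L), (s p.2).2) := by
  have hs' : PolyTime fun p : Input × History => s p.2 := hs.comp (snd PolyTime.id)
  refine optionMap (f := fun p : Input × History => ctrl p.1 (s p.2).1)
    (g := fun p L => F ((CC.seen ctrl p.1 (s p.2).1, L), (s p.2).2))
    (hctrl.comp (pair (fst PolyTime.id) (fst hs'))) ?_
  have hs'' := hs'.comp (fst (PolyTime.id (α := (Input × History) × List (Instr ℕ))))
  exact hF.comp (pair (pair (seen hctrl (fst (fst PolyTime.id)) (fst hs'')) (snd PolyTime.id))
    (snd hs''))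

theorem gridCtrl (tk : Toolkit) (n₁ n₂ : ℕ) {ctrl : Input → History → Option (List (Instr ℕ))}
    (hctrl : PolyTime fun p : Input × History => ctrl p.1 p.2) :
    PolyTime fun p : Input × History => gridCtrl tk n₁ n₂ ctrl p.1 p.2 :=
  controlled hctrl (PolyProg.layerAt_length _ (fun a : List ℕ × List (Instr ℕ) =>
    length_chunk tk n₁ n₂ a.1 a.2) (PolyProg.chunk tk n₁ n₂)) (splitHistory _ PolyTime.id)

end PolyTime

end CC

namespace CC

open Coded

/-! ### Total weight of the auxiliary outcomes -/

section Sums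

open scoped ENNReal

theorem tsum_list_cons {α : Type} {f : List α → ℝ≥0∞} (h : f [] = 0) :
    ∑' l, f l = ∑' (a : α) (l : List α), f (a :: l) := by
  have hi : Function.Injective fun p : α × List α => p.1 :: p.2 := by
    rintro ⟨a, l⟩ ⟨b, m⟩ h
    simpa using h
  rw [← hi.tsum_eq, ENNReal.tsum_prod']
  intro l hl
  cases l with
  | nil => exact absurd h hl
  | cons a l => exact ⟨(a, l), rfl⟩

theorem tsum_weight_meas (n : ℕ) :
    ∑' o : List ℕ, (StageKind.meas.weight n o : ℝ≥0∞) = 1 := by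
  induction n with
  | zero =>
    rw [tsum_eq_single []]
    · simp [StageKind.weight]
    · intro o ho
      have : o.length ≠ 0 := fun h => ho (List.length_eq_zero_iff.1 h)
      simp [StageKind.weight, ho]
  | succ n ih =>
    rw [tsum_list_cons (by simp [StageKind.weight])]
    have : ∀ a : ℕ, ∑' l : List ℕ, (StageKind.meas.weight (n + 1) (a :: l) : ℝ≥0∞) =
        if a < 2 then 2⁻¹ else 0 := by
      intro a
      by_cases ha : a < 2
      · have h2 : ((2⁻¹ : NNReal) : ℝ≥0∞) = 2⁻¹ := by
          rw [ENNReal.coe_inv (by norm_num)]; rfl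
        simp only [StageKind.weight_meas_cons, if_pos ha, ENNReal.coe_mul, ENNReal.tsum_mul_left,
          ih, mul_one, h2]
      · simp only [StageKind.weight_meas_cons, if_neg ha, ENNReal.coe_zero, tsum_zero]
    simp only [this]
    rw [tsum_eq_sum (s := Finset.range 2) (fun a ha => by simpa using ha)]
    simp [Finset.sum_range_succ, ENNReal.inv_two_add_inv_two]

theorem tsum_weight {Q : Type} {st : Stage Q} (h : st.kind ≠ StageKind.free) (w : History) :
    ∑' o : List ℕ, (st.weight w o : ℝ≥0∞) = 1 := by
  unfold Stage.weight
  cases hk : st.kind with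
  | unitary =>
    rw [tsum_eq_single (List.replicate (st.layer w).length 0)]
    · simp [StageKind.weight]
    · intro o ho; simp [StageKind.weight, ho]
  | meas => exact tsum_weight_meas _
  | free => exact absurd hk h

/-- The later timesteps have total weight 1 whatever the earlier outcomes were, so only the sum over
the first timestep is left. -/
theorem tsum_progWeight {Q : Type} {p : List (Stage Q)} (h : ∀ st ∈ p, st.kind ≠ StageKind.free)
    (w : History) :
    ∑' os : List (List ℕ), (if os.length = p.length then (progWeight p w os : ℝ≥0∞) else 0) = 1 := by
  induction p generalizing w with
  | nil =>
    rw [tsum_eq_single []]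
    · simp [progWeight]
    · intro o ho
      simp [ho]
  | cons st p ih =>
    rw [tsum_list_cons (by simp)]
    simp only [List.length_cons, Nat.add_right_cancel_iff, progWeight, ENNReal.coe_mul,
      ← mul_ite_zero, ENNReal.tsum_mul_left, ih (fun s hs => h s (by simp [hs])), mul_one]
    exact tsum_weight (h st (by simp)) w

/-- The outcomes `x` of the free timestep are prescribed and have weight 1; the probability of `x`
is contained in the state. Only the outcomes of the moves are summed over. -/
theorem tsum_progWeight_free {Q : Type} {p p' : List (Stage Q)} {st : Stage Q}
    (h : ∀ st ∈ p, st.kind ≠ StageKind.free) (hst : st.kind = StageKind.free)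
    (h' : ∀ st ∈ p', st.kind ≠ StageKind.free) (x : List ℕ) (w : History) :
    ∑' os : List (List ℕ), (if os.length = (p ++ st :: p').length then
      (if os.getD p.length [] = x then (progWeight (p ++ st :: p') w os : ℝ≥0∞) else 0) else 0) =
        1 := by
  induction p generalizing w with
  | nil =>
    simp only [List.nil_append]
    rw [tsum_list_cons (by simp)]
    have hw : ∀ o, st.weight w o = 1 := fun o => by simp [Stage.weight, hst, StageKind.weight]
    simp only [List.length_cons, Nat.add_right_cancel_iff, progWeight, hw, one_mul,
      List.length_nil, List.getD_cons_zero]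
    rw [tsum_eq_single x]
    · simp only [if_true]
      exact tsum_progWeight h' _
    · intro o ho
      simp [ho]
  | cons s p ih =>
    rw [tsum_list_cons (by simp)]
    simp only [List.cons_append, List.length_cons, Nat.add_right_cancel_iff, progWeight,
      ENNReal.coe_mul, List.getD_cons_succ, ← mul_ite_zero, ENNReal.tsum_mul_left,
      ih (fun s hs => h s (by simp [hs])), mul_one]
    exact tsum_weight (h s (by simp)) w

end Sums

theorem kind_wordBlock {α γ Q : Type} (inst : γ → α → Instr Q) (word : List γ)
    (sel : History → List α) : ∀ st ∈ wordBlock inst word sel, st.kind = StageKind.unitary := by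
  induction word generalizing sel with
  | nil => simp [wordBlock]
  | cons g gs ih => simpa [wordBlock] using ih _

theorem kind_moveBlock {Q : Type} (tk : Toolkit) (E : List (Edge Q)) :
    ∀ st ∈ tk.moveBlock E, st.kind ≠ StageKind.free := by
  have h : ∀ {α γ : Type} {inst : γ → α → Instr Q} {word : List γ} {sel : History → List α},
      ∀ st ∈ wordBlock inst word sel, st.kind ≠ StageKind.free := fun st hst => by
    rw [kind_wordBlock _ _ _ st hst]; simp
  simp only [Toolkit.moveBlock, Toolkit.parityBlock, List.mem_append, List.mem_singleton]
  rintro st (h1 | (h1 | h1 | h1) | (h1 | h1 | h1) | h1 | h1 | h1 | h1 | h1) <;>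
  first
  | exact h st h1
  | (subst h1; simp)

open scoped ENNReal in
theorem tsum_progWeight_chunk (tk : Toolkit) (n₁ n₂ : ℕ) (S : List ℕ) (L : List (Instr ℕ))
    (x : List ℕ) (w : History) :
    ∑' os : List (List ℕ), (if os.length = 4 * tk.moveLength + 1 then
      (if os.getD (2 * tk.moveLength) [] = x then
        (progWeight (chunk tk n₁ n₂ S L) w os : ℝ≥0∞) else 0) else 0) = 1 := by
  have hlen := length_chunk tk n₁ n₂ S L
  unfold chunk at *
  rw [← List.append_assoc, List.singleton_append] at *
  rw [← hlen, show 2 * tk.moveLength = (tk.moveBlock ((rowPaths (pairsOf S L)).flatMap pathEdges) ++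
    tk.moveBlock ((colPaths (pairsOf S L)).flatMap pathEdges)).length by
      rw [List.length_append, Toolkit.length_moveBlock, Toolkit.length_moveBlock, two_mul]]
  refine tsum_progWeight_free ?_ rfl ?_ x w
  all_goals
    intro st hst
    rcases List.mem_append.1 hst with h | h <;> exact kind_moveBlock _ _ st h

/-! ### Blocks of outcomes -/

/-- Division with remainder by the length of a block: the remainder tells which timestep of the
current block comes next. -/
theorem length_splitHistory (μ : ℕ) (h' : History) :
    h'.length = (4 * μ + 1) * (splitHistory μ h').1.length + (splitHistory μ h').2.length ∧
      (splitHistory μ h').2.length < 4 * μ + 1 := by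
  induction h' with
  | nil => simp [splitHistory]
  | cons o h' ih =>
    have hs : splitHistory μ (o :: h') = if (splitHistory μ h').2.length = 4 * μ
      then ((o :: (splitHistory μ h').2).getD (2 * μ) [] :: (splitHistory μ h').1, [])
      else ((splitHistory μ h').1, o :: (splitHistory μ h').2) := rfl
    rw [hs, List.length_cons, ih.1]
    split_ifs with h
    · simp only [List.length_cons, List.length_nil, h]
      exact ⟨by ring, by omega⟩
    · simp only [List.length_cons]
      exact ⟨by ring, by omega⟩

theorem splitHistory_cons (μ : ℕ) (o : List ℕ) (h' : History) :
    splitHistory μ (o :: h') = if (splitHistory μ h').2.length = 4 * μ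
      then ((o :: (splitHistory μ h').2).getD (2 * μ) [] :: (splitHistory μ h').1, [])
      else ((splitHistory μ h').1, o :: (splitHistory μ h').2) := rfl

theorem splitHistory_append {μ : ℕ} {h' h : History} (hs : splitHistory μ h' = (h, []))
    {os : List (List ℕ)} (hos : os.length ≤ 4 * μ) :
    splitHistory μ (os.reverse ++ h') = (h, os.reverse) := by
  induction os using List.reverseRecOn with
  | nil => exact hs
  | append_singleton os o ih =>
    rw [List.length_append, List.length_singleton] at hos
    rw [List.reverse_append, List.reverse_singleton, List.append_assoc, List.singleton_append,
      splitHistory_cons, ih (by omega), if_neg (by simp; omega)]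
    rfl

theorem splitHistory_append_full {μ : ℕ} {h' h : History} (hs : splitHistory μ h' = (h, []))
    {os : List (List ℕ)} (hos : os.length = 4 * μ + 1) :
    splitHistory μ (os.reverse ++ h') = (os.getD (2 * μ) [] :: h, []) := by
  have hne : os ≠ [] := by rintro rfl; simp at hos
  obtain ⟨os, o, rfl⟩ := (List.eq_nil_or_concat os).resolve_left hne
  rw [List.concat_eq_append] at *
  have hlen : os.length = 4 * μ := by simpa using hos
  rw [List.reverse_append, List.reverse_singleton, List.append_assoc, List.singleton_append,
    splitHistory_cons, splitHistory_append hs hlen.le, if_pos (by simpa using hlen)]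
  have : (o :: os.reverse) = (os ++ [o]).reverse := by simp
  rw [this, List.getD_eq_getElem?_getD, List.getD_eq_getElem?_getD,
    List.getElem?_reverse (by rw [hos]; omega), hos]
  -- Position 2μ is the middle of 4μ+1 entries, so it is the same counted from either end.
  congr 4
  omega

theorem splitHistory_eq_iff {μ : ℕ} {h' h : History} {os : List (List ℕ)} {o : List ℕ}
    (hos : os.length = 4 * μ + 1) :
    splitHistory μ (os.reverse ++ h') = (o :: h, []) ↔
      splitHistory μ h' = (h, []) ∧ os.getD (2 * μ) [] = o := by
  constructor
  · intro he
    have h1 := length_splitHistory μ h'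
    have h2 := length_splitHistory μ (os.reverse ++ h')
    rw [he] at h2
    simp only [List.length_append, List.length_reverse, hos, List.length_cons,
      List.length_nil] at h2
    have h3 : (splitHistory μ h').2 = [] := by
      rw [← List.length_eq_zero_iff]
      have h4 := congrArg (· % (4 * μ + 1)) (h1.1.symm.trans
        (show h'.length = (4 * μ + 1) * h.length by have := h2.1; rw [Nat.mul_succ] at this; omega))
      simpa [Nat.mod_eq_of_lt h1.2] using h4
    have h5 : splitHistory μ h' = ((splitHistory μ h').1, []) := by rw [← h3]
    rw [splitHistory_append_full h5 hos] at he
    simp only [Prod.mk.injEq, List.cons.injEq, and_true] at he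
    exact ⟨by rw [h5, he.2], he.1⟩
  · rintro ⟨hs, ho⟩
    rw [splitHistory_append_full hs hos, ho]

theorem splitHistory_eq_nil_iff {μ : ℕ} {h' : History} :
    splitHistory μ h' = ([], []) ↔ h' = [] := by
  constructor
  · intro h
    have := (length_splitHistory μ h').1
    rw [h] at this
    exact List.length_eq_zero_iff.1 (by simpa using this)
  · rintro rfl
    rfl

/-! ### Correctness of the simulating circuit -/

section Correct

open QState Circuit

theorem _root_.CC.QState.place_place {A Q R : Type} {f : A → Q} {g : Q → R}
    (hg : Function.Injective g) (ρ : QState A) : (ρ.place f).place g = ρ.place (g ∘ f) := by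
  funext c c'
  simp only [place]
  by_cases h : ∀ q, q ∉ Set.range (g ∘ f) → c q = false ∧ c' q = false
  · rw [if_pos h, if_pos, if_pos]
    · rfl
    · intro a ha
      refine h (g a) ?_
      rintro ⟨b, hb⟩
      exact ha ⟨b, hg hb⟩
    · intro q hq
      refine h q ?_
      rintro ⟨b, hb⟩
      exact hq ⟨f b, hb⟩
  · rw [if_neg h]
    split_ifs with h1 h2
    · refine absurd (fun q hq => ?_) h
      by_cases hq' : q ∈ Set.range g
      · obtain ⟨a, rfl⟩ := hq'
        refine h2 a ?_
        rintro ⟨b, rfl⟩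
        exact hq ⟨b, rfl⟩
      · exact h1 q hq'
    · rfl
    · rfl

variable {B : GateSet}

/-- `exec` proceeds from the first timestep and `run` from the last one; this recursion at the end
makes them comparable. -/
theorem exec_concat {Q : Type} [Coded Q] [DecidableEq Q] {adj : Q → Q → Prop}
    (C : Circuit B Q adj) (prog : List (Stage Q)) (w : History) (ρ : QState Q)
    (os : List (List ℕ)) (o : List ℕ) (h : os.length < prog.length) :
    exec C prog w ρ (os ++ [o]) =
      C.actLayer (layerAt prog os.length (os.reverse ++ w)) o (exec C prog w ρ os) := by
  induction prog generalizing w ρ os with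
  | nil => simp at h
  | cons st prog ih =>
    cases os with
    | nil => cases prog <;> rfl
    | cons o' os =>
      simp only [List.cons_append, exec, List.length_cons, List.reverse_cons, List.append_assoc,
        List.nil_append]
      rw [ih _ _ _ (by simpa using h)]
      rfl

theorem seen_nodup (ctrl : Input → History → Option (List (Instr ℕ))) (i : Input) (h : History) :
    (seen ctrl i h).Nodup := by
  cases h <;>
  · rw [seen_eq]
    exact foldl_insertNew_nodup (List.nodup_reverse.2 List.nodup_range)

theorem seen_suffix (ctrl : Input → History → Option (List (Instr ℕ))) (i : Input) (o : List ℕ)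
    (h : History) : seen ctrl i h <:+ seen ctrl i (o :: h) :=
  suffix_foldl_insertNew _ _

theorem range_suffix_seen (ctrl : Input → History → Option (List (Instr ℕ))) (i : Input)
    (h : History) : (List.range i.m).reverse <:+ seen ctrl i h := by
  rw [seen_eq]
  exact suffix_foldl_insertNew _ _

theorem mem_seen_of_ordered {ctrl : Input → History → Option (List (Instr ℕ))} {i : Input}
    {h : History} {q : ℕ} (hq : q ∈ orderedQubits (ctrl i h)) : q ∈ seen ctrl i h := by
  cases h <;>
  · rw [seen, mem_foldl_insertNew]
    exact Or.inl hq

theorem restSite_seen_input (ctrl : Input → History → Option (List (Instr ℕ))) (i : Input)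
    (h : History) {j : ℕ} (hj : j < i.m) : restSite (seen ctrl i h) j = column j := by
  have hm : j ∈ (List.range i.m).reverse := by simpa using hj
  rw [restSite_of_suffix (range_suffix_seen ctrl i h) (seen_nodup ctrl i h) hm, restSite,
    if_pos hm, length_after_range hj, column]

/-- The qubits ordered in response to `h` already belong to `seen C.ctrl i h`. Hence the next state
is supported there too, which is the second claim; it allows the passage from the arrangement before
a timestep to the one after it. -/
theorem run_supportedOn (C : CCAC B) (i : Input) (ρ : QState (Fin i.m)) (h : History) :
    SupportedOn {q | q ∈ seen C.ctrl i h} (C.run i (ρ.place fun j : Fin i.m => (j : ℕ)) h) ∧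
    ∀ o, SupportedOn {q | q ∈ seen C.ctrl i h}
      (C.run i (ρ.place fun j : Fin i.m => (j : ℕ)) (o :: h)) := by
  have step : ∀ h, SupportedOn {q | q ∈ seen C.ctrl i h}
        (C.run i (ρ.place fun j : Fin i.m => (j : ℕ)) h) →
      ∀ o, SupportedOn {q | q ∈ seen C.ctrl i h}
        (C.run i (ρ.place fun j : Fin i.m => (j : ℕ)) (o :: h)) := by
    intro h hs o
    simp only [run]
    cases hL : C.ctrl i h with
    | none => exact SupportedOn.zero _
    | some L =>
      refine actLayer_supportedOn C (fun q hq => mem_seen_of_ordered ?_) hs o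
      rw [hL]
      exact hq
  have main : SupportedOn {q | q ∈ seen C.ctrl i h}
      (C.run i (ρ.place fun j : Fin i.m => (j : ℕ)) h) := by
    induction h with
    | nil =>
      refine (supportedOn_place _ ρ).mono ?_
      rintro _ ⟨j, rfl⟩
      exact (range_suffix_seen C.ctrl i []).subset (by simp)
    | cons o h ih => exact (step h ih o).mono fun q hq => (seen_suffix C.ctrl i o h).subset hq
  exact ⟨main, step h main⟩

section Simulation

variable {C : CCAC B} {C' : CCNTC B} {tk : Toolkit} {n₁ n₂ : ℕ}
  (hctrl : C'.ctrl = gridCtrl tk n₁ n₂ C.ctrl)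

include hctrl in
-- Inside a block the decoded history does not change, so the same chunk is being executed, and its
-- timesteps see only the outcomes of the current block.
theorem run_append {i : Input} {h h' : History} {L : List (Instr ℕ)}
    (hs : splitHistory tk.moveLength h' = (h, [])) (hL : C.ctrl i h = some L)
    (ρ : QState (ℤ × ℤ)) {os : List (List ℕ)} (hos : os.length ≤ 4 * tk.moveLength + 1) :
    C'.run i ρ (os.reverse ++ h') =
      exec C' (chunk tk n₁ n₂ (seen C.ctrl i h) L) [] (C'.run i ρ h') os := by
  induction os using List.reverseRecOn with
  | nil => cases chunk tk n₁ n₂ (seen C.ctrl i h) L <;> rfl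
  | append_singleton os o ih =>
    rw [List.length_append, List.length_singleton] at hos
    have hc : C'.ctrl i (os.reverse ++ h') =
        some (layerAt (chunk tk n₁ n₂ (seen C.ctrl i h) L) os.length (os.reverse ++ [])) := by
      rw [hctrl, gridCtrl, splitHistory_append hs (by omega), hL, Option.map_some,
        List.length_reverse, List.append_nil]
    rw [List.reverse_append, List.reverse_singleton, List.append_assoc, List.singleton_append,
      run, hc, exec_concat _ _ _ _ _ _ (by rw [length_chunk]; omega), ← ih (by omega)]

open scoped ENNReal

include hctrl in
-- Induction on `h`, one block at a time. The coefficient of a history is that of its part before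
-- the last block times the weight of the last block, so the sums factorise.
theorem exists_weights (ht : tk.Valid C'.one C'.two) (h₁ : ∀ g, C'.one (g + n₁) = C.one g)
    (h₂ : ∀ g, C'.two (g + n₂) = C.two g) (i : Input) (ρ : QState (Fin i.m)) (h : History) :
    ∃ c : History → NNReal, (∀ h', splitHistory tk.moveLength h' = (h, []) →
        C'.run i (ρ.place fun j : Fin i.m => column j) h' = (c h' : ℝ) •
          (C.run i (ρ.place fun j : Fin i.m => (j : ℕ)) h).place (restSite (seen C.ctrl i h))) ∧
      (∀ h', splitHistory tk.moveLength h' ≠ (h, []) → c h' = 0) ∧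
      ∑' h', (c h' : ℝ≥0∞) = 1 := by
  set μ := tk.moveLength with hμ
  induction h with
  | nil =>
    refine ⟨fun h' => if h' = [] then 1 else 0, ?_, ?_, ?_⟩
    · intro h' hs
      rw [splitHistory_eq_nil_iff] at hs
      subst hs
      simp only [run, if_true, NNReal.coe_one, one_smul]
      rw [place_place (restSite_injective _)]
      congr 1
      funext j
      exact (restSite_seen_input C.ctrl i [] j.2).symm
    · intro h' hs
      rw [ne_eq, splitHistory_eq_nil_iff] at hs
      exact if_neg hs
    · rw [tsum_eq_single []]
      · simp
      · intro h' hh; simp [hh]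
  | cons o h ih =>
    obtain ⟨c, hc, hc0, hsum⟩ := ih
    -- If `C` has stopped at `h`, the states of both circuits vanish and any weights will do; the
    -- chunk of an empty timestep keeps their sum equal to 1.
    set prog := chunk tk n₁ n₂ (seen C.ctrl i h) ((C.ctrl i h).getD []) with hprog
    set T := 4 * μ + 1 with hT
    refine ⟨fun h' => if splitHistory μ h' = (o :: h, []) then
      c (h'.drop T) * progWeight prog [] (h'.take T).reverse else 0, ?_, ?_, ?_⟩
    · intro h' hs
      have hlen := (length_splitHistory μ h').1
      rw [hs] at hlen
      simp only [List.length_cons, List.length_nil, Nat.add_zero, Nat.mul_succ] at hlen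
      have hlt : (h'.take T).length = T := by rw [List.length_take]; omega
      have hh : h' = ((h'.take T).reverse).reverse ++ h'.drop T := by simp
      set os := (h'.take T).reverse with hos
      have hol : os.length = T := by rw [hos, List.length_reverse, hlt]
      have hs' := hs
      rw [hh, splitHistory_eq_iff hol] at hs'
      obtain ⟨hs0, hx⟩ := hs'
      simp only [if_pos hs]
      cases hL : C.ctrl i h with
      | none =>
        have h1 : C.run i (ρ.place fun j : Fin i.m => (j : ℕ)) (o :: h) = 0 := by
          simp only [run, hL]
        rw [h1, place_zero, smul_zero]
        cases hcase : os with
        | nil => rw [hcase] at hol; simp [hT] at hol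
        | cons a os' =>
          -- The first timestep after the stop already makes the state 0, and 0 is preserved by all
          -- further ones.
          have key : ∀ (l : History), l.length < T →
              C'.run i (ρ.place fun j : Fin i.m => column j)
                ((a :: l).reverse ++ h'.drop T) = 0 := by
            intro l
            induction l using List.reverseRecOn with
            | nil =>
              intro _
              simp only [List.reverse_cons, List.reverse_nil, List.nil_append,
                List.singleton_append, run]
              rw [hctrl, gridCtrl, hs0]
              simp [hL]
            | append_singleton l b ihl =>
              intro hl
              rw [List.length_append, List.length_singleton] at hl
              rw [← List.cons_append, List.reverse_append, List.reverse_singleton,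
                List.append_assoc, List.singleton_append]
              simp only [run]
              rw [ihl (by omega)]
              split
              · rfl
              · exact actLayer_zero _ _ _
          rw [hh, hcase]
          refine key os' ?_
          rw [hcase, List.length_cons] at hol
          omega
      | some L =>
        have hprog' : prog = chunk tk n₁ n₂ (seen C.ctrl i h) L := by rw [hprog, hL]; rfl
        have hmem : ∀ q ∈ L.flatMap Instr.qubits, q ∈ seen C.ctrl i h := fun q hq =>
          mem_seen_of_ordered (by rw [hL]; exact hq)
        have himpl := Impl.chunk ht h₁ h₂ (C.disjoint i h L hL) hmem [] hol
          (C.run i (ρ.place fun j : Fin i.m => (j : ℕ)) h)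
        have hrun : C.actLayer L o (C.run i (ρ.place fun j : Fin i.m => (j : ℕ)) h) =
            C.run i (ρ.place fun j : Fin i.m => (j : ℕ)) (o :: h) := by
          simp only [run, hL]
        rw [hx, hrun] at himpl
        -- Qubits that are new in response to `o :: h` change from their parking sites to rows of
        -- the first column. They are still in |0⟩, so this takes no operation.
        have hplace := place_congr (restSite_injective (seen C.ctrl i h))
          (restSite_injective (seen C.ctrl i (o :: h)))
          ((run_supportedOn C i ρ h).2 o) (fun q hq => (restSite_of_suffix
            (seen_suffix C.ctrl i o h) (seen_nodup C.ctrl i (o :: h)) hq).symm)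
        rw [hplace] at himpl
        conv_lhs => rw [hh]
        rw [run_append hctrl hs0 hL _ hol.le, hc _ hs0, exec_real_smul, himpl, hprog', smul_smul,
          NNReal.coe_mul]
    · intro h' hs
      exact if_neg hs
    · have hi : Function.Injective fun p : History × {os : List (List ℕ) // os.length = T} =>
          p.2.1.reverse ++ p.1 := by
        rintro ⟨l, os, hos⟩ ⟨l', os', hos'⟩ he
        have := List.append_inj he (by simp [hos, hos'])
        simp only [List.reverse_inj] at this
        simp [this.1, this.2]
      rw [← hi.tsum_eq, ENNReal.tsum_prod']
      · have h1 : ∀ (l : History) (os : {os : List (List ℕ) // os.length = T}),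
            (((if splitHistory μ (os.1.reverse ++ l) = (o :: h, []) then
              c ((os.1.reverse ++ l).drop T) *
                progWeight prog [] ((os.1.reverse ++ l).take T).reverse else 0 : NNReal)) : ℝ≥0∞) =
            c l * (if os.1.getD (2 * μ) [] = o then (progWeight prog [] os.1 : ℝ≥0∞) else 0) := by
          rintro l ⟨os, hos⟩
          have hr : os.reverse.length = T := by simp [hos]
          rw [List.drop_left' hr, List.take_left' hr, List.reverse_reverse]
          by_cases hl : splitHistory μ l = (h, [])
          · by_cases hx : os.getD (2 * μ) [] = o
            · rw [if_pos ((splitHistory_eq_iff hos).2 ⟨hl, hx⟩), if_pos hx, ENNReal.coe_mul]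
            · rw [if_neg (fun h' => hx ((splitHistory_eq_iff hos).1 h').2), if_neg hx,
                ENNReal.coe_zero, mul_zero]
          · rw [if_neg (fun h' => hl ((splitHistory_eq_iff hos).1 h').1), hc0 l hl,
              ENNReal.coe_zero, zero_mul]
        simp only [h1, ENNReal.tsum_mul_left]
        have h2 := tsum_progWeight_chunk tk n₁ n₂ (seen C.ctrl i h) ((C.ctrl i h).getD []) o []
        have h3 : ∑' os : {os : List (List ℕ) // os.length = T},
            (if os.1.getD (2 * μ) [] = o then (progWeight prog [] os.1 : ℝ≥0∞) else 0) = 1 := by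
          refine ((tsum_subtype {os : List (List ℕ) | os.length = T}
            (fun os => if os.getD (2 * μ) [] = o then (progWeight prog [] os : ℝ≥0∞) else 0)).trans
            (tsum_congr fun os => ?_)).trans h2
          rw [Set.indicator_apply]
          rfl
        rw [h3]
        simpa using hsum
      · intro h' hne
        have hs : splitHistory μ h' = (o :: h, []) := by
          by_contra hs
          exact hne (by simp only [if_neg hs, ENNReal.coe_zero])
        have hlen := (length_splitHistory μ h').1
        rw [hs] at hlen
        simp only [List.length_cons, List.length_nil, Nat.add_zero, Nat.mul_succ] at hlen
        exact ⟨(h'.drop T, ⟨(h'.take T).reverse, by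
          rw [List.length_reverse, List.length_take]; omega⟩), by simp⟩

include hctrl in
-- By `exists_weights` the series is a series of numbers with sum 1 times one fixed state. The
-- weights vanish on histories outside the index set, so restricting to that set does not change the
-- sum.
theorem simulates_of_ctrl (ht : tk.Valid C'.one C'.two) (h₁ : ∀ g, C'.one (g + n₁) = C.one g)
    (h₂ : ∀ g, C'.two (g + n₂) = C.two g) (hseed : C'.seedLen = C.seedLen) : Simulates C' C := by
  refine ⟨hseed, fun _ h' => (splitHistory tk.moveLength h').1,
    fun i h => restSite (seen C.ctrl i h),
    PolyTime.fst (PolyTime.splitHistory _ (PolyTime.snd PolyTime.id)),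
    PolyTime.restSite (PolyTime.seen C.polyTime (PolyTime.fst PolyTime.id)
      (PolyTime.fst (PolyTime.snd PolyTime.id))) (PolyTime.snd (PolyTime.snd PolyTime.id)),
    fun i h => ⟨restSite_injective _, fun j hj => restSite_seen_input _ _ _ hj, fun hnone ρ _ => ?_⟩⟩
  obtain ⟨c, hc, hc0, hsum⟩ := exists_weights hctrl ht h₁ h₂ i ρ h
  have hs : HasSum c 1 := by
    rw [← ENNReal.hasSum_coe, ENNReal.coe_one]
    have := ENNReal.summable (f := fun h' => (c h' : ℝ≥0∞)) |>.hasSum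
    rwa [hsum] at this
  have hs' : HasSum (fun h' => (c h' : ℝ)) 1 := by
    have := NNReal.hasSum_coe.2 hs
    rwa [NNReal.coe_one] at this
  have hsub : HasSum ((fun h' => (c h' : ℝ)) ∘ (Subtype.val :
      {h' | C'.ctrl i h' = none ∧ (splitHistory tk.moveLength h').1 = h} → History)) 1 := by
    rw [hasSum_subtype_iff_of_support_subset]
    · exact hs'
    · intro h' hne
      have : splitHistory tk.moveLength h' = (h, []) := by
        by_contra hh
        exact hne (by simp [hc0 h' hh])
      refine ⟨?_, by rw [this]⟩
      rw [hctrl, gridCtrl, this, hnone]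
      rfl
  have := hsub.smul_const ((C.run i (ρ.place fun j : Fin i.m => (j : ℕ)) h).place
    (restSite (seen C.ctrl i h)))
  rw [one_smul] at this
  suffices hfun : ∀ h' : {h' : History // C'.ctrl i h' = none ∧
      (splitHistory tk.moveLength h').1 = h},
      C'.run i (ρ.place fun j : Fin i.m => column j) h'.1 = (c h'.1 : ℝ) •
        (C.run i (ρ.place fun j : Fin i.m => (j : ℕ)) h).place (restSite (seen C.ctrl i h)) by
    change HasSum (fun h' : {h' : History // C'.ctrl i h' = none ∧
      (splitHistory tk.moveLength h').1 = h} =>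
        C'.run i (ρ.place fun j : Fin i.m => column j) h'.1) _
    rw [funext hfun]
    exact this
  rintro ⟨h', _, hh⟩
  simp only
  -- A history ending inside a block contributes 0: one timestep earlier it decoded to the same `h`,
  -- where the controller had already stopped.
  by_cases hw : (splitHistory tk.moveLength h').2 = []
  · exact hc h' (Prod.ext hh hw)
  · rw [hc0 h' fun h1 => hw (by rw [h1]), NNReal.coe_zero, zero_smul]
    cases h' with
    | nil => exact absurd rfl hw
    | cons o h' =>
      rw [splitHistory_cons] at hw hh
      split_ifs at hw hh with h1
      · exact absurd rfl hw
      · simp only at hh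
        simp only [run]
        rw [hctrl, gridCtrl, hh, hnone]
        rfl

end Simulation

end Correct

end CC

namespace CC

open Coded

/-! ### The operations of the simulating circuit -/

section Layers

variable {Q : Type}

/-- The operations act on some of the edges `E`. -/
def EdgeLayer (E : List (Edge Q)) (L : List (Instr Q)) : Prop :=
  ∃ F : List (Edge Q), F.Sublist E ∧ ((∃ g, L = F.map fun e => Instr.one g e.1.1) ∨
    (∃ g, L = F.map fun e => Instr.one g e.1.2) ∨
    ∃ c, (∀ e ∈ F, e.2.1 = c) ∧ ∃ g : Gate, L = F.map fun e => g.instr e.1)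

theorem layer_wordBlock {α γ : Type} {inst : γ → α → Instr Q} {word : List γ}
    {sel : History → List α} {st : Stage Q} (h : st ∈ wordBlock inst word sel) :
    ∃ g k, ∀ w, st.layer w = (sel (w.drop k)).map (inst g) := by
  induction word generalizing sel with
  | nil => simp [wordBlock] at h
  | cons g gs ih =>
    rcases List.mem_cons.1 h with rfl | h
    · exact ⟨g, 0, fun w => rfl⟩
    · obtain ⟨g', k, h'⟩ := ih h
      exact ⟨g', k + 1, fun w => by rw [h' w, List.tail_drop]⟩

theorem edgeLayer_moveBlock {tk : Toolkit} {E : List (Edge Q)} {st : Stage Q}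
    (h : st ∈ tk.moveBlock E) (w : History) : EdgeLayer E (st.layer w) := by
  have hdeco : ∀ (w : History) (f : DEdge Q → Bool),
      (((tk.deco E w).filter f).map Prod.fst).Sublist E := fun w f => by
    have := (List.filter_sublist (p := f) (l := tk.deco E w)).map Prod.fst
    rwa [Toolkit.deco, decorate_map_fst] at this
  have hpar : ∀ c, st ∈ tk.parityBlock E c → EdgeLayer E (st.layer w) := by
    intro c h
    have hF : (E.filter fun e => e.2.1 == c).Sublist E := List.filter_sublist
    have hc : ∀ e ∈ E.filter fun e => e.2.1 == c, e.2.1 = c := fun e he => by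
      simpa using (List.mem_filter.1 he).2
    simp only [Toolkit.parityBlock, List.mem_append, List.mem_singleton] at h
    rcases h with h | rfl | h
    · obtain ⟨g, k, h⟩ := layer_wordBlock h
      exact ⟨_, hF, Or.inr (Or.inr ⟨c, hc, g.1, h w⟩)⟩
    · exact ⟨_, hF, Or.inr (Or.inl ⟨_, rfl⟩)⟩
    · obtain ⟨g, k, h⟩ := layer_wordBlock h
      exact ⟨_, hF, Or.inr (Or.inr ⟨c, hc, g.1, h w⟩)⟩
  simp only [Toolkit.moveBlock, List.mem_append, List.mem_singleton] at h
  rcases h with h | h | h | h | rfl | h | h | h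
  · obtain ⟨g, k, h⟩ := layer_wordBlock h
    exact ⟨E, List.Sublist.refl _, Or.inr (Or.inl ⟨_, h w⟩)⟩
  · exact hpar _ h
  · exact hpar _ h
  · obtain ⟨g, k, h⟩ := layer_wordBlock h
    exact ⟨E, List.Sublist.refl _, Or.inl ⟨_, h w⟩⟩
  · exact ⟨E, List.Sublist.refl _, Or.inl ⟨_, rfl⟩⟩
  · obtain ⟨g, k, h⟩ := layer_wordBlock h
    exact ⟨_, hdeco _ _, Or.inl ⟨g.1, by rw [h w, List.map_map]; rfl⟩⟩
  · obtain ⟨g, k, h⟩ := layer_wordBlock h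
    exact ⟨_, hdeco _ _, Or.inr (Or.inl ⟨g.1, by rw [h w, List.map_map]; rfl⟩)⟩
  · obtain ⟨g, k, h⟩ := layer_wordBlock h
    exact ⟨_, hdeco _ _, Or.inr (Or.inl ⟨g.1, by rw [h w, List.map_map]; rfl⟩)⟩

theorem Gate.mem_qubits {g : Gate} {p : Q × Q} {q : Q} (h : q ∈ (g.instr p).qubits) :
    q = p.1 ∨ q = p.2 := by
  cases g <;> simp [Gate.instr, Instr.qubits] at h <;> tauto

/-- Two-qubit gates are applied to edges of one colour only, and these do not meet. First sites are
distinct among each other, and so are second sites. -/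
theorem EdgeLayer.nodup {E : List (Edge Q)} {L : List (Instr Q)} (h : EdgeLayer E L)
    (hsep : E.Pairwise EdgeSep) (hne : ∀ e ∈ E, e.1.1 ≠ e.1.2) :
    (L.flatMap Instr.qubits).Nodup := by
  obtain ⟨F, hF, h⟩ := h
  have hsep' := hsep.sublist hF
  rcases h with ⟨g, rfl⟩ | ⟨g, rfl⟩ | ⟨c, hc, g, rfl⟩ <;> rw [List.flatMap_map, List.nodup_flatMap]
  · exact ⟨fun e _ => by simp [Instr.qubits], hsep'.imp fun h => by
      simpa [Instr.qubits, Function.onFun] using Ne.symm h.1⟩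
  · exact ⟨fun e _ => by simp [Instr.qubits], hsep'.imp fun h => by
      simpa [Instr.qubits, Function.onFun] using Ne.symm h.2.2.1⟩
  · refine ⟨fun e he => ?_, hsep'.imp_of_mem fun {e e'} he he' h => ?_⟩
    · have := hne e (hF.subset he)
      have := this.symm
      cases g <;> simp [Gate.instr, Instr.qubits, *]
    · intro q hq hq'
      have h4 := h.2.2.2 (Or.inr ((hc e he).trans (hc e' he').symm))
      rcases Gate.mem_qubits hq with rfl | rfl <;> rcases Gate.mem_qubits hq' with h' | h'
      · exact h.1 h'
      · exact h.2.1 h'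
      · exact h4 h'
      · exact h.2.2.1 h'

theorem EdgeLayer.length_le {E : List (Edge Q)} {L : List (Instr Q)} (h : EdgeLayer E L) :
    L.length ≤ E.length := by
  obtain ⟨F, hF, h⟩ := h
  have := hF.length_le
  rcases h with ⟨g, rfl⟩ | ⟨g, rfl⟩ | ⟨c, hc, g, rfl⟩ <;> simpa using this

theorem EdgeLayer.mem_qubits {E : List (Edge Q)} {L : List (Instr Q)} (h : EdgeLayer E L)
    {i : Instr Q} (hi : i ∈ L) {q : Q} (hq : q ∈ i.qubits) :
    ∃ e ∈ E, q = e.1.1 ∨ q = e.1.2 := by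
  obtain ⟨F, hF, h⟩ := h
  rcases h with ⟨g, rfl⟩ | ⟨g, rfl⟩ | ⟨c, hc, g, rfl⟩ <;>
    obtain ⟨e, he, rfl⟩ := List.mem_map.1 hi <;> refine ⟨e, hF.subset he, ?_⟩
  · exact Or.inl (by simpa [Instr.qubits] using hq)
  · exact Or.inr (by simpa [Instr.qubits] using hq)
  · exact Gate.mem_qubits hq

theorem EdgeLayer.adjacent {E : List (Edge Q)} {L : List (Instr Q)} (h : EdgeLayer E L)
    {R : Q → Q → Prop} (hR : ∀ p q, R p q → R q p) (hE : ∀ e ∈ E, R e.1.1 e.1.2) {g : ℕ} {a b : Q}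
    (hi : Instr.two g a b ∈ L) : R a b := by
  obtain ⟨F, hF, h⟩ := h
  rcases h with ⟨g, rfl⟩ | ⟨g, rfl⟩ | ⟨c, hc, g, rfl⟩ <;>
    obtain ⟨e, he, hi⟩ := List.mem_map.1 hi
  · cases hi
  · cases hi
  · have := hE e (hF.subset he)
    cases g <;> cases hi
    · exact this
    · exact hR _ _ this

theorem pathEdges_chain {R : Q → Q → Prop} {P : List Q} (h : P.IsChain R) {e : Edge Q}
    (he : e ∈ pathEdges P) : R e.1.1 e.1.2 := by
  induction P with
  | nil => simp [pathEdges] at he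
  | cons p l ih =>
    cases l with
    | nil => simp [pathEdges] at he
    | cons q l =>
      rw [List.isChain_cons_cons] at h
      simp only [pathEdges, List.mem_cons] at he
      rcases he with rfl | he
      · exact h.1
      · exact ih h.2 he

end Layers

/-! ### Layers and paths inside a square of the grid -/

theorem GridAdj.symm (p q : ℤ × ℤ) (h : GridAdj p q) : GridAdj q p := by
  unfold GridAdj at *
  rwa [abs_sub_comm q.1, abs_sub_comm q.2]

/-- The square of side `k` at the origin. -/
def square (k : ℕ) : Set (ℤ × ℤ) := Set.Ico 0 (k : ℤ) ×ˢ Set.Ico 0 (k : ℤ)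

theorem mem_square {k : ℕ} {p : ℤ × ℤ} :
    p ∈ square k ↔ (0 ≤ p.1 ∧ p.1 < k) ∧ (0 ≤ p.2 ∧ p.2 < k) := Iff.rfl

/-- At most `n` operations on disjoint sets of neighbouring sites of the square of side `k`. -/
structure GridLayer (k n : ℕ) (L : List (Instr (ℤ × ℤ))) : Prop where
  nodup : (L.flatMap Instr.qubits).Nodup
  adjacent : ∀ g a b, Instr.two g a b ∈ L → GridAdj a b
  length_le : L.length ≤ n
  mem_square : ∀ i ∈ L, ∀ q ∈ i.qubits, q ∈ square k

theorem GridLayer.nil (k n : ℕ) : GridLayer k n [] := ⟨by simp, by simp, by simp, by simp⟩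

/-- Disjoint paths of at most `n` sites in total in the square of side `k`. -/
structure GridPaths (k n : ℕ) (Ps : List (List (ℤ × ℤ))) : Prop where
  nodup : Ps.flatten.Nodup
  chain : ∀ P ∈ Ps, P.IsChain GridAdj
  length_le : Ps.flatten.length ≤ n
  mem_square : ∀ P ∈ Ps, ∀ q ∈ P, q ∈ square k

theorem GridPaths.reverse {k n : ℕ} {Ps : List (List (ℤ × ℤ))} (h : GridPaths k n Ps) :
    GridPaths k n (Ps.map List.reverse) where
  nodup := flatten_map_reverse_nodup h.nodup
  chain P hP := by
    obtain ⟨P', hP', rfl⟩ := List.mem_map.1 hP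
    rw [List.isChain_reverse]
    exact (h.chain P' hP').imp fun a b => GridAdj.symm a b
  length_le := by
    refine le_of_eq_of_le ?_ h.length_le
    simp [List.length_flatten, Function.comp_def]
  mem_square P hP q hq := by
    obtain ⟨P', hP', rfl⟩ := List.mem_map.1 hP
    exact h.mem_square P' hP' q (List.mem_reverse.1 hq)

theorem GridPaths.gridLayer {k n : ℕ} {Ps : List (List (ℤ × ℤ))} (h : GridPaths k n Ps)
    {tk : Toolkit} {st : Stage (ℤ × ℤ)} (hst : st ∈ tk.moveBlock (Ps.flatMap pathEdges))
    (w : History) : GridLayer k n (st.layer w) := by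
  have hl := edgeLayer_moveBlock hst w
  refine ⟨hl.nodup (pathEdges_flatMap_sep h.nodup) fun e he => ?_,
    fun g a b hi => hl.adjacent GridAdj.symm (fun e he => ?_) hi, hl.length_le.trans ?_,
    fun i hi q hq => ?_⟩
  · obtain ⟨P, hP, he⟩ := List.mem_flatMap.1 he
    exact pathEdges_ne ((List.nodup_flatten.1 h.nodup).1 P hP) he
  · obtain ⟨P, hP, he⟩ := List.mem_flatMap.1 he
    exact pathEdges_chain (h.chain P hP) he
  · refine le_trans ?_ h.length_le
    rw [List.length_flatMap, List.length_flatten]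
    exact List.sum_le_sum fun P _ => length_pathEdges_le P
  · obtain ⟨e, he, hq⟩ := hl.mem_qubits hi hq
    obtain ⟨P, hP, he⟩ := List.mem_flatMap.1 he
    have := mem_of_mem_pathEdges he
    rcases hq with rfl | rfl
    · exact h.mem_square P hP _ this.1
    · exact h.mem_square P hP _ (List.mem_of_mem_tail this.2)

theorem rowPath_chain (n r : ℕ) : (rowPath n r).IsChain GridAdj := by
  rw [rowPath, List.isChain_map, List.isChain_range_succ]
  intro m _
  simp [GridAdj]

theorem colPath_chain (k n : ℕ) : (colPath k n).IsChain GridAdj := by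
  rw [colPath, List.isChain_map]
  refine List.IsChain.drop ?_ _
  rw [List.isChain_range]
  intro m _
  simp [GridAdj]

/-! ### Size and extent of the block for one timestep -/

section Chunk

variable {S : List ℕ} {L : List (Instr ℕ)} (hL : (L.flatMap Instr.qubits).Nodup)
  (hS : ∀ q ∈ L.flatMap Instr.qubits, q ∈ S)

theorem length_pairsOf_le (S : List ℕ) (L : List (Instr ℕ)) :
    (pairsOf S L).length ≤ L.length := by
  unfold pairsOf
  induction L with
  | nil => simp
  | cons i L ih =>
    rw [List.flatMap_cons, List.length_append, List.length_cons]
    cases i <;> simp only [List.length_nil, List.length_singleton] <;> omega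

include hS in
theorem length_lt_of_mem_pairsOf {u : List ℕ × List ℕ} (hu : u ∈ pairsOf S L) :
    u.1.length < S.length ∧ u.2.length < S.length := by
  obtain ⟨g, a, b, hi, rfl⟩ := mem_pairsOf.1 hu
  exact ⟨length_after_lt (hS a (List.mem_flatMap.2 ⟨_, hi, by simp [Instr.qubits]⟩)),
    length_after_lt (hS b (List.mem_flatMap.2 ⟨_, hi, by simp [Instr.qubits]⟩))⟩

include hL hS in
-- A pair uses two stretches of rows with at most `S.length` sites each, and there are at most
-- `L.length` pairs. This is the source of the factor 2n in the bound on the size.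
theorem gridPaths_rowPaths : GridPaths S.length (2 * S.length * L.length)
    (rowPaths (pairsOf S L)) where
  nodup := rowPaths_nodup (rowsNodup_pairsOf hL hS)
  chain P hP := by
    obtain ⟨u, _, hP⟩ := List.mem_flatMap.1 hP
    simp only [List.mem_cons, List.not_mem_nil, or_false] at hP
    rcases hP with rfl | rfl <;> exact rowPath_chain _ _
  length_le := by
    have hlen : ∀ U : List (List ℕ × List ℕ), (∀ u ∈ U, (maxList u).length < S.length) →
        (rowPaths U).flatten.length ≤ U.length * (2 * S.length) := by
      intro U hU
      induction U with
      | nil => simp [rowPaths]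
      | cons u U ih =>
        have h1 := ih fun v hv => hU v (by simp [hv])
        have h2 := hU u (by simp)
        unfold rowPaths at *
        rw [List.flatMap_cons, List.flatten_append, List.length_append, List.length_cons,
          Nat.succ_mul]
        simp only [List.flatten_cons, List.flatten_nil, List.append_nil, List.length_append,
          rowPath, List.length_map, List.length_range] at *
        omega
    refine (hlen _ fun u hu => ?_).trans ?_
    · have := length_lt_of_mem_pairsOf hS hu
      rw [length_maxList]
      omega
    · rw [mul_comm (2 * S.length)]
      exact Nat.mul_le_mul_right _ (length_pairsOf_le S L)
  mem_square P hP q hq := by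
    obtain ⟨u, hu, hP⟩ := List.mem_flatMap.1 hP
    have := length_lt_of_mem_pairsOf hS hu
    have hm := length_maxList u
    simp only [List.mem_cons, List.not_mem_nil, or_false] at hP
    rcases hP with rfl | rfl <;>
    · obtain ⟨x, hx, rfl⟩ := mem_rowPath.1 hq
      rw [mem_square]
      simp only
      omega

include hL hS in
theorem gridPaths_colPaths : GridPaths S.length (2 * S.length * L.length)
    (colPaths (pairsOf S L)) where
  nodup := colPaths_nodup (rowsNodup_pairsOf hL hS)
  chain P hP := by
    obtain ⟨u, _, rfl⟩ := List.mem_map.1 hP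
    exact colPath_chain _ _
  length_le := by
    have hlen : ∀ U : List (List ℕ × List ℕ), (∀ u ∈ U, (maxList u).length < S.length) →
        (colPaths U).flatten.length ≤ U.length * (2 * S.length) := by
      intro U hU
      induction U with
      | nil => simp [colPaths]
      | cons u U ih =>
        have h1 := ih fun v hv => hU v (by simp [hv])
        have h2 := hU u (by simp)
        unfold colPaths at *
        rw [List.map_cons, List.flatten_cons, List.length_append, List.length_cons,
          Nat.succ_mul]
        simp only [colPath, List.length_map, List.length_drop, List.length_range] at *
        omega
    refine (hlen _ fun u hu => ?_).trans ?_
    · have := length_lt_of_mem_pairsOf hS hu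
      rw [length_maxList]
      omega
    · rw [mul_comm (2 * S.length)]
      exact Nat.mul_le_mul_right _ (length_pairsOf_le S L)
  mem_square P hP q hq := by
    obtain ⟨u, hu, rfl⟩ := List.mem_map.1 hP
    have := length_lt_of_mem_pairsOf hS hu
    have hm := length_maxList u
    obtain ⟨y, _, hy, rfl⟩ := mem_colPath.1 hq
    rw [mem_square]
    simp only
    omega

theorem meetSite_mem_square {r r' k : ℕ} (h : r < k) (h' : r' < k) : meetSite r r' ∈ square k := by
  unfold meetSite
  rw [mem_square]
  split_ifs <;> simp only <;> omega

theorem relabel_qubits {Q R : Type} (n₁ n₂ : ℕ) (f : Q → R) (i : Instr Q) :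
    (i.relabel n₁ n₂ f).qubits = i.qubits.map f := by
  cases i <;> rfl

include hL hS in
theorem gridLayer_gridInstr (n₁ n₂ : ℕ) :
    GridLayer S.length (2 * S.length * L.length) (L.map (gridInstr n₁ n₂ S)) where
  nodup := by
    have hU := rowsNodup_pairsOf hL hS
    rw [map_gridInstr n₁ n₂ hL hS, List.flatMap_map]
    simp only [relabel_qubits]
    rw [← List.map_flatMap]
    exact hL.map (hopAll_injective (colPaths_nodup hU) (colPaths_tail_not_mem hU (restSite_fst S))
      (hopAll_injective (rowPaths_nodup hU) (rowPaths_tail_not_mem (restSite_fst S))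
        (restSite_injective S)))
  adjacent g a b h := by
    obtain ⟨i, hi, h⟩ := List.mem_map.1 h
    cases i with
    | one g' q => cases h
    | two g' a' b' =>
      cases h
      exact gridAdj_meetSite ((rowsNodup_pairsOf hL hS).ne (mem_pairsOf.2 ⟨_, _, _, hi, rfl⟩))
  length_le := by
    rw [List.length_map]
    cases L with
    | nil => simp
    | cons i L =>
      have : 0 < S.length := by
        cases i with
        | one g q => exact List.length_pos_of_mem (hS q (by simp [Instr.qubits]))
        | two g a b => exact List.length_pos_of_mem (hS a (by simp [Instr.qubits]))
      exact Nat.le_mul_of_pos_left _ (by omega)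
  mem_square i hi q hq := by
    obtain ⟨j, hj, rfl⟩ := List.mem_map.1 hi
    have hS' : ∀ q ∈ j.qubits, (after S q).length < S.length := fun q hq =>
      length_after_lt (hS q (List.mem_flatMap.2 ⟨j, hj, hq⟩))
    cases j with
    | one g q' =>
      have := hS' q' (by simp [Instr.qubits])
      simp only [gridInstr, Instr.qubits, List.mem_singleton] at hq
      rw [hq, mem_square]
      simp only
      omega
    | two g a b =>
      have h1 := hS' a (by simp [Instr.qubits])
      have h2 := hS' b (by simp [Instr.qubits])
      simp only [gridInstr, Instr.qubits, List.mem_cons, List.not_mem_nil, or_false] at hq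
      rcases hq with rfl | rfl
      · exact meetSite_mem_square h1 h2
      · exact meetSite_mem_square h2 h1

include hL hS in
theorem gridLayer_chunk (tk : Toolkit) (n₁ n₂ : ℕ) (k : ℕ) (w : History) :
    GridLayer S.length (2 * S.length * L.length) (layerAt (chunk tk n₁ n₂ S L) k w) := by
  unfold layerAt
  cases h : (chunk tk n₁ n₂ S L)[k]? with
  | none => exact GridLayer.nil _ _
  | some st =>
    have hst := List.mem_of_getElem? h
    simp only [chunk, List.mem_append, List.mem_singleton] at hst
    simp only [Option.map_some, Option.getD_some]
    rcases hst with hst | hst | rfl | hst | hst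
    · exact (gridPaths_rowPaths hL hS).gridLayer hst w
    · exact (gridPaths_colPaths hL hS).gridLayer hst w
    · exact gridLayer_gridInstr hL hS n₁ n₂
    · exact (gridPaths_colPaths hL hS).reverse.gridLayer hst w
    · exact (gridPaths_rowPaths hL hS).reverse.gridLayer hst w

end Chunk

end CC

namespace CC

open Coded

/-! ### Words for the gates from universality -/

section Universal

theorem getElem_prepend {α : Type} {E : List α} (f : ℕ → α) {k : ℕ} {a : α} (h : E[k]? = some a) :
    prepend E f k = a := by
  obtain ⟨hk, rfl⟩ := List.getElem?_eq_some_iff.1 h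
  exact dif_pos hk

theorem prepend_add {α : Type} (E : List α) (f : ℕ → α) (k : ℕ) :
    prepend E f (k + E.length) = f k := by
  simp [prepend]

theorem prepend_mem {α : Type} {E : List α} {f : ℕ → α} {s : Set α} (hE : ∀ a ∈ E, a ∈ s)
    (hf : ∀ k, f k ∈ s) (k : ℕ) : prepend E f k ∈ s := by
  unfold prepend
  split_ifs
  · exact hE _ (List.getElem_mem _)
  · exact hf _

/-- The set of operations in two lists. -/
def GateSet.ofLists (E₁ : List (Instrument Bool)) (E₂ : List (Instrument (Bool × Bool))) : GateSet :=
  ⟨{E | E ∈ E₁}, {E | E ∈ E₂}⟩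

theorem GateSet.unitary₁_mono {B B' : GateSet} (h : B.one ⊆ B'.one) : B.unitary₁ ⊆ B'.unitary₁ :=
  fun _ ⟨E, hE, hV⟩ => ⟨E, h hE, hV⟩

theorem GateSet.unitary₂_mono {B B' : GateSet} (h₁ : B.one ⊆ B'.one) (h₂ : B.two ⊆ B'.two) :
    B.unitary₂ ⊆ B'.unitary₂ := by
  rintro W (⟨V, hV, h⟩ | ⟨V, hV, h⟩ | ⟨E, hE, h⟩ | ⟨E, hE, h⟩)
  · exact Or.inl ⟨V, unitary₁_mono h₁ hV, h⟩
  · exact Or.inr (Or.inl ⟨V, unitary₁_mono h₁ hV, h⟩)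
  · exact Or.inr (Or.inr (Or.inl ⟨E, h₂ hE, h⟩))
  · exact Or.inr (Or.inr (Or.inr ⟨E, h₂ hE, h⟩))

variable {B : GateSet}

/-- A word has finitely many letters, so finitely many basic operations suffice for it; these will
be put in front of every table. -/
theorem exists_list₁ {gs : List (Matrix Bool Bool ℂ)} (h : ∀ V ∈ gs, V ∈ B.unitary₁) :
    ∃ E₁ : List (Instrument Bool), (∀ E ∈ E₁, E ∈ B.one) ∧
      ∀ V ∈ gs, V ∈ (GateSet.ofLists E₁ []).unitary₁ := by
  induction gs with
  | nil => exact ⟨[], by simp, by simp⟩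
  | cons V gs ih =>
    obtain ⟨E₁, hE, hgs⟩ := ih fun W hW => h W (by simp [hW])
    obtain ⟨E, hE', hV⟩ := h V (by simp)
    refine ⟨E :: E₁, by simpa using ⟨hE', hE⟩, ?_⟩
    rw [List.forall_mem_cons]
    refine ⟨⟨E, List.mem_cons_self, hV⟩, fun W hW => GateSet.unitary₁_mono ?_ (hgs W hW)⟩
    exact fun E' hE' => List.mem_cons_of_mem _ hE'

theorem exists_list₂ {gs : List (Matrix (Bool × Bool) (Bool × Bool) ℂ)}
    (h : ∀ W ∈ gs, W ∈ B.unitary₂) :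
    ∃ (E₁ : List (Instrument Bool)) (E₂ : List (Instrument (Bool × Bool))),
      (∀ E ∈ E₁, E ∈ B.one) ∧ (∀ E ∈ E₂, E ∈ B.two) ∧
      ∀ W ∈ gs, W ∈ (GateSet.ofLists E₁ E₂).unitary₂ := by
  induction gs with
  | nil => exact ⟨[], [], by simp, by simp, by simp⟩
  | cons W gs ih =>
    obtain ⟨E₁, E₂, hE₁, hE₂, hgs⟩ := ih fun W hW => h W (by simp [hW])
    have h1 : ∀ E, (GateSet.ofLists E₁ E₂).unitary₂ ⊆ (GateSet.ofLists (E :: E₁) E₂).unitary₂ :=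
      fun E => GateSet.unitary₂_mono (fun _ hE' => List.mem_cons_of_mem _ hE') fun _ h => h
    have h2 : ∀ E, (GateSet.ofLists E₁ E₂).unitary₂ ⊆ (GateSet.ofLists E₁ (E :: E₂)).unitary₂ :=
      fun E => GateSet.unitary₂_mono (fun _ h => h) fun _ hE' => List.mem_cons_of_mem _ hE'
    rcases h W (by simp) with ⟨V, ⟨E, hE, hV⟩, hW⟩ | ⟨V, ⟨E, hE, hV⟩, hW⟩ | ⟨E, hE, hW⟩ |
      ⟨E, hE, hW⟩
    · refine ⟨E :: E₁, E₂, by simpa using ⟨hE, hE₁⟩, hE₂, List.forall_mem_cons.2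
        ⟨Or.inl ⟨V, ⟨E, List.mem_cons_self, hV⟩, hW⟩, fun W hW => h1 E (hgs W hW)⟩⟩
    · refine ⟨E :: E₁, E₂, by simpa using ⟨hE, hE₁⟩, hE₂, List.forall_mem_cons.2
        ⟨Or.inr (Or.inl ⟨V, ⟨E, List.mem_cons_self, hV⟩, hW⟩), fun W hW => h1 E (hgs W hW)⟩⟩
    · refine ⟨E₁, E :: E₂, hE₁, by simpa using ⟨hE, hE₂⟩, List.forall_mem_cons.2
        ⟨Or.inr (Or.inr (Or.inl ⟨E, List.mem_cons_self, hW⟩)), fun W hW => h2 E (hgs W hW)⟩⟩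
    · refine ⟨E₁, E :: E₂, hE₁, by simpa using ⟨hE, hE₂⟩, List.forall_mem_cons.2
        ⟨Or.inr (Or.inr (Or.inr ⟨E, List.mem_cons_self, hW⟩)), fun W hW => h2 E (hgs W hW)⟩⟩

theorem exists_word {γ M : Type} {P : γ → M → Prop} {gs : List M} (h : ∀ V ∈ gs, ∃ k, P k V) :
    ∃ word : List (γ × M), word.map Prod.snd = gs ∧ ∀ g ∈ word, P g.1 g.2 := by
  induction gs with
  | nil => exact ⟨[], rfl, by simp⟩
  | cons V gs ih =>
    obtain ⟨k, hk⟩ := h V (by simp)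
    obtain ⟨word, h1, h2⟩ := ih fun W hW => h W (by simp [hW])
    exact ⟨(k, V) :: word, by simp [h1], List.forall_mem_cons.2 ⟨hk, h2⟩⟩

theorem exists_name₁ {E₁ : List (Instrument Bool)} {E₂ : List (Instrument (Bool × Bool))}
    {V : Matrix Bool Bool ℂ} (h : V ∈ (GateSet.ofLists E₁ E₂).unitary₁) :
    ∃ k, ∀ f, (prepend E₁ f k).kraus = [[V]] := by
  obtain ⟨E, hE, hV⟩ := h
  obtain ⟨k, hk⟩ := List.mem_iff_getElem?.1 hE
  exact ⟨k, fun f => by rw [getElem_prepend f hk, hV]⟩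

theorem exists_name₂ {E₁ : List (Instrument Bool)} {E₂ : List (Instrument (Bool × Bool))}
    {W : Matrix (Bool × Bool) (Bool × Bool) ℂ} (h : W ∈ (GateSet.ofLists E₁ E₂).unitary₂) :
    ∃ g : Gate, ∀ f f', g.Is (prepend E₁ f) (prepend E₂ f') W := by
  rcases h with ⟨V, hV, h⟩ | ⟨V, hV, h⟩ | ⟨E, hE, h⟩ | ⟨E, hE, h⟩
  · obtain ⟨k, hk⟩ := exists_name₁ hV
    exact ⟨Gate.fst k, fun f f' => ⟨V, hk f, h⟩⟩
  · obtain ⟨k, hk⟩ := exists_name₁ hV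
    exact ⟨Gate.snd k, fun f f' => ⟨V, hk f, h⟩⟩
  · obtain ⟨k, hk⟩ := List.mem_iff_getElem?.1 hE
    exact ⟨Gate.both k, fun f f' => by rw [Gate.Is, getElem_prepend f' hk, h]⟩
  · obtain ⟨k, hk⟩ := List.mem_iff_getElem?.1 hE
    exact ⟨Gate.swapped k, fun f f' => by rw [Gate.Is, getElem_prepend f' hk, h]⟩

/-- The words are written for H, X, Z and CNOT with the operations at the beginning of the table.
Their names are positions in that beginning, so they are the same for all circuits. -/
theorem exists_toolkit (hB : B.IsUniversal) (hM : B.HasMeasurement) :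
    ∃ (tk : Toolkit) (E₁ : List (Instrument Bool)) (E₂ : List (Instrument (Bool × Bool))),
      (∀ E ∈ E₁, E ∈ B.one) ∧ (∀ E ∈ E₂, E ∈ B.two) ∧
      ∀ f f', tk.Valid (prepend E₁ f) (prepend E₂ f') := by
  obtain ⟨gH, hH, zH⟩ := hB.one _ gateH_mem
  obtain ⟨gX, hX, zX⟩ := hB.one _ gateX_mem
  obtain ⟨gZ, hZ, zZ⟩ := hB.one _ gateZ_mem
  obtain ⟨gC, hC, zC⟩ := hB.two _ gateCNOT_mem
  obtain ⟨EM, hEM, hkM⟩ := hM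
  obtain ⟨E, hE, hV⟩ := exists_list₁ (gs := gH ++ gX ++ gZ) (B := B) fun V hV => by
    simp only [List.mem_append] at hV
    rcases hV with (h | h) | h
    exacts [hH V h, hX V h, hZ V h]
  obtain ⟨E₁, E₂, hE₁, hE₂, hW⟩ := exists_list₂ hC
  set F := E ++ E₁ ++ [EM] with hF
  have hone : ∀ V ∈ gH ++ gX ++ gZ, ∃ k, ∀ f, (prepend F f k).kraus = [[V]] := fun V h =>
    exists_name₁ (E₂ := []) (GateSet.unitary₁_mono (B := GateSet.ofLists E []) (B' := GateSet.ofLists F [])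
      (fun e (he : e ∈ E) => show e ∈ F by simp [hF, he]) (hV V h))
  have htwo : ∀ W ∈ gC, ∃ g : Gate, ∀ f f', g.Is (prepend F f) (prepend E₂ f') W := fun W h =>
    exists_name₂ (GateSet.unitary₂_mono (B := GateSet.ofLists E₁ E₂) (B' := GateSet.ofLists F E₂)
      (fun e (he : e ∈ E₁) => show e ∈ F by simp [hF, he]) (fun _ h => h) (hW W h))
  have word₁ : ∀ {gs : List (Matrix Bool Bool ℂ)} {U : Matrix Bool Bool ℂ},
      (∀ V ∈ gs, V ∈ gH ++ gX ++ gZ) → (∃ z : ℂ, ‖z‖ = 1 ∧ gs.prod = z • U) →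
      ∃ word, ∀ f, IsWord₁ (prepend F f) word U := by
    intro gs U h hz
    -- In a product the last factor acts first, whereas a word is applied from its first letter.
    obtain ⟨word, h1, h2⟩ := exists_word (gs := gs.reverse) fun V hV =>
      hone V (h V (List.mem_reverse.1 hV))
    exact ⟨word, fun f => ⟨fun g hg => h2 g hg f, by rwa [h1, List.reverse_reverse]⟩⟩
  obtain ⟨wH, hwH⟩ := word₁ (fun V h => by simp [h]) zH
  obtain ⟨wX, hwX⟩ := word₁ (fun V h => by simp [h]) zX
  obtain ⟨wZ, hwZ⟩ := word₁ (fun V h => by simp [h]) zZ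
  obtain ⟨wC, h1, h2⟩ := exists_word (gs := gC.reverse) fun W hW =>
    htwo W (List.mem_reverse.1 hW)
  obtain ⟨kM, hk⟩ := List.mem_iff_getElem?.1 (show EM ∈ F by simp [hF])
  refine ⟨⟨wH, wX, wZ, wC, kM⟩, F, E₂, ?_, hE₂, fun f f' =>
    ⟨hwH f, hwX f, hwZ f, ⟨fun g hg => h2 g hg f f', by rwa [h1, List.reverse_reverse]⟩, ?_⟩⟩
  · intro e he
    simp only [hF, List.mem_append, List.mem_singleton] at he
    rcases he with (h | h) | rfl
    exacts [hE e h, hE₁ e h, hEM]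
  · rw [getElem_prepend f hk, hkM, single_eq_toC_intP, single_eq_toC_intP]

end Universal

/-! ### Depth, size and width -/

/-- Here `a` is the charge for the response to a history and `A` bounds the charges of all responses
so far; `a'` and `A'` belong to the grid. Each timestep still missing from the current block is paid
in advance by one unit `a`, so inside a block the left side does not grow. When a block is
completed, the new response adds at least `a` to `A`, which pays for its 4μ+1 timesteps. -/
theorem block_bound {μ : ℕ} {a A a' A' : History → ℕ} (hn : a [] ≤ A [])
    (hc : ∀ o h, a (o :: h) + A h ≤ A (o :: h)) (hn' : A' [] ≤ a' [])
    (hc' : ∀ o h', A' (o :: h') ≤ a' (o :: h') + A' h')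
    (ha : ∀ h', a' h' ≤ a (splitHistory μ h').1) (h' : History) :
    A' h' + (4 * μ - (splitHistory μ h').2.length) * a (splitHistory μ h').1 ≤
      (4 * μ + 1) * A (splitHistory μ h').1 := by
  induction h' with
  | nil =>
    have h1 := ha []
    have h2 := Nat.mul_le_mul_left (4 * μ + 1) hn
    simp only [splitHistory, List.foldr_nil, List.length_nil, Nat.sub_zero] at *
    rw [Nat.succ_mul] at h2
    omega
  | cons o h' ih =>
    have h1 := ha (o :: h')
    have h2 := hc' o h'
    rw [splitHistory_cons] at *
    split_ifs at * with hw
    · have h3 := Nat.mul_le_mul_left (4 * μ + 1)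
        (hc ((o :: (splitHistory μ h').2).getD (2 * μ) []) (splitHistory μ h').1)
      rw [Nat.mul_add, Nat.succ_mul (4 * μ) (a _)] at h3
      simp only [hw, List.length_nil, Nat.sub_zero, Nat.sub_self, Nat.zero_mul] at *
      omega
    · have h4 := (length_splitHistory μ h').2
      obtain ⟨j, hj⟩ : ∃ j, 4 * μ - (splitHistory μ h').2.length = j + 1 :=
        ⟨4 * μ - (splitHistory μ h').2.length - 1, by omega⟩
      have h5 : 4 * μ - ((splitHistory μ h').2.length + 1) = j := by omega
      rw [hj, Nat.succ_mul] at ih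
      simp only [List.length_cons, h5] at *
      omega

section Accounting

open Circuit

variable {B : GateSet} {C : CCAC B} {C' : CCNTC B} {tk : Toolkit} {n₁ n₂ : ℕ}

theorem gridLayer_gridCtrl {i : Input} {h' : History} {L' : List (Instr (ℤ × ℤ))}
    (h : gridCtrl tk n₁ n₂ C.ctrl i h' = some L') :
    ∃ L, C.ctrl i (splitHistory tk.moveLength h').1 = some L ∧
      GridLayer (seen C.ctrl i (splitHistory tk.moveLength h').1).length
        (2 * (seen C.ctrl i (splitHistory tk.moveLength h').1).length * L.length) L' := by
  obtain ⟨L, hL, rfl⟩ := Option.map_eq_some_iff.1 h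
  exact ⟨L, hL, gridLayer_chunk (C.disjoint _ _ _ hL)
    (fun q hq => mem_seen_of_ordered (by rw [hL]; exact hq)) _ _ _ _ _⟩

variable (hctrl : C'.ctrl = gridCtrl tk n₁ n₂ C.ctrl)

include hctrl in
theorem length_timesteps_le (i : Input) (h' : History) : (C'.timesteps i h').length ≤
    (4 * tk.moveLength + 1) * (C.timesteps i (splitHistory tk.moveLength h').1).length := by
  refine le_trans (Nat.le_add_right _ _) (block_bound (a := fun h => (C.ctrl i h).toList.length)
    (A := fun h => (C.timesteps i h).length) (a' := fun h' => (C'.ctrl i h').toList.length)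
    (A' := fun h' => (C'.timesteps i h').length) le_rfl
    (fun o h => by simp [timesteps]) le_rfl (fun o h => by simp [timesteps]) (fun h' => ?_) h')
  cases hL' : C'.ctrl i h' with
  | none => simp
  | some L' =>
    rw [hctrl] at hL'
    obtain ⟨L, hL, _⟩ := gridLayer_gridCtrl hL'
    rw [hL]
    simp

theorem length_seen_le (ctrl : Input → History → Option (List (Instr ℕ))) (i : Input)
    (o : List ℕ) (h : History) : (seen ctrl i h).length ≤ (seen ctrl i (o :: h)).length :=
  (seen_suffix ctrl i o h).length_le

include hctrl in
theorem length_flatten_timesteps_le (i : Input) (h' : History) :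
    (C'.timesteps i h').flatten.length ≤ (4 * tk.moveLength + 1) *
      (2 * (seen C.ctrl i (splitHistory tk.moveLength h').1).length *
        (C.timesteps i (splitHistory tk.moveLength h').1).flatten.length) := by
  refine le_trans (Nat.le_add_right _ _) (block_bound
    (a := fun h => 2 * (seen C.ctrl i h).length * (C.ctrl i h).toList.flatten.length)
    (A := fun h => 2 * (seen C.ctrl i h).length * (C.timesteps i h).flatten.length)
    (a' := fun h' => (C'.ctrl i h').toList.flatten.length)
    (A' := fun h' => (C'.timesteps i h').flatten.length) le_rfl
    (fun o h => ?_) le_rfl (fun o h => by simp [timesteps]) (fun h' => ?_) h')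
  · simp only [timesteps, List.flatten_append, List.length_append, Nat.mul_add]
    -- The number of qubits seen can only grow, so earlier operations are cheaply charged at the
    -- present, larger number.
    exact Nat.add_le_add_left (Nat.mul_le_mul_right _ (Nat.mul_le_mul_left _
      (length_seen_le C.ctrl i o h))) _
  · cases hL' : C'.ctrl i h' with
    | none => simp
    | some L' =>
      rw [hctrl] at hL'
      obtain ⟨L, hL, hgl⟩ := gridLayer_gridCtrl hL'
      rw [hL]
      simpa using hgl.length_le

theorem square_mono {k k' : ℕ} (h : k ≤ k') : square k ⊆ square k' := by
  intro p hp
  rw [mem_square] at *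
  omega

include hctrl in
theorem mem_square_of_timesteps (i : Input) (h' : History) : ∀ L ∈ C'.timesteps i h', ∀ a ∈ L,
    ∀ q ∈ a.qubits, q ∈ square (seen C.ctrl i (splitHistory tk.moveLength h').1).length := by
  have key : ∀ h' L, C'.ctrl i h' = some L → ∀ a ∈ L, ∀ q ∈ a.qubits,
      q ∈ square (seen C.ctrl i (splitHistory tk.moveLength h').1).length := by
    intro h' L hL
    rw [hctrl] at hL
    obtain ⟨_, _, hgl⟩ := gridLayer_gridCtrl hL
    exact hgl.mem_square
  induction h' with
  | nil =>
    intro L hL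
    exact key _ _ (Option.mem_toList.1 hL)
  | cons o h' ih =>
    intro L hL a ha q hq
    rcases List.mem_append.1 hL with hL | hL
    · exact key _ _ (Option.mem_toList.1 hL) a ha q hq
    · refine square_mono ?_ (ih L hL a ha q hq)
      rw [splitHistory_cons]
      split_ifs
      · exact length_seen_le _ _ _ _
      · exact le_rfl

theorem exists_block (μ : ℕ) (h' : History) :
    ∃ l b, h' = l ++ b ∧ splitHistory μ b = ((splitHistory μ h').1, []) := by
  induction h' with
  | nil => exact ⟨[], [], rfl, rfl⟩
  | cons o h' ih =>
    obtain ⟨l, b, hb, hs⟩ := ih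
    rw [splitHistory_cons]
    split_ifs with hw
    · exact ⟨[], o :: h', rfl, by rw [splitHistory_cons, if_pos hw]⟩
    · exact ⟨o :: l, b, by rw [hb]; rfl, hs⟩

theorem run_ne_zero {Q : Type} [Coded Q] [DecidableEq Q] {adj : Q → Q → Prop}
    {C : Circuit B Q adj} {i : Input} {ρ : QState Q} {l h : History}
    (hne : C.run i ρ (l ++ h) ≠ 0) : C.run i ρ h ≠ 0 := by
  induction l with
  | nil => exact hne
  | cons o l ih =>
    refine ih fun h0 => hne ?_
    rw [List.cons_append, run]
    cases C.ctrl i (l ++ h) with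
    | none => rfl
    | some L => simp only [h0]; exact actLayer_zero _ _ _

variable (ht : tk.Valid C'.one C'.two) (h₁ : ∀ g, C'.one (g + n₁) = C.one g)
  (h₂ : ∀ g, C'.two (g + n₂) = C.two g) (hseed : C'.seedLen = C.seedLen)

include hctrl ht h₁ h₂ hseed in
-- A nonzero state was nonzero at the end of the last complete block, where `exists_weights` makes
-- it a multiple of the placed state of `C`; so that state is nonzero as well.
theorem isRun_of_isRun {l m : ℕ} {i : Input} {h' : History} (h : C'.IsRun column l m i h') :
    C.IsRun id l m i (splitHistory tk.moveLength h').1 := by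
  obtain ⟨hx, hm, hr, ρ, hρ, hne⟩ := h
  refine ⟨hx, hm, hseed ▸ hr, ρ, hρ, ?_⟩
  obtain ⟨l, b, hb, hs⟩ := exists_block tk.moveLength h'
  rw [hb] at hne
  have hne' := run_ne_zero hne
  obtain ⟨c, hc, _⟩ := exists_weights hctrl ht h₁ h₂ i ρ (splitHistory tk.moveLength h').1
  rw [hc b hs] at hne'
  exact QState.place_ne_zero (right_ne_zero_of_smul hne')

theorem mem_seen {i : Input} {h : History} {q : ℕ} (hq : q ∈ seen C.ctrl i h) :
    q < i.m ∨ ∃ L ∈ C.timesteps i h, ∃ a ∈ L, q ∈ a.qubits := by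
  have key : ∀ h, q ∈ orderedQubits (C.ctrl i h) → ∃ L ∈ (C.ctrl i h).toList, ∃ a ∈ L,
      q ∈ a.qubits := by
    intro h hq
    unfold orderedQubits at hq
    cases hL : C.ctrl i h with
    | none => simp [hL] at hq
    | some L => simpa [hL] using hq
  induction h with
  | nil =>
    rw [seen, mem_foldl_insertNew] at hq
    rcases hq with hq | hq
    · exact Or.inr (key [] hq)
    · exact Or.inl (by simpa using hq)
  | cons o h ih =>
    rw [seen, mem_foldl_insertNew] at hq
    rcases hq with hq | hq
    · obtain ⟨L, hL, h'⟩ := key _ hq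
      exact Or.inr ⟨L, List.mem_append_left _ hL, h'⟩
    · rcases ih hq with h' | ⟨L, hL, h'⟩
      · exact Or.inl h'
      · exact Or.inr ⟨L, List.mem_append_right _ hL, h'⟩

/-- The list of qubits seen has no repetitions and contains only input qubits and qubits acted on in
this run. So the number of rows in use is bounded by the width of `C`. -/
theorem length_seen_le_used {m : ℕ} {i : Input} {h : History}
    (hr : C.IsRun id i.x.length m i h) :
    ((seen C.ctrl i h).length : ℕ∞) ≤ (C.used id m i.x).encard := by
  rw [← List.toFinset_card_of_nodup (seen_nodup C.ctrl i h), ← Set.encard_coe_eq_coe_finsetCard]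
  refine Set.encard_le_encard fun q hq => ?_
  rcases mem_seen (List.mem_toFinset.1 (Finset.mem_coe.1 hq)) with h' | h'
  · exact Or.inl ⟨q, hr.2.1 ▸ h', rfl⟩
  · exact Or.inr ⟨i, h, rfl, hr, h'⟩

include hctrl ht h₁ h₂ hseed in
theorem depth_le (l m : ℕ) : CCNTC.depth C' l m ≤
    ((4 * tk.moveLength + 1 : ℕ) : ℕ∞) * CCAC.depth C l m := by
  refine iSup_le fun i => iSup_le fun h' => iSup_le fun hr => ?_
  have h1 : ((C'.timesteps i h').length : ℕ∞) ≤ ((4 * tk.moveLength + 1 : ℕ) : ℕ∞) *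
      ((C.timesteps i (splitHistory tk.moveLength h').1).length : ℕ∞) := by
    exact_mod_cast length_timesteps_le hctrl i h'
  refine h1.trans (mul_le_mul_right ?_ _)
  exact le_iSup_of_le i (le_iSup_of_le _ (le_iSup_of_le
    (isRun_of_isRun hctrl ht h₁ h₂ hseed hr) le_rfl))

include hctrl ht h₁ h₂ hseed in
theorem size_le (l m : ℕ) : CCNTC.size C' l m ≤
    ((2 * (4 * tk.moveLength + 1) : ℕ) : ℕ∞) * (CCAC.size C l m * CCAC.width C l m) := by
  refine iSup_le fun i => iSup_le fun h' => iSup_le fun hr => ?_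
  have hr' := isRun_of_isRun hctrl ht h₁ h₂ hseed hr
  set h := (splitHistory tk.moveLength h').1 with hh
  have h1 : ((C'.timesteps i h').flatten.length : ℕ∞) ≤
      ((2 * (4 * tk.moveLength + 1) : ℕ) : ℕ∞) * (((C.timesteps i h).flatten.length : ℕ∞) *
        ((seen C.ctrl i h).length : ℕ∞)) := by
    have := length_flatten_timesteps_le hctrl i h'
    rw [← hh] at this
    have h2 : (C'.timesteps i h').flatten.length ≤ 2 * (4 * tk.moveLength + 1) *
        ((C.timesteps i h).flatten.length * (seen C.ctrl i h).length) :=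
      this.trans_eq (by ring)
    exact_mod_cast h2
  refine h1.trans (mul_le_mul_right (mul_le_mul' ?_ ?_) _)
  · exact le_iSup_of_le i (le_iSup_of_le _ (le_iSup_of_le hr' le_rfl))
  · obtain ⟨hx, _⟩ := id hr'
    exact (length_seen_le_used (by rw [hx]; exact hr')).trans
      (le_iSup_of_le i.x (le_iSup_of_le hx le_rfl))

include hctrl ht h₁ h₂ hseed in
theorem width_le (l m : ℕ) : CCNTC.width C' l m ≤ CCAC.width C l m ^ 2 := by
  refine iSup_le fun x => iSup_le fun hx => ?_
  have hle : (C.used id m x).encard ≤ CCAC.width C l m :=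
    le_iSup_of_le x (le_iSup_of_le hx le_rfl)
  -- If infinitely many qubits are used there is nothing to show; otherwise their number `k` is the
  -- side of the square.
  by_cases htop : (C.used id m x).encard = ⊤
  · rw [htop, top_le_iff] at hle
    rw [hle]
    exact le_top.trans_eq (by simp)
  · obtain ⟨k, hk⟩ := ENat.ne_top_iff_exists.1 htop
    -- The input qubits count as used even if nothing acts on them, so the m sites of the input fit
    -- into the square.
    have hm : m ≤ k := by
      have h1 : ((Finset.range m : Set ℕ)).encard ≤ (C.used id m x).encard :=
        Set.encard_le_encard fun j hj => Or.inl ⟨j, by simpa using hj, rfl⟩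
      rw [Set.encard_coe_eq_coe_finsetCard, Finset.card_range, ← hk] at h1
      exact_mod_cast h1
    have hsub : C'.used column m x ⊆ Set.Ico 0 (0 + (k : ℤ)) ×ˢ Set.Ico 0 (0 + (k : ℤ)) := by
      rw [zero_add]
      change _ ⊆ square k
      rintro q (⟨j, hj, rfl⟩ | ⟨i, h', rfl, hr, L, hL, a, ha, hq⟩)
      · rw [mem_square, column]
        simp only
        omega
      · have hr' := isRun_of_isRun hctrl ht h₁ h₂ hseed hr
        have h1 := length_seen_le_used hr'
        rw [← hk] at h1
        exact square_mono (by exact_mod_cast h1)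
          (mem_square_of_timesteps hctrl i h' L hL a ha q hq)
    have h1 : (⨅ (a : ℤ) (b : ℤ) (k : ℕ)
        (_ : C'.used column m x ⊆ Set.Ico a (a + k) ×ˢ Set.Ico b (b + k)), ((k ^ 2 : ℕ) : ℕ∞)) ≤
        ((k ^ 2 : ℕ) : ℕ∞) :=
      iInf_le_of_le (0 : ℤ) (iInf_le_of_le (0 : ℤ) (iInf_le_of_le k (iInf_le_of_le hsub le_rfl)))
    refine h1.trans ?_
    rw [← hk] at hle
    push_cast
    exact pow_le_pow_left' hle 2

end Accounting

/-- The circuit on the grid that simulates `C`. -/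
def gridCircuit {B : GateSet} (tk : Toolkit) (E₁ : List (Instrument Bool))
    (E₂ : List (Instrument (Bool × Bool))) (hE₁ : ∀ E ∈ E₁, E ∈ B.one)
    (hE₂ : ∀ E ∈ E₂, E ∈ B.two) (C : CCAC B) : CCNTC B where
  one := prepend E₁ C.one
  one_mem := prepend_mem hE₁ C.one_mem
  two := prepend E₂ C.two
  two_mem := prepend_mem hE₂ C.two_mem
  seedLen := C.seedLen
  ctrl := gridCtrl tk E₁.length E₂.length C.ctrl
  polyTime := PolyTime.gridCtrl tk _ _ C.polyTime
  disjoint i h' L' hL' := by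
    obtain ⟨_, _, hgl⟩ := gridLayer_gridCtrl hL'
    exact hgl.nodup
  adjacent i h' L' hL' := by
    obtain ⟨_, _, hgl⟩ := gridLayer_gridCtrl hL'
    exact hgl.adjacent

end CC

theorem mainTheorem2 (B : CC.GateSet) (hB : B.IsUniversal) (hM : B.HasMeasurement) :
    ∃ (K : ℕ) (E₁ : List (CC.Instrument Bool)) (E₂ : List (CC.Instrument (Bool × Bool))),
      ∀ C : CC.CCAC B, ∃ C' : CC.CCNTC B,
        CC.Simulates C' C ∧
        C'.one = CC.prepend E₁ C.one ∧ C'.two = CC.prepend E₂ C.two ∧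
        ∀ l m : ℕ,
          CC.CCNTC.depth C' l m ≤ K * CC.CCAC.depth C l m ∧
          CC.CCNTC.size C' l m ≤ K * (CC.CCAC.size C l m * CC.CCAC.width C l m) ∧
          CC.CCNTC.width C' l m ≤ CC.CCAC.width C l m ^ 2 := by
  obtain ⟨tk, E₁, E₂, hE₁, hE₂, ht⟩ := CC.exists_toolkit hB hM
  -- A timestep becomes four moves and the operations themselves; the factor 2 is needed for the
  -- size only, because of the two rows of each pair.
  refine ⟨2 * (4 * tk.moveLength + 1), E₁, E₂, fun C => ?_⟩
  have h₁ : ∀ g, CC.prepend E₁ C.one (g + E₁.length) = C.one g := CC.prepend_add _ _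
  have h₂ : ∀ g, CC.prepend E₂ C.two (g + E₂.length) = C.two g := CC.prepend_add _ _
  refine ⟨CC.gridCircuit tk E₁ E₂ hE₁ hE₂ C, CC.simulates_of_ctrl rfl (ht _ _) h₁ h₂ rfl, rfl, rfl,
    fun l m => ⟨?_, ?_, ?_⟩⟩
  · refine (CC.depth_le rfl (ht _ _) h₁ h₂ rfl l m).trans (mul_le_mul_left ?_ _)
    exact_mod_cast Nat.le_mul_of_pos_left _ two_pos
  · exact CC.size_le rfl (ht _ _) h₁ h₂ rfl l m
  · exact CC.width_le rfl (ht _ _) h₁ h₂ rfl l m
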